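/- Theorem 1.1. A non-increasing sequence $\pi=(d_1,\dots,d_n)$ of nonnegative integers is graphic if it is the degree sequence of a simple graph on $n$ vertices (a realization of $\pi$); write $\sigma(\pi)=d_1+\dots+d_n$. For a graph $H$, $\pi$ is potentially $H$-graphic if some realization of $\pi$ contains $H$ as a (not necessarily induced) subgraph, and $\sigma(H,n)$ denotes the minimum even integer $l$ such that every $n$-term graphic sequence $\pi$ with $\sigma(\pi)\ge l$ is potentially $H$-graphic. Let $K_3\cup P_3$ be the disjoint union of a triangle and a path with three edges (four vertices), and for $r\ge 6$ let $K_{r+1}-(K_3\cup P_3)$ be the graph obtained from the complete graph $K_{r+1}$ by deleting the edges of a copy of $K_3\cup P_3$. If $r\ge 6$ and $n\ge 5r+18$, then $$\sigma(K_{r+1}-(K_3\cup P_3),n)=\begin{cases}(r-1)(2n-r)-3(n-r)-1,&\text{if } n-r \text{ is odd},\\(r-1)(2n-r)-3(n-r),&\text{if } n-r\text{ is even}.\end{cases}$$ -/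

import Mathlib

/-- `G`, a simple graph on the `n` vertices `0, …, n - 1`, realizes the sequence `d`:
vertex `i` has degree `d i`. -/
def Realizes {n : ℕ} (G : SimpleGraph (Fin n)) (d : Fin n → ℕ) : Prop :=
  ∀ i, (G.neighborSet i).ncard = d i

/-- An `n`-term graphic sequence: a non-increasing sequence of nonnegative integers that is the
degree sequence of some simple graph on `n` vertices. -/
def IsGraphic {n : ℕ} (d : Fin n → ℕ) : Prop :=
  Antitone d ∧ ∃ G : SimpleGraph (Fin n), Realizes G d

/-- `d` is potentially `H`-graphic: some realization of `d` contains `H` as a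
(not necessarily induced) subgraph. -/
def PotentiallyGraphic {V : Type*} (H : SimpleGraph V) {n : ℕ} (d : Fin n → ℕ) : Prop :=
  ∃ G : SimpleGraph (Fin n), Realizes G d ∧ H.IsContained G

/-- `l = σ(H, n)`: `l` is the minimum even integer such that every `n`-term graphic sequence
with sum at least `l` is potentially `H`-graphic. -/
def IsSigma {V : Type*} (H : SimpleGraph V) (n : ℕ) (l : ℤ) : Prop :=
  IsLeast {l : ℤ | Even l ∧
    ∀ d : Fin n → ℕ, IsGraphic d → l ≤ ∑ i, (d i : ℤ) → PotentiallyGraphic H d} l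

/-- `K_m - H`: the complete graph on `m` vertices with the edges of (a copy of) `H` removed,
where `f` says how `H` sits inside `K_m`. -/
def completeMinus {W : Type*} {m : ℕ} (H : SimpleGraph W) (f : W ↪ Fin m) :
    SimpleGraph (Fin m) :=
  (⊤ : SimpleGraph (Fin m)) \ H.map f

/-- `K_3 ∪ P_3`: the disjoint union of a triangle and a path with `3` edges
(hence on `4` vertices). -/
def triangleUnionPath : SimpleGraph (Fin 3 ⊕ Fin 4) :=
  SimpleGraph.sum (⊤ : SimpleGraph (Fin 3)) (SimpleGraph.pathGraph 4)

/-- `K_3 ∪ P_3` fits inside `K_{r+1}` as soon as `r ≥ 6`. -/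
theorem nonempty_triangleUnionPath_embedding {r : ℕ} (hr : 6 ≤ r) :
    Nonempty (Fin 3 ⊕ Fin 4 ↪ Fin (r + 1)) :=
  ⟨finSumFinEquiv.toEmbedding.trans (Fin.castLEEmb (by omega))⟩

open Finset
set_option linter.unusedSectionVars false

/-! Put `m = (2r-5)n - r² + 4r - 1`. The asserted value is `m` or `m + 1`, whichever is even.

Lower bound. Four vertices of `K_3 ∪ P_3` span at most three edges, so any four vertices of `K_{r+1}
- (K_3 ∪ P_3)` span at least three. Join `K_{r-3}` to a perfect matching or, if parity forbids this,
to a matching plus a path with two edges. The degree sum is two below the asserted value. In every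
realization the `r - 3` full degrees belong to dominating vertices, and four of the other vertices
have degree sum at most five among themselves (`not_potentiallyGraphic`).

Upper bound. A sum of at least `m` bounds several degrees from below (`degrees_of_le_sum`) and
leaves three cases, according to whether at least `r - 2`, exactly `r - 3` or exactly `r - 4`
entries are at least `r`. Each has a core on `r + 1` vertices that contains the target graph: a
clique on the large vertices joined to three independent vertices, to a 4-cycle or a 4-vertex path
(which is its own complement), or to `K_{2,3}` plus an edge. In the last two cases the vertices
outside the clique get exactly their demanded degrees from the core, up to one edge.

The core is extended to a realization by saturating the vertices one at a time, in order of
decreasing demand. If this fails at `c`, an extremal graph (`Stuck`) is analysed by edge exchanges.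
The vertices treated outside the core form a clique `D`, completely joined to the set `X` of core
vertices with neighbours in the untreated remainder, and to every deficient vertex of the remainder
(`Layout`). If `X` is the whole core, the Erdős–Gallai inequality is violated (`Stuck.layout_ne`).
Otherwise edge counts over `D` bound everything in terms of the core vertices outside `X`, and the
degree sum comes out too small (`Layout.false_of_four_le`, `Stuck.false_of_large_core`). With three
independent vertices, those have to be saturated first, which needs its own analysis
(`Stuck.false_of_join`). -/

open scoped Classical in
/-- The adjacency indicator of a graph. -/
noncomputable def adjInd {V : Type*} (F : SimpleGraph V) (v w : V) : ℕ := if F.Adj v w then 1 else 0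

/-- The degree of `v` in `F`, as a sum of adjacency indicators. -/
noncomputable def dg {V : Type*} [Fintype V] (F : SimpleGraph V) (v : V) : ℕ := ∑ w, adjInd F v w

/-! ### Degrees, one-edge changes, and the Erdős–Gallai inequality. -/

section Basic

variable {V : Type*}

theorem adjInd_comm (F : SimpleGraph V) (v w : V) : adjInd F v w = adjInd F w v := by
  by_cases h : F.Adj v w
  · simp [adjInd, h, h.symm]
  · have h' : ¬ F.Adj w v := fun h' => h h'.symm
    simp [adjInd, h, h']

theorem adjInd_of_adj {F : SimpleGraph V} {v w : V} (h : F.Adj v w) : adjInd F v w = 1 := by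
  simp [adjInd, h]

theorem adjInd_of_not {F : SimpleGraph V} {v w : V} (h : ¬ F.Adj v w) : adjInd F v w = 0 := by
  simp [adjInd, h]

theorem adjInd_self (F : SimpleGraph V) (v : V) : adjInd F v v = 0 := by simp [adjInd]

theorem adjInd_le_one (F : SimpleGraph V) (v w : V) : adjInd F v w ≤ 1 := by
  unfold adjInd; split_ifs <;> simp

theorem sum_adjInd_eq_card (F : SimpleGraph V) [DecidableRel F.Adj] (X : Finset V) (v : V) :
    ∑ w ∈ X, adjInd F v w = #{w ∈ X | F.Adj v w} := by
  rw [card_filter]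
  exact sum_congr rfl fun w _ => by unfold adjInd; congr

theorem dg_eq_ncard [Fintype V] (F : SimpleGraph V) (v : V) : (F.neighborSet v).ncard = dg F v := by
  classical
  rw [dg, sum_adjInd_eq_card, Set.ncard_eq_toFinset_card']
  congr 1; ext w; simp

theorem sum_adjInd_le_card (F : SimpleGraph V) (X : Finset V) (v : V) :
    ∑ w ∈ X, adjInd F v w ≤ #X := by
  simpa using sum_le_card_nsmul X (adjInd F v) 1 fun w _ => adjInd_le_one F v w

theorem sum_adjInd_of_forall {F : SimpleGraph V} {X : Finset V} {v : V}
    (h : ∀ w ∈ X, F.Adj v w) : ∑ w ∈ X, adjInd F v w = #X := by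
  rw [sum_congr rfl fun w hw => adjInd_of_adj (h w hw)]; simp

theorem sum_adjInd_of_forall_ne [DecidableEq V] {F : SimpleGraph V} {X : Finset V} {v : V}
    (hv : v ∈ X) (h : ∀ w ∈ X, w ≠ v → F.Adj v w) : ∑ w ∈ X, adjInd F v w = #X - 1 := by
  rw [← add_sum_erase X _ hv, adjInd_self, zero_add, sum_adjInd_of_forall, card_erase_of_mem hv]
  intro w hw
  exact h w (mem_of_mem_erase hw) (ne_of_mem_erase hw)

theorem sum_adjInd_of_forall_not {F : SimpleGraph V} {X : Finset V} {v : V}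
    (h : ∀ w ∈ X, ¬ F.Adj v w) : ∑ w ∈ X, adjInd F v w = 0 :=
  sum_eq_zero fun w hw => adjInd_of_not (h w hw)

theorem sum_adjInd_le_card_sub_one [DecidableEq V] (F : SimpleGraph V) {X : Finset V} {v : V}
    (hv : v ∈ X) : ∑ w ∈ X, adjInd F v w ≤ #X - 1 := by
  rw [← add_sum_erase X _ hv, adjInd_self, zero_add, ← card_erase_of_mem hv]
  exact sum_adjInd_le_card F _ v

theorem sum_sum_adjInd_comm (F : SimpleGraph V) (X Y : Finset V) :
    ∑ x ∈ X, ∑ y ∈ Y, adjInd F x y = ∑ y ∈ Y, ∑ x ∈ X, adjInd F y x := by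
  rw [sum_comm]
  exact sum_congr rfl fun y _ => sum_congr rfl fun x _ => adjInd_comm F x y

theorem dg_le_card_sub_one [Fintype V] (F : SimpleGraph V) (v : V) :
    dg F v ≤ Fintype.card V - 1 := by
  classical
  exact sum_adjInd_le_card_sub_one F (mem_univ v)

theorem even_sum_dg [Fintype V] (F : SimpleGraph V) : Even (∑ v, dg F v) := by
  classical
  have h := F.sum_degrees_eq_twice_card_edges
  have : ∑ v, dg F v = ∑ v, F.degree v := by
    refine sum_congr rfl fun v _ => ?_
    rw [dg, sum_adjInd_eq_card, ← F.card_neighborFinset_eq_degree, F.neighborFinset_eq_filter]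
  rw [this, h]; exact even_two_mul _

/-- The necessity half of the Erdős–Gallai theorem, for an arbitrary set of vertices. -/
theorem sum_dg_le [Fintype V] [DecidableEq V] (G : SimpleGraph V) (X : Finset V) :
    ∑ v ∈ X, dg G v ≤ #X * (#X - 1) + ∑ v ∈ Xᶜ, min #X (dg G v) := by
  have h1 : ∀ v, dg G v = ∑ w ∈ X, adjInd G v w + ∑ w ∈ Xᶜ, adjInd G v w := fun v =>
    (sum_add_sum_compl X _).symm
  rw [sum_congr rfl fun v _ => h1 v, sum_add_distrib, sum_sum_adjInd_comm G X Xᶜ]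
  refine add_le_add ?_ ?_
  · calc _ ≤ ∑ _v ∈ X, (#X - 1) := sum_le_sum fun v hv => sum_adjInd_le_card_sub_one G hv
      _ = _ := by simp
  · refine sum_le_sum fun v _ => le_min (sum_adjInd_le_card G X v) ?_
    rw [h1 v]; exact Nat.le_add_right _ _

/-- `F` with the edge `ab` added. -/
def addE (F : SimpleGraph V) (a b : V) : SimpleGraph V := F ⊔ SimpleGraph.edge a b

/-- `F` with the edge `ab` deleted. -/
def delE (F : SimpleGraph V) (a b : V) : SimpleGraph V := F \ SimpleGraph.edge a b

theorem addE_adj {F : SimpleGraph V} {a b : V} (h : a ≠ b) {x y : V} :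
    (addE F a b).Adj x y ↔ F.Adj x y ∨ (x = a ∧ y = b) ∨ (x = b ∧ y = a) := by
  simp only [addE, SimpleGraph.sup_adj, SimpleGraph.edge_adj]
  constructor
  · rintro (h1 | ⟨h1, _⟩) <;> tauto
  · rintro (h1 | ⟨rfl, rfl⟩ | ⟨rfl, rfl⟩) <;> tauto

theorem delE_adj {F : SimpleGraph V} {a b x y : V} :
    (delE F a b).Adj x y ↔ F.Adj x y ∧ ¬ ((x = a ∧ y = b) ∨ (x = b ∧ y = a)) := by
  simp only [delE, SimpleGraph.sdiff_adj, SimpleGraph.edge_adj]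
  have := F.ne_of_adj (a := x) (b := y)
  tauto

theorem dg_addE [Fintype V] [DecidableEq V] {F : SimpleGraph V} {a b : V} (hab : a ≠ b)
    (h : ¬ F.Adj a b) (v : V) :
    dg (addE F a b) v = dg F v + ((if v = a then 1 else 0) + (if v = b then 1 else 0)) := by
  have key : ∀ w, adjInd (addE F a b) v w = adjInd F v w +
      ((if w = b then (if v = a then 1 else 0) else 0) +
       (if w = a then (if v = b then 1 else 0) else 0)) := by
    intro w
    have h' : ¬ F.Adj b a := fun h1 => h h1.symm
    by_cases h1 : F.Adj v w
    · rw [adjInd_of_adj h1, adjInd_of_adj ((addE_adj hab).2 (Or.inl h1))]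
      have h2 : v = a → w ≠ b := by rintro rfl rfl; exact h h1
      have h3 : v = b → w ≠ a := by rintro rfl rfl; exact h' h1
      by_cases h4 : v = a <;> by_cases h5 : v = b <;> simp_all
    · rw [adjInd_of_not h1]
      by_cases h2 : (v = a ∧ w = b) ∨ (v = b ∧ w = a)
      · rw [adjInd_of_adj ((addE_adj hab).2 (Or.inr h2))]
        rcases h2 with ⟨rfl, rfl⟩ | ⟨rfl, rfl⟩
        · simp [hab]
        · simp [hab]
      · rw [adjInd_of_not (fun h3 => ((addE_adj hab).1 h3).elim h1 h2)]
        by_cases h4 : v = a <;> by_cases h5 : v = b <;> simp_all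
  simp only [dg, key, sum_add_distrib, sum_ite_eq', mem_univ, if_true]

theorem addE_delE {F : SimpleGraph V} {a b : V} (h : F.Adj a b) : addE (delE F a b) a b = F := by
  ext x y
  rw [addE_adj h.ne, delE_adj]
  have := h.symm
  constructor
  · rintro (h1 | ⟨rfl, rfl⟩ | ⟨rfl, rfl⟩) <;> tauto
  · tauto

theorem dg_delE [Fintype V] [DecidableEq V] {F : SimpleGraph V} {a b : V} (h : F.Adj a b) (v : V) :
    dg F v = dg (delE F a b) v + ((if v = a then 1 else 0) + (if v = b then 1 else 0)) := by
  conv_lhs => rw [← addE_delE h]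
  exact dg_addE h.ne (by simp [delE_adj]) v

end Basic

/-! ### Edge exchanges at a vertex whose degree cannot be raised. -/

section Switching

variable {V : Type*} [Fintype V] [DecidableEq V]

theorem le_addE {Φ F : SimpleGraph V} (h : Φ ≤ F) (a b : V) : Φ ≤ addE F a b :=
  h.trans le_sup_left

theorem le_delE {Φ F : SimpleGraph V} (h : Φ ≤ F) {a b : V} (hab : ¬ Φ.Adj a b) :
    Φ ≤ delE F a b := by
  intro u w huw
  rw [delE_adj]
  refine ⟨h huw, ?_⟩
  rintro (⟨rfl, rfl⟩ | ⟨rfl, rfl⟩)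
  · exact hab huw
  · exact hab huw.symm

/-- `F` contains `Φ`, its degrees are at most `d`, with equality on `L`. -/
structure Good (d : V → ℕ) (Φ : SimpleGraph V) (L : Finset V) (F : SimpleGraph V) : Prop where
  le : Φ ≤ F
  bd : ∀ v, dg F v ≤ d v
  sat : ∀ v ∈ L, dg F v = d v

/-- `F` maximizes the degree of `c` among the graphs that contain `Φ`, have degrees at most `d`,
and attain `d` on `L`; still it does not attain `d c`.  Outside `L ∪ {c}` there are no edges. -/
structure Stuck (d : V → ℕ) (Φ : SimpleGraph V) (L : Finset V) (c : V) (F : SimpleGraph V) :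
    Prop where
  good : Good d Φ L F
  even : Even (∑ v, d v)
  notMem : c ∉ L
  lt : dg F c < d c
  max : ∀ F', Good d Φ L F' → dg F' c ≤ dg F c
  free : ∀ s ∉ L, ∀ s' ∉ L, ¬ Φ.Adj s s'
  indep : ∀ s ∉ L, s ≠ c → ∀ t ∉ L, t ≠ c → ¬ F.Adj s t

/-- The vertex `m` has at least the demand of `c`, and no forced neighbours that `c` lacks. -/
def Dominates (d : V → ℕ) (Φ : SimpleGraph V) (c m : V) : Prop :=
  d c ≤ d m ∧ ∀ w, Φ.Adj m w → Φ.Adj c w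

/-- Otherwise the transposition of `c` and `m` would map the neighbours of `m` to neighbours of `c`.
-/
theorem exists_adj_not_adj {F : SimpleGraph V} {c m : V} (h : dg F c < dg F m) :
    ∃ w, w ≠ c ∧ F.Adj m w ∧ ¬ F.Adj c w := by
  by_contra! hcon
  refine absurd h (not_lt.2 ?_)
  unfold dg
  rw [← Equiv.sum_comp (Equiv.swap c m) (fun w => adjInd F c w)]
  refine sum_le_sum fun w _ => ?_
  by_cases h1 : F.Adj m w
  · by_cases h2 : w = c
    · subst h2
      rw [Equiv.swap_apply_left, adjInd_comm]
    · rw [Equiv.swap_apply_of_ne_of_ne h2 h1.ne', adjInd_of_adj (hcon w h2 h1)]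
      exact adjInd_le_one _ _ _
  · rw [adjInd_of_not h1]; exact Nat.zero_le _

/-- Since `m'` is a neighbour of `c` but not of `m`, there is a second witness besides `w₀`.
Otherwise the neighbours of `m` would inject into those of `c`, with `c` going to `m` and `w₀` to
`m'`. -/
theorem exists_adj_not_adj_ne {F : SimpleGraph V} {c m m' w₀ : V} (h : dg F c < dg F m)
    (hmc : F.Adj c m) (hmc' : F.Adj c m') (hmm : ¬ F.Adj m m') (hne : m ≠ m')
    (hw₀ : ¬ F.Adj c w₀) (hw₀c : w₀ ≠ c) :
    ∃ w, w ≠ c ∧ w ≠ w₀ ∧ F.Adj m w ∧ ¬ F.Adj c w := by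
  by_contra! hcon
  refine absurd h (not_lt.2 ?_)
  unfold dg
  rw [← Equiv.sum_comp ((Equiv.swap c m).trans (Equiv.swap w₀ m')) (fun w => adjInd F c w)]
  refine sum_le_sum fun w _ => ?_
  have h1 : w₀ ≠ m := by rintro rfl; exact hw₀ hmc
  have h2 : w₀ ≠ m' := by rintro rfl; exact hw₀ hmc'
  by_cases h3 : F.Adj m w
  · rw [Equiv.trans_apply]
    refine (adjInd_le_one _ _ _).trans (adjInd_of_adj ?_).ge
    by_cases h4 : w = c
    · subst h4
      rwa [Equiv.swap_apply_left, Equiv.swap_apply_of_ne_of_ne h1.symm hne]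
    · rw [Equiv.swap_apply_of_ne_of_ne h4 h3.ne']
      by_cases h5 : w = w₀
      · subst h5
        rwa [Equiv.swap_apply_left]
      · rw [Equiv.swap_apply_of_ne_of_ne h5 (by rintro rfl; exact hmm h3)]
        exact hcon w h4 h5 h3
  · rw [adjInd_of_not h3]; exact Nat.zero_le _

namespace Stuck

variable {d : V → ℕ} {Φ F F' : SimpleGraph V} {L : Finset V} {c m m' s x y : V}

theorem ne_of_mem (h : Stuck d Φ L c F) (hx : x ∈ L) : x ≠ c := by
  rintro rfl; exact h.notMem hx

theorem mem_of_not_deficient (h : Stuck d Φ L c F) (hs : dg F s < d s) : s ∉ L := fun hL =>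
  absurd (h.good.sat s hL) hs.ne

theorem false_of_gain (h : Stuck d Φ L c F) (hΦ : Φ ≤ F') (hL : ∀ v ∈ L, dg F' v = dg F v)
    (hb : ∀ v, dg F' v ≤ d v) (hc : dg F c < dg F' c) : False :=
  absurd (h.max F' ⟨hΦ, hb, fun v hv => (hL v hv).trans (h.good.sat v hv)⟩) (not_le.2 hc)

/-- An exchange that preserves the degree of `c` yields another extremal graph, to which all
adjacency lemmas apply again. -/
theorem switch (h : Stuck d Φ L c F) (hΦ : Φ ≤ F') (hL : ∀ v ∈ L, dg F' v = dg F v)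
    (hb : ∀ v, dg F' v ≤ d v) (hc : dg F' c = dg F c)
    (hi : ∀ s ∉ L, s ≠ c → ∀ s' ∉ L, s' ≠ c → ¬ F'.Adj s s') : Stuck d Φ L c F' where
  good := ⟨hΦ, hb, fun v hv => (hL v hv).trans (h.good.sat v hv)⟩
  even := h.even
  notMem := h.notMem
  lt := hc ▸ h.lt
  max := fun F'' h'' => hc ▸ h.max F'' h''
  free := h.free
  indep := hi

/-- A vertex with a deficiency is adjacent to `c`. -/
theorem adj_of_deficient (h : Stuck d Φ L c F) (hsc : s ≠ c) (hs : dg F s < d s) :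
    F.Adj s c := by
  by_contra hn
  have hd := dg_addE hsc hn
  have hsL := h.mem_of_not_deficient hs
  have hlt := h.lt
  refine h.false_of_gain (le_addE h.good.le s c) (fun v hv => ?_) (fun v => ?_) ?_
  · have h1 := hd v
    have h2 : v ≠ s := by rintro rfl; exact hsL hv
    simpa [h2, h.ne_of_mem hv] using h1
  · have h1 := hd v
    have := h.good.bd v
    split_ifs at h1 with h2 h3 h3
    · exact absurd (h2.symm.trans h3) hsc
    · subst h2; omega
    · subst h3; omega
    · omega
  · have h1 := hd c
    simp [hsc.symm] at h1
    omega

/-- The total deficiency is a difference of two even sums, so it cannot equal one. -/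
theorem exists_deficient (h : Stuck d Φ L c F) (h1 : d c = dg F c + 1) :
    ∃ s, s ≠ c ∧ dg F s < d s := by
  by_contra! hcon
  have h2 : ∑ v, d v = ∑ v, dg F v + 1 := by
    rw [← add_sum_erase _ _ (mem_univ c), ← add_sum_erase _ (fun v => dg F v) (mem_univ c),
      sum_congr rfl fun v hv => le_antisymm (hcon v (ne_of_mem_erase hv)) (h.good.bd v), h1]
    ring
  have h3 := h.even
  rw [h2, Nat.even_add_one] at h3
  exact h3 (even_sum_dg F)

/-- No admissible graph raises the degree of `c` by two without changing the degrees in `L`. -/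
theorem false_of_gain_two (h : Stuck d Φ L c F) (hΦ : Φ ≤ F') (hL : ∀ v ∈ L, dg F' v = dg F v)
    (hb : ∀ v ≠ c, dg F' v ≤ d v) (hc : dg F' c = dg F c + 2)
    (hadj : ∀ s ∉ L, s ≠ c → F.Adj s c → F'.Adj s c) : False := by
  have hlt := h.lt
  -- If `c` lacks only one edge, a gain of two overshoots. Parity then provides another deficient
  -- vertex `s`, and deleting the edge `sc` leaves a gain of one.
  by_cases h1 : d c = dg F c + 1
  · obtain ⟨s, hsc, hs⟩ := h.exists_deficient h1
    have hsL := h.mem_of_not_deficient hs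
    have hs' := hadj s hsL hsc (h.adj_of_deficient hsc hs)
    have hd := dg_delE hs'
    refine h.false_of_gain (le_delE hΦ (h.free s hsL c h.notMem)) (fun v hv => ?_) (fun v => ?_) ?_
    · have h2 := hd v
      have h3 : v ≠ s := by rintro rfl; exact hsL hv
      rw [← hL v hv, h2]
      simp [h3, h.ne_of_mem hv]
    · have h2 := hd v
      by_cases h3 : v = c
      · subst h3; simp [hsc.symm] at h2; omega
      · have := hb v h3
        omega
    · have h2 := hd c
      simp [hsc.symm] at h2
      omega
  · refine h.false_of_gain hΦ hL (fun v => ?_) (by omega)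
    by_cases h3 : v = c
    · subst h3; omega
    · exact hb v h3

/-- A saturated vertex with a removable edge out of `L ∪ {c}` is adjacent to `c`. -/
theorem adj_of_free_adj (h : Stuck d Φ L c F) (hx : x ∈ L) (hs : s ∉ L) (hsc : s ≠ c)
    (hxs : F.Adj x s) (hfree : ¬ Φ.Adj x s) : F.Adj x c := by
  by_contra hn
  have hxc := h.ne_of_mem hx
  -- Exchange `xs` for `xc`.
  have h1 := dg_delE hxs
  have hn' : ¬ (delE F x s).Adj x c := fun h' => hn (delE_adj.1 h').1
  have h2 := dg_addE hxc hn'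
  have hlt := h.lt
  refine h.false_of_gain (le_addE (le_delE h.good.le hfree) x c) (fun v hv => ?_) (fun v => ?_) ?_
  · have h3 : v ≠ s := by rintro rfl; exact hs hv
    rw [h1 v, h2 v]
    simp [h3, h.ne_of_mem hv]
  · have := h1 v
    have := h2 v
    have := h.good.bd v
    by_cases h4 : v = c
    · subst h4; simp [hxc.symm, hsc.symm] at *; omega
    · simp [h4] at *; omega
  · have := h1 c
    have := h2 c
    simp [hxc.symm, hsc.symm] at *; omega

/-- Of two saturated vertices joined by a removable edge, one is adjacent to `c`. -/
theorem adj_or_adj_of_free_adj (h : Stuck d Φ L c F) (hx : x ∈ L) (hy : y ∈ L)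
    (hxy : F.Adj x y) (hfree : ¬ Φ.Adj x y) : F.Adj x c ∨ F.Adj y c := by
  by_contra! hn
  obtain ⟨hnx, hny⟩ := hn
  have hxc := h.ne_of_mem hx
  have hyc := h.ne_of_mem hy
  -- Exchange `xy` for `xc` and `yc`: the degrees of `x` and `y` are kept, that of `c` rises by two.
  have h1 := dg_delE hxy
  have hn1 : ¬ (delE F x y).Adj x c := fun h' => hnx (delE_adj.1 h').1
  have h2 := dg_addE hxc hn1
  have hn2 : ¬ (addE (delE F x y) x c).Adj y c := by
    rw [addE_adj hxc, delE_adj]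
    have := hxy.ne
    tauto
  have h3 := dg_addE hyc hn2
  have heq : ∀ v ≠ c, dg (addE (addE (delE F x y) x c) y c) v = dg F v := by
    intro v hv
    rw [h1 v, h3 v, h2 v]
    simp [hv]
    ring
  refine h.false_of_gain_two (le_addE (le_addE (le_delE h.good.le hfree) x c) y c)
    (fun v hv => heq v (h.ne_of_mem hv)) (fun v hv => (heq v hv).trans_le (h.good.bd v)) ?_ ?_
  · have := h1 c
    have := h2 c
    have := h3 c
    simp [hxc.symm, hyc.symm] at *; omega
  · intro s hs hsc hadj
    rw [addE_adj hyc, addE_adj hxc, delE_adj]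
    have h4 : s ≠ x := by rintro rfl; exact hs hx
    have h5 : s ≠ y := by rintro rfl; exact hs hy
    tauto

theorem not_forced (h : Stuck d Φ L c F) (hm : Dominates d Φ c m) (hx : ¬ F.Adj c x) :
    ¬ Φ.Adj m x := fun h' => hx (h.good.le (hm.2 x h'))

theorem dg_lt (h : Stuck d Φ L c F) (hmL : m ∈ L) (hm : Dominates d Φ c m) :
    dg F c < dg F m := by
  rw [h.good.sat m hmL]; exact h.lt.trans_le hm.1

/-- A saturated vertex that dominates `c` is adjacent to `c`. -/
theorem adj_of_dominates (h : Stuck d Φ L c F) (hmL : m ∈ L) (hm : Dominates d Φ c m) :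
    F.Adj m c := by
  by_contra hn
  -- The edge `mw` is removable, because forced neighbours of `m` are neighbours of `c`.
  obtain ⟨w, hwc, hmw, hcw⟩ := exists_adj_not_adj (h.dg_lt hmL hm)
  have hfree := h.not_forced hm hcw
  by_cases hw : w ∈ L
  · rcases h.adj_or_adj_of_free_adj hmL hw hmw hfree with h1 | h1
    · exact hn h1
    · exact hcw h1.symm
  · exact hn (h.adj_of_free_adj hmL hw hwc hmw hfree)

/-- Two saturated vertices that dominate `c` are adjacent. -/
theorem adj_of_dominates_of_dominates (h : Stuck d Φ L c F) (hmL : m ∈ L)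
    (hm : Dominates d Φ c m) (hmL' : m' ∈ L) (hm' : Dominates d Φ c m') (hne : m ≠ m') :
    F.Adj m m' := by
  by_contra hn
  have hmc := h.adj_of_dominates hmL hm
  have hmc' := h.adj_of_dominates hmL' hm'
  obtain ⟨w, hwc, hmw, hcw⟩ := exists_adj_not_adj (h.dg_lt hmL hm)
  obtain ⟨w', hwc', hww, hmw', hcw'⟩ := exists_adj_not_adj_ne (h.dg_lt hmL' hm') hmc'.symm
    hmc.symm (fun h' => hn h'.symm) hne.symm hcw hwc
  have hne1 := h.ne_of_mem hmL
  have hne2 := h.ne_of_mem hmL'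
  have hwm : w ≠ m := hmw.ne'
  have hwm' : w ≠ m' := by rintro rfl; exact hn hmw
  have hw'm : w' ≠ m := by rintro rfl; exact hn hmw'.symm
  have hw'm' : w' ≠ m' := hmw'.ne'
  -- Exchange `mw` and `m'w'` for `mm'`, `wc` and `w'c`: only the degree of `c` changes, by two.
  have h1 := dg_delE hmw
  have a2 : (delE F m w).Adj m' w' := by rw [delE_adj]; tauto
  have h2 := dg_delE a2
  have a3 : ¬ (delE (delE F m w) m' w').Adj m m' := by rw [delE_adj, delE_adj]; tauto
  have h3 := dg_addE hne a3
  have hcw1 : ¬ F.Adj w c := fun h' => hcw h'.symm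
  have hcw1' : ¬ F.Adj w' c := fun h' => hcw' h'.symm
  have a4 : ¬ (addE (delE (delE F m w) m' w') m m').Adj w c := by
    rw [addE_adj hne, delE_adj, delE_adj]; tauto
  have h4 := dg_addE hwc a4
  have a5 : ¬ (addE (addE (delE (delE F m w) m' w') m m') w c).Adj w' c := by
    rw [addE_adj hwc, addE_adj hne, delE_adj, delE_adj]; tauto
  have h5 := dg_addE hwc' a5
  have heq : ∀ v ≠ c, dg (addE (addE (addE (delE (delE F m w) m' w') m m') w c) w' c) v
      = dg F v := by
    intro v hv
    rw [h1 v, h2 v, h5 v, h4 v, h3 v]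
    simp [hv]
    ring
  refine h.false_of_gain_two (le_addE (le_addE (le_addE (le_delE (le_delE h.good.le
    (h.not_forced hm hcw)) (h.not_forced hm' hcw')) _ _) _ _) _ _)
    (fun v hv => heq v (h.ne_of_mem hv)) (fun v hv => (heq v hv).trans_le (h.good.bd v)) ?_ ?_
  · have := h1 c
    have := h2 c
    have := h3 c
    have := h4 c
    have := h5 c
    simp [hne1.symm, hne2.symm, hwc.symm, hwc'.symm] at *; omega
  · intro s hs hsc hadj
    rw [addE_adj hwc', addE_adj hwc, addE_adj hne, delE_adj, delE_adj]
    have h4 : s ≠ m := by rintro rfl; exact hs hmL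
    have h5 : s ≠ m' := by rintro rfl; exact hs hmL'
    tauto

/-- A saturated vertex with a removable edge out of `L ∪ {c}` is adjacent to the saturated
vertices that dominate `c`. -/
theorem adj_of_free_adj_of_dominates (h : Stuck d Φ L c F) (hx : x ∈ L) (hs : s ∉ L)
    (hsc : s ≠ c) (hxs : F.Adj x s) (hfree : ¬ Φ.Adj x s) (hmL : m ∈ L)
    (hm : Dominates d Φ c m) (hne : x ≠ m) : F.Adj x m := by
  by_contra hn
  have hxc := h.adj_of_free_adj hx hs hsc hxs hfree
  obtain ⟨w, hwc, hmw, hcw⟩ := exists_adj_not_adj (h.dg_lt hmL hm)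
  have hxne := h.ne_of_mem hx
  have hmne := h.ne_of_mem hmL
  have hwx : w ≠ x := by rintro rfl; exact hcw hxc.symm
  have hsm : s ≠ m := by rintro rfl; exact hs hmL
  have hlt := h.lt
  -- Exchange `xs` and `mw` for `xm` and `wc`: `s` loses an edge and `c` gains one.
  have h1 := dg_delE hxs
  have a2 : (delE F x s).Adj m w := by
    rw [delE_adj]
    have := hne.symm
    tauto
  have h2 := dg_delE a2
  have a3 : ¬ (delE (delE F x s) m w).Adj x m := by rw [delE_adj, delE_adj]; tauto
  have h3 := dg_addE hne a3
  have a4 : ¬ (addE (delE (delE F x s) m w) x m).Adj w c := by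
    rw [addE_adj hne, delE_adj, delE_adj]
    have := fun h' : F.Adj w c => hcw h'.symm
    tauto
  have h4 := dg_addE hwc a4
  refine h.false_of_gain (le_addE (le_addE (le_delE (le_delE h.good.le hfree)
    (h.not_forced hm hcw)) x m) w c) (fun v hv => ?_) (fun v => ?_) ?_
  · have hv1 : v ≠ s := by rintro rfl; exact hs hv
    rw [h1 v, h2 v, h4 v, h3 v]
    simp [hv1, h.ne_of_mem hv]
    ring
  · have := h1 v
    have := h2 v
    have := h3 v
    have := h4 v
    have := h.good.bd v
    by_cases h5 : v = c
    · subst h5; simp [hxne.symm, hsc.symm, hmne.symm, hwc.symm] at *; omega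
    · simp only [h5, if_false, add_zero] at *; omega
  · have := h1 c
    have := h2 c
    have := h3 c
    have := h4 c
    simp [hxne.symm, hsc.symm, hmne.symm, hwc.symm] at *; omega

/-- A vertex with a deficiency is adjacent to the saturated vertices that dominate `c`. -/
theorem adj_of_deficient_of_dominates (h : Stuck d Φ L c F) (hsc : s ≠ c) (hs : dg F s < d s)
    (hmL : m ∈ L) (hm : Dominates d Φ c m) : F.Adj s m := by
  by_contra hn
  have hsL := h.mem_of_not_deficient hs
  have hadj := h.adj_of_deficient hsc hs
  obtain ⟨w, hwc, hmw, hcw⟩ := exists_adj_not_adj (h.dg_lt hmL hm)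
  have hmne := h.ne_of_mem hmL
  have hws : w ≠ s := by rintro rfl; exact hcw hadj.symm
  have hsm : s ≠ m := by rintro rfl; exact hsL hmL
  have hlt := h.lt
  -- Exchange `mw` for `sm` and `wc`.
  have h1 := dg_delE hmw
  have a2 : ¬ (delE F m w).Adj s m := by rw [delE_adj]; tauto
  have h2 := dg_addE hsm a2
  have a3 : ¬ (addE (delE F m w) s m).Adj w c := by
    rw [addE_adj hsm, delE_adj]
    have := fun h' : F.Adj w c => hcw h'.symm
    tauto
  have h3 := dg_addE hwc a3
  refine h.false_of_gain (le_addE (le_addE (le_delE h.good.le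
    (h.not_forced hm hcw)) s m) w c) (fun v hv => ?_) (fun v => ?_) ?_
  · have hv1 : v ≠ s := by rintro rfl; exact hsL hv
    rw [h1 v, h3 v, h2 v]
    simp [hv1, h.ne_of_mem hv]
    ring
  · have := h1 v
    have := h2 v
    have := h3 v
    have := h.good.bd v
    by_cases h5 : v = c
    · subst h5; simp [hsc.symm, hmne.symm, hwc.symm] at *; omega
    · by_cases h6 : v = s
      · subst h6; simp [hws.symm, hsm, hsc] at *; omega
      · simp only [h5, h6, if_false, add_zero, zero_add] at *; omega
  · have := h1 c
    have := h2 c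
    have := h3 c
    simp [hsc.symm, hmne.symm, hwc.symm] at *; omega

end Stuck
end Switching

/-! ### Saturating the vertices one by one. -/

section Completion

variable {V : Type*} [Fintype V] [DecidableEq V]

namespace Stuck

variable {d : V → ℕ} {Φ F : SimpleGraph V} {L : Finset V} {c m s x y : V}

/-- A deficiency of `s` can be moved to a neighbour `y` of a saturated vertex `x`. -/
theorem stuck_move (h : Stuck d Φ L c F) (hx : x ∈ L) (hy : y ∉ L) (hyc : y ≠ c)
    (hsc : s ≠ c) (hxy : F.Adj x y) (hfree : ¬ Φ.Adj x y) (hxs : ¬ F.Adj x s)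
    (hs : dg F s < d s) :
    Stuck d Φ L c (addE (delE F x y) x s) ∧ dg (addE (delE F x y) x s) y < d y := by
  have hsL := h.mem_of_not_deficient hs
  have hxs' : x ≠ s := by rintro rfl; exact hsL hx
  have hys : y ≠ s := by rintro rfl; exact hxs hxy
  have hxc := h.ne_of_mem hx
  have h1 := dg_delE hxy
  have a2 : ¬ (delE F x y).Adj x s := by rw [delE_adj]; tauto
  have h2 := dg_addE hxs' a2
  refine ⟨h.switch (le_addE (le_delE h.good.le hfree) x s) (fun v hv => ?_) (fun v => ?_) ?_ ?_, ?_⟩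
  · have h3 : v ≠ s := by rintro rfl; exact hsL hv
    have h4 : v ≠ y := by rintro rfl; exact hy hv
    rw [h1 v, h2 v]; simp [h3, h4]
  · have := h1 v
    have := h2 v
    have := h.good.bd v
    by_cases h5 : v = s
    · subst h5; simp [hys.symm, hxs'.symm] at *; omega
    · simp only [h5, if_false, add_zero] at *; omega
  · rw [h1 c, h2 c]; simp [hxc.symm, hyc.symm, hsc.symm]
  · intro u hu huc u' hu' huc'
    rw [addE_adj hxs', delE_adj]
    have := h.indep u hu huc u' hu' huc'
    have h3 : u ≠ x := by rintro rfl; exact hu hx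
    have h4 : u' ≠ x := by rintro rfl; exact hu' hx
    tauto
  · have := h1 y
    have := h2 y
    have := h.good.bd y
    simp [hys, hxy.ne'] at *; omega

/-- After the move `y` is deficient in a graph that is still stuck. The move adds no edge at `y`, so
the adjacencies found there already hold in `F`. -/
theorem adj_of_move (h : Stuck d Φ L c F) (hx : x ∈ L) (hy : y ∉ L) (hyc : y ≠ c)
    (hsc : s ≠ c) (hxy : F.Adj x y) (hfree : ¬ Φ.Adj x y) (hxs : ¬ F.Adj x s)
    (hs : dg F s < d s) :
    F.Adj y c ∧ ∀ m ∈ L, Dominates d Φ c m → F.Adj y m := by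
  obtain ⟨h1, h2⟩ := h.stuck_move hx hy hyc hsc hxy hfree hxs hs
  have hsL := h.mem_of_not_deficient hs
  have hxs' : x ≠ s := by rintro rfl; exact hsL hx
  have hys : y ≠ s := by rintro rfl; exact hxs hxy
  have key : ∀ m, (addE (delE F x y) x s).Adj y m → F.Adj y m := by
    intro m hm
    rw [addE_adj hxs', delE_adj] at hm
    have := hxy.ne'
    tauto
  exact ⟨key _ (h1.adj_of_deficient hyc h2), fun m hm hd =>
    key _ (h1.adj_of_deficient_of_dominates hyc h2 hm hd)⟩

/-- If two nonadjacent saturated vertices have removable edges to `y` and `y'`, then `y` is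
adjacent to `c` and to the saturated vertices that dominate `c`. -/
theorem adj_of_not_adj {x' y' : V} (h : Stuck d Φ L c F) (hx : x ∈ L) (hx' : x' ∈ L)
    (hne : x ≠ x') (hxx : ¬ F.Adj x x') (hy : y ∉ L) (hyc : y ≠ c) (hy' : y' ∉ L) (hyc' : y' ≠ c)
    (hxy : F.Adj x y) (hxy' : F.Adj x' y') (hfree : ¬ Φ.Adj x y) (hfree' : ¬ Φ.Adj x' y') :
    F.Adj y c ∧ ∀ m ∈ L, Dominates d Φ c m → F.Adj y m := by
  have hxc := h.ne_of_mem hx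
  have hxc' := h.ne_of_mem hx'
  -- Exchange `xy` and `x'y'` for `xx'`: the graph stays stuck and `y` becomes deficient.
  have h1 := dg_delE hxy
  have a2 : (delE F x y).Adj x' y' := by
    rw [delE_adj]
    have h3 : x' ≠ y := by rintro rfl; exact hy hx'
    have := hne.symm
    tauto
  have h2 := dg_delE a2
  have a3 : ¬ (delE (delE F x y) x' y').Adj x x' := by rw [delE_adj, delE_adj]; tauto
  have h3 := dg_addE hne a3
  have hyx : y ≠ x := hxy.ne'
  have hyx' : y ≠ x' := by rintro rfl; exact hy hx'
  have hle : ∀ v ∉ L, dg (addE (delE (delE F x y) x' y') x x') v ≤ dg F v := by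
    intro v hv
    have := h1 v
    have := h2 v
    have := h3 v
    have h5 : v ≠ x := by rintro rfl; exact hv hx
    have h6 : v ≠ x' := by rintro rfl; exact hv hx'
    simp only [h5, h6, if_false] at *
    omega
  have heq : ∀ v ∈ L, dg (addE (delE (delE F x y) x' y') x x') v = dg F v := by
    intro v hv
    have h5 : v ≠ y := by rintro rfl; exact hy hv
    have h6 : v ≠ y' := by rintro rfl; exact hy' hv
    rw [h1 v, h2 v, h3 v]
    simp [h5, h6]; ring
  have h4 : Stuck d Φ L c (addE (delE (delE F x y) x' y') x x') := by
    refine h.switch (le_addE (le_delE (le_delE h.good.le hfree) hfree') x x') heq (fun v => ?_) ?_ ?_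
    · by_cases hv : v ∈ L
      · rw [heq v hv]; exact h.good.bd v
      · exact (hle v hv).trans (h.good.bd v)
    · rw [h1 c, h2 c, h3 c]; simp [hxc.symm, hyc.symm, hxc'.symm, hyc'.symm]
    · intro u hu huc u' hu' huc'
      rw [addE_adj hne, delE_adj, delE_adj]
      have := h.indep u hu huc u' hu' huc'
      have h3 : u ≠ x := by rintro rfl; exact hu hx
      have h4 : u ≠ x' := by rintro rfl; exact hu hx'
      tauto
  have h5 : dg (addE (delE (delE F x y) x' y') x x') y < d y := by
    have := h1 y
    have := h2 y
    have := h3 y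
    have := h.good.bd y
    simp [hyx, hyx'] at *; omega
  have key : ∀ m, (addE (delE (delE F x y) x' y') x x').Adj y m → F.Adj y m := by
    intro m hm
    rw [addE_adj hne, delE_adj, delE_adj] at hm
    tauto
  exact ⟨key _ (h4.adj_of_deficient hyc h5), fun m hm hd =>
    key _ (h4.adj_of_deficient_of_dominates hyc h5 hm hd)⟩

/-- If `L ∪ {c}` is a clique and the deficient vertices are adjacent to all of it, then `d` is
not graphic. -/
theorem false_of_clique (h : Stuck d Φ L c F) {G : SimpleGraph V} (hG : ∀ v, dg G v = d v)
    (hK : ∀ x ∈ insert c L, ∀ y ∈ insert c L, x ≠ y → F.Adj x y)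
    (hdef : ∀ s ∉ insert c L, dg F s < d s → ∀ x ∈ insert c L, F.Adj s x) : False := by
  set K := insert c L with hKdef
  -- The degrees of `F` on `K` already reach the Erdős–Gallai bound: `K` is a clique, a deficient
  -- outer vertex sends `#K` edges to it, and a saturated one sends all its edges there. Yet the
  -- demand on `K` is strictly larger.
  have hEG := sum_dg_le G K
  simp only [hG] at hEG
  have hlt : ∑ v ∈ K, dg F v < ∑ v ∈ K, d v :=
    sum_lt_sum (fun v _ => h.good.bd v) ⟨c, mem_insert_self _ _, h.lt⟩
  have h1 : ∀ v, dg F v = ∑ w ∈ K, adjInd F v w + ∑ w ∈ Kᶜ, adjInd F v w := fun v =>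
    (sum_add_sum_compl K _).symm
  rw [sum_congr rfl fun v _ => h1 v, sum_add_distrib, sum_sum_adjInd_comm F K Kᶜ,
    sum_congr rfl fun v hv => sum_adjInd_of_forall_ne hv fun w hw hwv => hK v hv w hw hwv.symm,
    sum_const, smul_eq_mul] at hlt
  have h2 : ∑ v ∈ Kᶜ, min #K (d v) ≤ ∑ v ∈ Kᶜ, ∑ w ∈ K, adjInd F v w := by
    refine sum_le_sum fun s hs => ?_
    rw [mem_compl] at hs
    by_cases hsd : dg F s < d s
    · rw [sum_adjInd_of_forall (hdef s hs hsd)]; exact min_le_left _ _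
    · refine (min_le_right _ _).trans ?_
      have h3 := h1 s
      rw [sum_adjInd_of_forall_not (X := Kᶜ)] at h3
      · omega
      · intro w hw
        rw [mem_compl] at hw
        rw [hKdef, mem_insert, not_or] at hs hw
        exact h.indep s hs.2 hs.1 w hw.2 hw.1
  omega

end Stuck

/-- Take an admissible graph with the largest degree at `c`. If it falls short of `d c`, deleting
the edges that avoid `insert c L` affects neither the forced edges nor the degrees on `insert c L`,
and makes it stuck. -/
theorem Good.exists_good_insert_or_stuck {d : V → ℕ} {Φ F : SimpleGraph V} {L : Finset V} {c : V}
    (hF : Good d Φ L F) (hc : c ∉ L) (heven : Even (∑ v, d v))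
    (hfree : ∀ s ∉ L, ∀ s' ∉ L, ¬ Φ.Adj s s') :
    (∃ F', Good d Φ (insert c L) F') ∨ ∃ F', Stuck d Φ L c F' := by
  obtain ⟨F₁, hF₁, hmax⟩ := Set.exists_max_image {F | Good d Φ L F} (fun F => dg F c)
    (Set.toFinite _) ⟨F, hF⟩
  by_cases h1 : dg F₁ c = d c
  · refine Or.inl ⟨F₁, hF₁.le, hF₁.bd, fun v hv => ?_⟩
    rcases mem_insert.1 hv with rfl | hv
    · exact h1
    · exact hF₁.sat v hv
  · right
    let F₂ : SimpleGraph V :=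
      { Adj := fun x y => F₁.Adj x y ∧ (x ∈ insert c L ∨ y ∈ insert c L)
        symm := ⟨fun x y hxy => ⟨hxy.1.symm, hxy.2.symm⟩⟩
        loopless := ⟨fun x hx => F₁.irrefl hx.1⟩ }
    have hind : ∀ v w, adjInd F₂ v w ≤ adjInd F₁ v w := by
      intro v w
      by_cases h2 : F₂.Adj v w
      · rw [adjInd_of_adj h2, adjInd_of_adj h2.1]
      · rw [adjInd_of_not h2]; exact Nat.zero_le _
    have hdg : ∀ v, dg F₂ v ≤ dg F₁ v := fun v => sum_le_sum fun w _ => hind v w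
    have hdg' : ∀ v ∈ insert c L, dg F₂ v = dg F₁ v := by
      intro v hv
      refine sum_congr rfl fun w _ => ?_
      by_cases h2 : F₁.Adj v w
      · rw [adjInd_of_adj h2, adjInd_of_adj (show F₂.Adj v w from ⟨h2, Or.inl hv⟩)]
      · rw [adjInd_of_not h2, adjInd_of_not (fun h' : F₂.Adj v w => h2 h'.1)]
    have hgood : Good d Φ L F₂ := by
      refine ⟨fun x y hxy => ⟨hF₁.le hxy, ?_⟩, fun v => (hdg v).trans (hF₁.bd v), fun v hv => ?_⟩
      · by_contra! hcon
        exact hfree x (fun h' => hcon.1 (mem_insert_of_mem h')) y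
          (fun h' => hcon.2 (mem_insert_of_mem h')) hxy
      · rw [hdg' v (mem_insert_of_mem hv), hF₁.sat v hv]
    have hcc := hdg' c (mem_insert_self _ _)
    refine ⟨F₂, hgood, heven, hc, ?_, fun F' hF' => ?_, hfree, ?_⟩
    · rw [hcc]; exact lt_of_le_of_ne (hF₁.bd c) h1
    · rw [hcc]; exact hmax F' hF'
    · intro s hs hsc s' hs' hsc' h2
      rcases h2.2 with h3 | h3
      · exact (mem_insert.1 h3).elim hsc hs
      · exact (mem_insert.1 h3).elim hsc' hs'

/-- A graph that attains `d` on `A` can be completed to a realization of `d`, by saturating the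
other vertices in the order of decreasing demand, unless it gets stuck. -/
theorem Good.exists_realization {d : V → ℕ} {Φ F : SimpleGraph V} {A : Finset V}
    (hF : Good d Φ A F) (heven : Even (∑ v, d v)) (hfree : ∀ x y, Φ.Adj x y → x ∈ A ∨ y ∈ A)
    (hstuck : ∀ M c F, Disjoint A M → (∀ m ∈ M, d c ≤ d m) →
      (∀ s, s ∉ A → s ∉ M → d s ≤ d c) → Stuck d Φ (A ∪ M) c F → False) :
    ∃ G, Φ ≤ G ∧ ∀ v, dg G v = d v := by
  have key : ∀ k M F, #(A ∪ M)ᶜ = k → Disjoint A M → Good d Φ (A ∪ M) F →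
      (∀ m ∈ M, ∀ s, s ∉ A → s ∉ M → d s ≤ d m) → ∃ G, Φ ≤ G ∧ ∀ v, dg G v = d v := by
    intro k
    induction k with
    | zero =>
      intro M F hk _ hF _
      rw [card_eq_zero, compl_eq_empty_iff] at hk
      exact ⟨F, hF.le, fun v => hF.sat v (hk ▸ mem_univ v)⟩
    | succ k ih =>
      intro M F hk hdis hF htop
      obtain ⟨c, hc, hmax⟩ := exists_max_image (A ∪ M)ᶜ d
        (card_pos.1 (by omega))
      rw [mem_compl] at hc
      have hcM := fun h' => hc (mem_union_right A h')
      have hcA := fun h' => hc (mem_union_left M h')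
      rcases hF.exists_good_insert_or_stuck hc heven
        (fun s hs s' hs' h' => (hfree s s' h').elim (fun h1 => hs (mem_union_left _ h1))
          fun h1 => hs' (mem_union_left _ h1)) with ⟨F', hF'⟩ | ⟨F', hF'⟩
      · refine ih (insert c M) F' ?_ ?_ ?_ ?_
        · rw [union_insert, compl_insert, card_erase_of_mem (mem_compl.2 hc)]; omega
        · rw [disjoint_insert_right]; exact ⟨hcA, hdis⟩
        · rw [union_insert]; exact hF'
        · intro m hm s hsA hsM
          rw [mem_insert, not_or] at hsM
          rcases mem_insert.1 hm with rfl | hm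
          · exact hmax s (by simp [hsA, hsM.2])
          · exact htop m hm s hsA hsM.2
      · exact (hstuck M c F' hdis (fun m hm => htop m hm c hcA hcM)
          (fun s hsA hsM => hmax s (by simp [hsA, hsM])) hF').elim
  exact key _ ∅ F rfl (disjoint_empty_right A) (by rwa [union_empty]) (by simp)

end Completion

/-! ### The shape of a stuck graph and its edge counts. -/

section Layout

variable {V : Type*} [Fintype V] [DecidableEq V]

/-- The shape of a stuck graph: `A` is the saturated core, `X ⊆ A` consists of its vertices with
neighbours in the remainder `S`, and `D` is the set of vertices treated so far, the last of which,
`c`, is deficient. -/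
structure Layout (d : V → ℕ) (F : SimpleGraph V) (A X D S : Finset V) (c : V) : Prop where
  mem : c ∈ D
  sub : X ⊆ A
  disj : Disjoint A D
  compl : S = (A ∪ D)ᶜ
  bd : ∀ v, dg F v ≤ d v
  satA : ∀ v ∈ A, dg F v = d v
  satD : ∀ v ∈ D, v ≠ c → dg F v = d v
  lt : dg F c < d c
  out : ∀ a ∈ X, ∃ s ∈ S, F.Adj a s
  inn : ∀ a ∈ A, a ∉ X → ∀ s ∈ S, ¬ F.Adj a s
  join : ∀ a ∈ X, ∀ b ∈ D, F.Adj a b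
  clique : ∀ b ∈ D, ∀ b' ∈ D, b ≠ b' → F.Adj b b'
  defi : ∀ s ∈ S, dg F s < d s → ∀ b ∈ D, F.Adj s b
  indep : ∀ s ∈ S, ∀ s' ∈ S, ¬ F.Adj s s'
  even : Even (∑ v, d v)

/-- Forced edges lie inside `A`, so the vertices of `M`, which have at least the demand of `c`, all
dominate `c`; the exchange lemmas then give each clause. -/
theorem Stuck.exists_layout {d : V → ℕ} {Φ F : SimpleGraph V} {A M : Finset V} {c : V}
    (h : Stuck d Φ (A ∪ M) c F) (hdis : Disjoint A M) (hM : ∀ m ∈ M, d c ≤ d m)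
    (hΦ : ∀ x y, Φ.Adj x y → x ∈ A ∧ y ∈ A) :
    (∀ m ∈ M, Dominates d Φ c m) ∧
      ∃ X, Layout d F A X (insert c M) (A ∪ insert c M)ᶜ c := by
  classical
  have hcA : c ∉ A := fun h' => h.notMem (mem_union_left _ h')
  have hcM : c ∉ M := fun h' => h.notMem (mem_union_right _ h')
  have hdom : ∀ m ∈ M, Dominates d Φ c m := fun m hm =>
    ⟨hM m hm, fun w hw => absurd (hΦ _ _ hw).1 (disjoint_right.1 hdis hm)⟩
  have hS : ∀ s, s ∈ (A ∪ insert c M)ᶜ ↔ s ∉ A ∪ M ∧ s ≠ c := by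
    intro s; simp only [mem_compl, mem_union, mem_insert]; tauto
  have hfree : ∀ x s, s ∈ (A ∪ insert c M)ᶜ → ¬ Φ.Adj x s := by
    intro x s hs hadj
    exact ((hS s).1 hs).1 (mem_union_left _ (hΦ _ _ hadj).2)
  refine ⟨hdom, {a ∈ A | ∃ s ∈ (A ∪ insert c M)ᶜ, F.Adj a s}, mem_insert_self _ _,
    filter_subset _ _, ?_, rfl, h.good.bd, fun v hv => h.good.sat v (mem_union_left _ hv), ?_, h.lt,
    fun a ha => (mem_filter.1 ha).2, ?_, ?_, ?_, ?_, ?_, h.even⟩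
  · rw [disjoint_insert_right]; exact ⟨hcA, hdis⟩
  · intro v hv hvc
    exact h.good.sat v (mem_union_right _ ((mem_insert.1 hv).resolve_left hvc))
  · intro a ha haX s hs hadj
    exact haX (mem_filter.2 ⟨ha, s, hs, hadj⟩)
  · intro a ha b hb
    obtain ⟨haA, s, hs, hadj⟩ := mem_filter.1 ha
    have hs' := (hS s).1 hs
    rcases mem_insert.1 hb with rfl | hb
    · exact h.adj_of_free_adj (mem_union_left _ haA) hs'.1 hs'.2 hadj (hfree a s hs)
    · exact h.adj_of_free_adj_of_dominates (mem_union_left _ haA) hs'.1 hs'.2 hadj (hfree a s hs)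
        (mem_union_right _ hb) (hdom b hb) (by rintro rfl; exact disjoint_left.1 hdis haA hb)
  · intro b hb b' hb' hne
    rcases mem_insert.1 hb with rfl | h1 <;> rcases mem_insert.1 hb' with rfl | h2
    · exact absurd rfl hne
    · exact (h.adj_of_dominates (mem_union_right _ h2) (hdom _ h2)).symm
    · exact h.adj_of_dominates (mem_union_right _ h1) (hdom _ h1)
    · exact h.adj_of_dominates_of_dominates (mem_union_right _ h1) (hdom _ h1)
        (mem_union_right _ h2) (hdom _ h2) hne
  · intro s hs hsd b hb
    have hs' := (hS s).1 hs
    rcases mem_insert.1 hb with rfl | hb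
    · exact h.adj_of_deficient hs'.2 hsd
    · exact h.adj_of_deficient_of_dominates hs'.2 hsd (mem_union_right _ hb) (hdom _ hb)
  · intro s hs s' hs'
    have h1 := (hS s).1 hs
    have h2 := (hS s').1 hs'
    exact h.indep s h1.1 h1.2 s' h2.1 h2.2

namespace Layout

variable {d : V → ℕ} {F : SimpleGraph V} {A X D S : Finset V} {c : V}

theorem dg_split (h : Layout d F A X D S c) (v : V) :
    dg F v = ∑ w ∈ A, adjInd F v w + ∑ w ∈ D, adjInd F v w + ∑ w ∈ S, adjInd F v w := by
  rw [← sum_union h.disj, h.compl, sum_add_sum_compl, dg]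

theorem card_split (h : Layout d F A X D S c) : #A + #D + #S = Fintype.card V := by
  rw [← card_union_of_disjoint h.disj, h.compl, card_add_card_compl]

theorem sum_split (h : Layout d F A X D S c) (f : V → ℕ) :
    ∑ v, f v = ∑ v ∈ A, f v + ∑ v ∈ D, f v + ∑ v ∈ S, f v := by
  rw [← sum_union h.disj, h.compl, sum_add_sum_compl]

theorem sum_A_split (h : Layout d F A X D S c) (f : V → ℕ) :
    ∑ v ∈ A, f v = ∑ v ∈ X, f v + ∑ v ∈ A \ X, f v := by
  rw [add_comm, sum_sdiff h.sub]

theorem dg_inn (h : Layout d F A X D S c) {a : V} (ha : a ∈ A \ X) :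
    d a = ∑ w ∈ A, adjInd F a w + ∑ w ∈ D, adjInd F a w := by
  rw [mem_sdiff] at ha
  rw [← h.satA a ha.1, h.dg_split, sum_adjInd_of_forall_not (h.inn a ha.1 ha.2), add_zero]

theorem card_pos (h : Layout d F A X D S c) : 1 ≤ #D := Finset.card_pos.2 ⟨c, h.mem⟩

theorem le_card_inn (h : Layout d F A X D S c) {a : V} (ha : a ∈ A \ X) :
    d a ≤ #A - 1 + #D := by
  rw [h.dg_inn ha]
  exact add_le_add (sum_adjInd_le_card_sub_one F (sdiff_subset ha)) (sum_adjInd_le_card F _ _)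

/-- The degree count over `D`. -/
theorem sum_D (h : Layout d F A X D S c) :
    ∑ b ∈ D, d b = #D * (#D - 1) + #D * #X + ∑ a ∈ A \ X, ∑ b ∈ D, adjInd F a b
      + ∑ b ∈ D, ∑ s ∈ S, adjInd F b s + (d c - dg F c) := by
  have h1 : ∑ b ∈ D, d b = ∑ b ∈ D, dg F b + (d c - dg F c) := by
    rw [← add_sum_erase _ _ h.mem, ← add_sum_erase _ (fun v => dg F v) h.mem]
    have h2 : ∑ v ∈ D.erase c, d v = ∑ v ∈ D.erase c, dg F v :=
      sum_congr rfl fun v hv => (h.satD v (mem_of_mem_erase hv) (ne_of_mem_erase hv)).symm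
    have := h.lt
    omega
  have h2 : ∀ b ∈ D, dg F b = #X + ∑ a ∈ A \ X, adjInd F b a + (#D - 1)
      + ∑ s ∈ S, adjInd F b s := by
    intro b hb
    rw [h.dg_split, h.sum_A_split, sum_adjInd_of_forall fun a ha => (h.join a ha b hb).symm,
      sum_adjInd_of_forall_ne hb fun b' hb' hne => h.clique b hb b' hb' hne.symm]
  rw [h1, sum_congr rfl h2]
  simp only [sum_add_distrib, sum_const, smul_eq_mul]
  rw [sum_sum_adjInd_comm F D (A \ X)]
  ring

/-- Each deficient vertex of `S` is joined to all of `D`. -/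
theorem card_deficient_mul_le (h : Layout d F A X D S c) :
    #{s ∈ S | dg F s < d s} * #D ≤ ∑ b ∈ D, ∑ s ∈ S, adjInd F b s := by
  rw [sum_sum_adjInd_comm, card_eq_sum_ones, sum_mul, sum_filter]
  refine sum_le_sum fun s hs => ?_
  split_ifs with h1
  · rw [sum_adjInd_of_forall (h.defi s hs h1), one_mul]
  · exact Nat.zero_le _

/-- By parity, `D` misses at least two. -/
theorem two_le (h : Layout d F A X D S c) :
    2 ≤ ∑ b ∈ D, ∑ s ∈ S, adjInd F b s + (d c - dg F c) := by
  have hlt := h.lt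
  by_contra! hcon
  -- With no edge between `D` and `S`, no vertex of `S` is deficient, so `c` alone carries a total
  -- deficiency of one, against parity.
  have h1 : d c - dg F c = 1 := by omega
  have h2 : #{s ∈ S | dg F s < d s} * #D = 0 := by
    have := h.card_deficient_mul_le; omega
  have hD := h.card_pos
  have h3 : {s ∈ S | dg F s < d s} = ∅ := by
    rw [← card_eq_zero]
    rcases Nat.mul_eq_zero.1 h2 with h3 | h3
    · exact h3
    · omega
  rw [filter_eq_empty_iff] at h3
  have h4 : ∑ v, d v = ∑ v, dg F v + 1 := by
    rw [← add_sum_erase _ _ (mem_univ c), ← add_sum_erase _ (fun v => dg F v) (mem_univ c)]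
    have h5 : ∑ v ∈ univ.erase c, d v = ∑ v ∈ univ.erase c, dg F v := by
      refine sum_congr rfl fun v hv => ?_
      have hvc := ne_of_mem_erase hv
      by_cases hvA : v ∈ A
      · exact (h.satA v hvA).symm
      · by_cases hvD : v ∈ D
        · exact (h.satD v hvD hvc).symm
        · have hvS : v ∈ S := by rw [h.compl]; simp [hvA, hvD]
          exact le_antisymm (not_lt.1 (h3 hvS)) (h.bd v)
    omega
  have h5 := h.even
  rw [h4, Nat.even_add_one] at h5
  exact h5 (even_sum_dg F)

/-- Vertices of `S` have neighbours only in `X` and `D`. A deficient one sees all of `D`, so its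
demand exceeds its edges to `D` by at most `Δ - #D`. -/
theorem sum_S (h : Layout d F A X D S c) {Δ : ℕ} (hΔ : ∀ s ∈ S, d s ≤ Δ) :
    ∑ s ∈ S, d s ≤ ∑ a ∈ X, ∑ s ∈ S, adjInd F a s + ∑ b ∈ D, ∑ s ∈ S, adjInd F b s
      + #{s ∈ S | dg F s < d s} * (Δ - #D) := by
  have h1 : ∀ s ∈ S, d s ≤ ∑ a ∈ X, adjInd F s a + ∑ b ∈ D, adjInd F s b
      + (if dg F s < d s then 1 else 0) * (Δ - #D) := by
    intro s hs
    have h2 : dg F s = ∑ a ∈ X, adjInd F s a + ∑ b ∈ D, adjInd F s b := by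
      rw [h.dg_split, h.sum_A_split, sum_adjInd_of_forall_not (h.indep s hs),
        sum_adjInd_of_forall_not (X := A \ X)]
      · ring
      · intro a ha hadj
        rw [mem_sdiff] at ha
        exact h.inn a ha.1 ha.2 s hs hadj.symm
    split_ifs with h3
    · have h4 := sum_adjInd_of_forall (h.defi s hs h3)
      have := hΔ s hs
      omega
    · omega
  refine (sum_le_sum h1).trans ?_
  rw [sum_add_distrib, sum_add_distrib, sum_sum_adjInd_comm F S X, sum_sum_adjInd_comm F S D,
    ← sum_mul, card_filter]

theorem _root_.sum_sum_adjInd_le (F : SimpleGraph V) (X S : Finset V) :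
    ∑ a ∈ X, ∑ s ∈ S, adjInd F a s ≤ #X * #S := by
  simpa using sum_le_card_nsmul X _ #S fun a _ => sum_adjInd_le_card F S a

end Layout
end Layout

/-! ### Layouts that cannot occur. -/

section Contradictions

variable {V : Type*} [Fintype V] [DecidableEq V]

/-- If every vertex of the core has a neighbour in the remainder, then `d` is not graphic. -/
theorem Stuck.layout_ne {d : V → ℕ} {Φ F : SimpleGraph V} {A M : Finset V} {c : V}
    (h : Stuck d Φ (A ∪ M) c F) (hΦ : ∀ x y, Φ.Adj x y → x ∈ A ∧ y ∈ A)
    (hdom : ∀ m ∈ M, Dominates d Φ c m) (hA : ∀ a ∈ A, d c ≤ d a)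
    {G : SimpleGraph V} (hG : ∀ v, dg G v = d v)
    (hl : Layout d F A A (insert c M) (A ∪ insert c M)ᶜ c) : False := by
  classical
  set D := insert c M with hD
  set S := (A ∪ D)ᶜ with hS
  have hmemS : ∀ s, s ∈ S ↔ s ∉ A ∪ M ∧ s ≠ c := by
    intro s; simp only [hS, hD, mem_compl, mem_union, mem_insert]; tauto
  have hfree : ∀ x s, s ∈ S → ¬ Φ.Adj x s := by
    intro x s hs hadj
    exact ((hmemS s).1 hs).1 (mem_union_left _ (hΦ _ _ hadj).2)
  set S₁ := {s ∈ S | ∀ b ∈ D, F.Adj s b} with hS₁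
  have hmem₁ : ∀ y ∈ S, (F.Adj y c ∧ ∀ m ∈ A ∪ M, Dominates d Φ c m → F.Adj y m) → y ∈ S₁ := by
    intro y hy hyy
    refine mem_filter.2 ⟨hy, fun b hb => ?_⟩
    rcases mem_insert.1 hb with rfl | hb
    · exact hyy.1
    · exact hyy.2 b (mem_union_right _ hb) (hdom b hb)
  -- `c` sees `A`, the rest of `D` and `S₁`, and still lacks an edge. Every `a ∈ A` demands at least
  -- as much, hence has more than `#S₁` neighbours in `S`.
  have hc1 : #A + #D + #S₁ ≤ d c := by
    have h1 := hl.dg_split c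
    have h2 : #S₁ ≤ ∑ s ∈ S, adjInd F c s := by
      rw [← sum_adjInd_of_forall (F := F) (X := S₁) (v := c) fun s hs =>
        ((mem_filter.1 hs).2 c hl.mem).symm]
      exact sum_le_sum_of_subset (filter_subset _ _)
    rw [sum_adjInd_of_forall fun a ha => (hl.join a ha c hl.mem).symm,
      sum_adjInd_of_forall_ne hl.mem fun b hb hne => hl.clique c hl.mem b hb hne.symm] at h1
    have := hl.lt
    have := hl.card_pos
    omega
  have hsub : ∀ a (Y : Finset V), (∀ y ∈ S, F.Adj a y → y ∈ Y) → ∑ s ∈ S, adjInd F a s ≤ #Y := by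
    intro a Y hY
    rw [sum_adjInd_eq_card]
    exact card_le_card fun y hy => hY y (mem_filter.1 hy).1 (mem_filter.1 hy).2
  -- If `a` misses a deficient `s`, moving the deficiency shows that all neighbours of `a` in `S`
  -- lie in `S₁.erase s`, which is too small.
  have hcomp : ∀ s ∈ S, dg F s < d s → ∀ a ∈ A, F.Adj s a := by
    intro s hs hsd a ha
    by_contra hn
    have hs' := (hmemS s).1 hs
    have h1 : ∑ s ∈ S, adjInd F a s ≤ #(S₁.erase s) := by
      refine hsub a _ fun y hy hay => mem_erase.2 ⟨?_, hmem₁ y hy ?_⟩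
      · rintro rfl; exact hn hay.symm
      · have hy' := (hmemS y).1 hy
        exact h.adj_of_move (mem_union_left _ ha) hy'.1 hy'.2 hs'.2 hay (hfree a y hy)
          (fun h' => hn h'.symm) hsd
    have hs1 : s ∈ S₁ := mem_filter.2 ⟨hs, hl.defi s hs hsd⟩
    rw [card_erase_of_mem hs1] at h1
    have h2 := sum_adjInd_le_card_sub_one F ha
    have h3 := sum_adjInd_le_card F D a
    have h4 := hl.dg_split a
    have h5 := hl.satA a ha
    have h6 := hA a ha
    have h7 := Finset.card_pos.2 ⟨s, hs1⟩
    have h8 := Finset.card_pos.2 ⟨a, ha⟩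
    omega
  -- Some neighbour `y ∈ S` of `a` lies outside `S₁`. If `a` and `a'` were not adjacent,
  -- `adj_of_not_adj` would put `y` into `S₁`.
  have hclq : ∀ a ∈ A, ∀ a' ∈ A, a ≠ a' → F.Adj a a' := by
    intro a ha a' ha' hne
    by_contra hn
    have h0 : ∃ y ∈ S, F.Adj a y ∧ y ∉ S₁ := by
      by_contra! hcon
      have h1 := hsub a S₁ hcon
      have h2 : ∑ w ∈ A, adjInd F a w ≤ #A - 1 - 1 := by
        rw [← add_sum_erase _ _ ha', adjInd_of_not hn, zero_add, ← card_erase_of_mem ha']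
        exact sum_adjInd_le_card_sub_one F (mem_erase.2 ⟨hne, ha⟩)
      have h3 := sum_adjInd_le_card F D a
      have h4 := hl.dg_split a
      have h5 := hl.satA a ha
      have h6 := hA a ha
      have h8 : 1 < #A := one_lt_card.2 ⟨a, ha, a', ha', hne⟩
      omega
    obtain ⟨y, hy, hay, hy₁⟩ := h0
    obtain ⟨y', hy', hay'⟩ := hl.out a' ha'
    have h1 := (hmemS y).1 hy
    have h2 := (hmemS y').1 hy'
    exact hy₁ (hmem₁ y hy (h.adj_of_not_adj (mem_union_left _ ha) (mem_union_left _ ha') hne hn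
      h1.1 h1.2 h2.1 h2.2 hay hay' (hfree a y hy) (hfree a' y' hy')))
  have hK : ∀ x, x ∈ insert c (A ∪ M) ↔ x ∈ A ∨ x ∈ D := by
    intro x; simp only [hD, mem_insert, mem_union]; tauto
  refine h.false_of_clique hG (fun x hx y hy hne => ?_) (fun s hs hsd x hx => ?_)
  · rcases (hK x).1 hx with hx | hx <;> rcases (hK y).1 hy with hy | hy
    · exact hclq x hx y hy hne
    · exact hl.join x hx y hy
    · exact (hl.join y hy x hx).symm
    · exact hl.clique x hx y hy hne
  · rw [hK] at hs
    have hsS : s ∈ S := by rw [hS]; simpa using hs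
    rcases (hK x).1 hx with hx | hx
    · exact hcomp s hsS hsd x hx
    · exact hl.defi s hsS hsd x hx

/-- Here `p`, `α`, `q` are the sizes of `X`, `A \ X`, `D`. The upper bound has leading term `2pn ≤
(2r-6)n`, below `(2r-5)n`; the size of `n` absorbs the rest. -/
theorem count_contradiction {r n p α q : ℤ} (hr : 6 ≤ r) (hn : 5 * r + 18 ≤ n)
    (hp : p + α = r + 1) (hα : 4 ≤ α) (hp0 : 0 ≤ p) (hq : 1 ≤ q) (hqα : q + 1 ≤ α)
    (h : (2 * r - 5) * n - r ^ 2 + 4 * r - 1 ≤ p * (n - 1) + α * (r + q) + q * (r + q - 1)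
      + (p * (n - r - 1 - q) + (q * (α - q) - 1) + (α - q - 1) * (r - 1))) : False := by
  obtain rfl : p = r + 1 - α := by linarith
  have h1 : 0 ≤ (2 * α - 7) * (n - (5 * r + 18)) := by
    apply mul_nonneg <;> linarith
  have h2 : 7 * α * r + 35 * α - 27 * r - 125 + q * (r + 1 - 3 * α) ≤ 0 := by nlinarith
  -- `h2` is linear in `q` with coefficient `r + 1 - 3α`; its sign decides which end of the range of
  -- `q` is the worst.
  by_cases h3 : 3 * α ≤ r + 1
  · have h4 : 0 ≤ q * (r + 1 - 3 * α) := by apply mul_nonneg <;> linarith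
    nlinarith
  · have h4 : 0 ≤ (α - 1 - q) * (3 * α - 1 - r) := by apply mul_nonneg <;> linarith
    have h5 : 0 ≤ (α - 4) * (r + 1 - α) := by apply mul_nonneg <;> linarith
    nlinarith

namespace Layout

variable {d : V → ℕ} {F : SimpleGraph V} {A X D S : Finset V} {c : V}

/-- A layout in which many core vertices have no neighbour in the remainder has too small a
degree sum. -/
theorem false_of_four_le (h : Layout d F A X D S c) {r Δ : ℕ} (hr : 6 ≤ r)
    (hn : 5 * r + 18 ≤ Fintype.card V) (hA : #A = r + 1) (hα : 4 ≤ #(A \ X))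
    (hsum : (2 * (r : ℤ) - 5) * Fintype.card V - (r : ℤ) ^ 2 + 4 * r - 1 ≤ ∑ v, (d v : ℤ))
    (hD : ∀ b ∈ D, d b ≤ Δ) (hS : ∀ s ∈ S, d s ≤ Δ) (hq : #D + 1 ≤ #(A \ X))
    (hE : ((∑ b ∈ D, ∑ s ∈ S, adjInd F b s : ℕ) : ℤ) + 1 ≤ #D * (#(A \ X) - #D))
    (hΔ : Δ + 1 ≤ r + #D) : False := by
  have hp : #X + #(A \ X) = r + 1 := by
    rw [← hA, add_comm]; exact card_sdiff_add_card_eq_card h.sub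
  set E := ∑ b ∈ D, ∑ s ∈ S, adjInd F b s with hEdef
  set ν := #{s ∈ S | dg F s < d s} with hν
  have h1 : ν * #D ≤ E := h.card_deficient_mul_le
  have hqpos := h.card_pos
  -- Each deficient vertex of `S` uses `#D` of the fewer than `#D * (#(A \ X) - #D)` edges between
  -- `D` and `S`.
  have h2 : (ν : ℤ) + 1 ≤ #(A \ X) - #D := by
    have h3 : (ν : ℤ) * #D ≤ E := by exact_mod_cast h1
    by_contra! hcon
    have h4 : ((#(A \ X) : ℤ) - #D) * #D ≤ ν * #D := by
      apply mul_le_mul_of_nonneg_right <;> omega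
    linarith
  have hsplit := h.sum_split d
  rw [h.sum_A_split] at hsplit
  have b1 : ∑ v ∈ X, d v ≤ #X * (Fintype.card V - 1) := by
    refine (sum_le_card_nsmul X d _ fun a ha => ?_)
    rw [← h.satA a (h.sub ha)]; exact dg_le_card_sub_one F a
  have b2 : ∑ v ∈ A \ X, d v ≤ #(A \ X) * (r + #D) :=
    sum_le_card_nsmul _ d _ fun a ha => by have := h.le_card_inn ha; omega
  have b3 : ∑ v ∈ D, d v ≤ #D * Δ := sum_le_card_nsmul _ d _ hD
  have b4 := h.sum_S hS
  rw [← hEdef, ← hν] at b4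
  have b5 := sum_sum_adjInd_le F X S
  have hcard := h.card_split
  have c1 : (∑ v, (d v : ℤ)) ≤ #X * ((Fintype.card V : ℤ) - 1) + #(A \ X) * ((r : ℤ) + #D)
      + #D * Δ + (#X * #S + E + ν * ((r : ℤ) - 1)) := by
    have e1 : ν * (Δ - #D) ≤ ν * (r - 1) := Nat.mul_le_mul_left _ (by omega)
    have e2 : ∑ v, d v ≤ #X * (Fintype.card V - 1) + #(A \ X) * (r + #D) + #D * Δ
        + (#X * #S + E + ν * (r - 1)) := by omega
    have e3 : ((Fintype.card V - 1 : ℕ) : ℤ) = (Fintype.card V : ℤ) - 1 := by omega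
    have e4 : ((r - 1 : ℕ) : ℤ) = (r : ℤ) - 1 := by omega
    rw [← e3, ← e4]
    exact_mod_cast e2
  have hSc : (#S : ℤ) = (Fintype.card V : ℤ) - r - 1 - #D := by omega
  rw [hSc] at c1
  refine count_contradiction (r := r) (n := Fintype.card V) (p := #X) (α := #(A \ X)) (q := #D)
    (by omega) (by omega) (by omega) (by omega) (by omega) (by omega) (by omega) ?_
  have c2 : (#D : ℤ) * Δ ≤ #D * ((r : ℤ) + #D - 1) :=
    mul_le_mul_of_nonneg_left (by omega) (by omega)
  have c3 : (ν : ℤ) * ((r : ℤ) - 1) ≤ ((#(A \ X) : ℤ) - #D - 1) * ((r : ℤ) - 1) :=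
    mul_le_mul_of_nonneg_right (by omega) (by omega)
  linarith

/-- The case in which all vertices outside the core have small degrees. -/
theorem false_of_small (h : Layout d F A X D S c) {r : ℕ} (hr : 6 ≤ r)
    (hn : 5 * r + 18 ≤ Fintype.card V) (hA : #A = r + 1) (hα : 4 ≤ #(A \ X))
    (hsum : (2 * (r : ℤ) - 5) * Fintype.card V - (r : ℤ) ^ 2 + 4 * r - 1 ≤ ∑ v, (d v : ℤ))
    (hsmall : ∀ b, b ∉ A → d b + 1 ≤ r) : False := by
  have hp : #X + #(A \ X) = r + 1 := by
    rw [← hA, add_comm]; exact card_sdiff_add_card_eq_card h.sub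
  have hDA : ∀ b ∈ D, b ∉ A := fun b hb => disjoint_right.1 h.disj hb
  have hSA : ∀ s ∈ S, s ∉ A := fun s hs hsA => by
    rw [h.compl, mem_compl] at hs; exact hs (mem_union_left _ hsA)
  have h1 := h.sum_D
  have h2 := h.two_le
  have h3 : ∑ b ∈ D, d b ≤ #D * (r - 1) :=
    sum_le_card_nsmul D d _ fun b hb => by have := hsmall b (hDA b hb); omega
  have hlt := h.lt
  have hqpos := h.card_pos
  set E := ∑ b ∈ D, ∑ s ∈ S, adjInd F b s with hE
  -- A vertex of `D` demands at most `r - 1` and already has `#X + #D - 1` neighbours in `X ∪ D`;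
  -- the extra `1` is the deficiency of `c`.
  have h4 : (E : ℤ) + 1 ≤ #D * ((#(A \ X) : ℤ) - 1 - #D) := by
    have e1 : #D * (#D - 1) + #D * #X + E + 1 ≤ #D * (r - 1) := by omega
    have e2 : ((#D - 1 : ℕ) : ℤ) = (#D : ℤ) - 1 := by omega
    have e3 : ((r - 1 : ℕ) : ℤ) = (r : ℤ) - 1 := by omega
    have e4 : (#D : ℤ) * ((#D : ℤ) - 1) + #D * #X + E + 1 ≤ #D * ((r : ℤ) - 1) := by
      rw [← e2, ← e3]; exact_mod_cast e1
    have e5 : (#(A \ X) : ℤ) = r + 1 - #X := by omega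
    rw [e5]; linarith
  have h5 : #D + 1 ≤ #(A \ X) := by
    by_contra! hcon
    have : (#D : ℤ) * ((#(A \ X) : ℤ) - 1 - #D) ≤ 0 :=
      mul_nonpos_of_nonneg_of_nonpos (by omega) (by omega)
    linarith [Int.natCast_nonneg E]
  refine h.false_of_four_le (Δ := r - 1) hr hn hA hα hsum
    (fun b hb => by have := hsmall b (hDA b hb); omega)
    (fun b hb => by have := hsmall b (hSA b hb); omega) h5 ?_ (by omega)
  have : (#D : ℤ) * ((#(A \ X) : ℤ) - 1 - #D) ≤ #D * ((#(A \ X) : ℤ) - #D) :=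
    mul_le_mul_of_nonneg_left (by omega) (by omega)
  linarith

end Layout
end Contradictions

/-! ### The core `K_{r-2}` joined to three independent vertices. -/

section LargeCore

variable {V : Type*} [Fintype V] [DecidableEq V]

/-- The numerical consequences of a degree count in which three core vertices are left. -/
theorem small_inn_arith {q α Δ r p K e : ℤ} (hq : 1 ≤ q) (hα : 1 ≤ α) (hp : p + α = r + 1)
    (hK : 2 ≤ K) (he : 0 ≤ e) (heα : α * (Δ - r) ≤ e) (hΔ : Δ ≤ r + q)
    (h : q * (q - 1) + q * p + e + K ≤ q * Δ) :
    q + 1 ≤ α ∧ Δ + 1 ≤ r + q ∧ K ≤ q * (α - q) ∧ (α ≤ 3 → α = 3 ∧ Δ = r ∧ e = 0 ∧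
      (q = 1 → K ≤ 2)) := by
  -- `q`, `α`, `p` are the sizes of `D`, `A \ X`, `X`; `Δ` is the largest demand in `D`, `e` counts
  -- the edges between `A \ X` and `D`, and `K` the edges from `D` to `S` plus the deficiency of
  -- `c`. Inserting the lower bound for `e` makes the count factor as in `h1`; `h4` uses only `0 ≤
  -- e`.
  obtain rfl : p = r + 1 - α := by linarith
  have h1 : K ≤ (α - q) * (q + r - Δ) := by nlinarith
  have h2 : q + 1 ≤ α := by
    by_contra! hcon
    have : (α - q) * (q + r - Δ) ≤ 0 := mul_nonpos_of_nonpos_of_nonneg (by linarith) (by linarith)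
    linarith
  have h3 : Δ + 1 ≤ r + q := by
    by_contra! hcon
    have h4 : q + r - Δ = 0 := by linarith
    rw [h4, mul_zero] at h1
    linarith
  have h4 : K ≤ q * (Δ - r + α - q) := by nlinarith
  refine ⟨h2, h3, ?_, fun h5 => ?_⟩
  · by_cases h6 : r ≤ Δ
    · have : (α - q) * (q + r - Δ) ≤ (α - q) * q := mul_le_mul_of_nonneg_left (by linarith) (by linarith)
      linarith
    · have : q * (Δ - r + α - q) ≤ q * (α - q) := mul_le_mul_of_nonneg_left (by linarith) (by linarith)
      linarith
  · have h6 : α = 2 ∨ α = 3 := by omega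
    rcases h6 with rfl | rfl
    · obtain rfl : q = 1 := by omega
      omega
    · have h7 : q = 1 ∨ q = 2 := by omega
      rcases h7 with rfl | rfl
      · have h8 : Δ = r := by omega
        subst h8
        exact ⟨rfl, rfl, by omega, fun _ => by omega⟩
      · have h8 : Δ = r := by omega
        subst h8
        exact ⟨rfl, rfl, by omega, fun h9 => by omega⟩

set_option maxHeartbeats 1000000 in
/-- With the join of `K_{r-2}` and three vertices as a core, saturation never gets stuck. -/
theorem Stuck.false_of_large_core {d : V → ℕ} {Φ F : SimpleGraph V} {A T M : Finset V} {c : V}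
    {r : ℕ} (h : Stuck d Φ (A ∪ M) c F) (hdis : Disjoint A M) (hM : ∀ m ∈ M, d c ≤ d m)
    (hMs : ∀ s, s ∉ A → s ∉ M → d s ≤ d c) (hr : 6 ≤ r)
    (hn : 5 * r + 18 ≤ Fintype.card V)
    (hsum : (2 * (r : ℤ) - 5) * Fintype.card V - (r : ℤ) ^ 2 + 4 * r - 1 ≤ ∑ v, (d v : ℤ))
    {G : SimpleGraph V} (hG : ∀ v, dg G v = d v)
    (hΦ : ∀ x y, Φ.Adj x y → x ∈ A ∧ y ∈ A) (hTA : T ⊆ A) (hT : #T = r - 2) (hW : #(A \ T) = 3)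
    (hTΦ : ∀ a ∈ T, ∀ x ∈ A, a ≠ x → Φ.Adj a x)
    (hWΦ : ∀ w ∈ A \ T, ∀ w' ∈ A \ T, ¬ Φ.Adj w w')
    (hTW : ∀ a ∈ T, ∀ w ∈ A \ T, d w ≤ d a) (hA : ∀ a ∈ A, ∀ b, b ∉ A → d b ≤ d a) : False := by
  classical
  obtain ⟨hdom, X, hl⟩ := h.exists_layout hdis hM hΦ
  set D := insert c M with hDdef
  set S := (A ∪ D)ᶜ with hSdef
  have hDA : ∀ b ∈ D, b ∉ A := fun b hb => disjoint_right.1 hl.disj hb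
  have hSA : ∀ s ∈ S, s ∉ A := fun s hs hsA => by
    rw [hSdef, mem_compl] at hs; exact hs (mem_union_left _ hsA)
  have hcA : c ∉ A := hDA c hl.mem
  have hAcard : #A = r + 1 := by
    have := card_sdiff_add_card_eq_card hTA; omega
  have hp : #X + #(A \ X) = r + 1 := by
    rw [← hAcard, add_comm]; exact card_sdiff_add_card_eq_card hl.sub
  by_cases hα0 : #(A \ X) = 0
  · have hXA : X = A := by
      rw [card_eq_zero, sdiff_eq_empty_iff_subset] at hα0
      exact Subset.antisymm hl.sub hα0
    rw [hXA] at hl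
    exact h.layout_ne hΦ hdom (fun a ha => hA a ha c hcA) hG hl
  obtain ⟨b₀, hb₀, hmax⟩ := exists_max_image D d ⟨c, hl.mem⟩
  set Δ := d b₀ with hΔ
  have hΔA : ∀ a ∈ A, Δ ≤ d a := fun a ha => hA a ha b₀ (hDA b₀ hb₀)
  have hΔS : ∀ s ∈ S, d s ≤ Δ := by
    intro s hs
    refine (hMs s (hSA s hs) fun hsM => ?_).trans (hmax c hl.mem)
    rw [hSdef, mem_compl] at hs
    exact hs (mem_union_right _ (mem_insert_of_mem hsM))
  have hsD := hl.sum_D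
  have h2 := hl.two_le
  have hlt := hl.lt
  have hqpos := hl.card_pos
  set E := ∑ b ∈ D, ∑ s ∈ S, adjInd F b s with hE
  set e := ∑ a ∈ A \ X, ∑ b ∈ D, adjInd F a b with he
  have hDle : ∑ b ∈ D, d b ≤ #D * Δ := sum_le_card_nsmul D d _ hmax
  have hAle : ∀ a ∈ A, ∑ w ∈ A, adjInd F a w ≤ r := fun a ha => by
    have := sum_adjInd_le_card_sub_one F ha; omega
  -- A vertex of `A \ X` demands at least `Δ`, meets at most `r` of it inside `A`, and the rest in
  -- `D`.
  have heα : (#(A \ X) : ℤ) * ((Δ : ℤ) - r) ≤ e := by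
    have h3 : #(A \ X) * Δ ≤ e + #(A \ X) * r := by
      have h4 : ∀ a ∈ A \ X, Δ ≤ ∑ b ∈ D, adjInd F a b + r := by
        intro a ha
        have := hl.dg_inn ha
        have := hΔA a (sdiff_subset ha)
        have := hAle a (sdiff_subset ha)
        omega
      have := sum_le_sum h4
      rw [sum_add_distrib] at this
      simpa using this
    have h5 : (#(A \ X) : ℤ) * Δ ≤ e + #(A \ X) * r := by exact_mod_cast h3
    linarith
  obtain ⟨a₁, ha₁⟩ := Finset.card_pos.1 (Nat.pos_of_ne_zero hα0)
  have hΔq : Δ ≤ r + #D := by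
    have := hl.le_card_inn ha₁
    have := hΔA a₁ (sdiff_subset ha₁)
    omega
  have hmain : (#D : ℤ) * ((#D : ℤ) - 1) + #D * #X + e + ((E + (d c - dg F c) : ℕ) : ℤ)
      ≤ #D * (Δ : ℤ) := by
    have e1 : #D * (#D - 1) + #D * #X + e + (E + (d c - dg F c)) ≤ #D * Δ := by omega
    have e2 : ((#D - 1 : ℕ) : ℤ) = (#D : ℤ) - 1 := by omega
    rw [← e2]; exact_mod_cast e1
  obtain ⟨r1, r2, r3, r4⟩ := small_inn_arith (q := #D) (α := #(A \ X)) (Δ := Δ) (r := r) (p := #X)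
    (K := ((E + (d c - dg F c) : ℕ) : ℤ)) (e := e) (by omega) (by omega) (by omega) (by omega)
    (by omega) heα (by omega) hmain
  by_cases hα4 : 4 ≤ #(A \ X)
  · exact hl.false_of_four_le (Δ := Δ) hr hn hAcard hα4 hsum hmax hΔS (by omega) (by omega)
      (by omega)
  -- What remains is the tight case: three vertices of `A \ X`, of degree exactly `r`, adjacent to
  -- the whole core and to nothing else.
  obtain ⟨s1, s2, s3, s4⟩ := r4 (by omega)
  have hα3 : #(A \ X) = 3 := by omega
  have hΔr : Δ = r := by omega
  have he0 : e = 0 := by omega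
  have hnoD : ∀ a ∈ A \ X, ∀ b ∈ D, ¬ F.Adj a b := by
    intro a ha b hb hadj
    have h3 := (sum_eq_zero_iff.1 he0) a ha
    have h4 := (sum_eq_zero_iff.1 h3) b hb
    rw [adjInd_of_adj hadj] at h4
    exact one_ne_zero h4
  have hdr : ∀ a ∈ A \ X, d a = r ∧ ∑ w ∈ A, adjInd F a w = r := by
    intro a ha
    have h3 := hl.dg_inn ha
    rw [sum_adjInd_of_forall_not (hnoD a ha)] at h3
    have := hΔA a (sdiff_subset ha)
    have := hAle a (sdiff_subset ha)
    omega
  have hadjA : ∀ a ∈ A \ X, ∀ x ∈ A, a ≠ x → F.Adj a x := by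
    intro a ha x hx hne
    by_contra hn
    have h3 := (hdr a ha).2
    rw [← add_sum_erase _ _ hx, adjInd_of_not hn, zero_add] at h3
    have h4 := sum_adjInd_le_card_sub_one F (mem_erase.2 ⟨hne, sdiff_subset ha⟩)
    rw [card_erase_of_mem hx] at h4
    omega
  -- Otherwise two vertices of `A \ T` are joined by a removable edge, and one of them is adjacent
  -- to `c`.
  have hWX : ∃ w ∈ A \ T, w ∈ X := by
    by_contra! hcon
    have hsub : A \ T ⊆ A \ X := fun w hw => mem_sdiff.2 ⟨sdiff_subset hw, hcon w hw⟩
    obtain ⟨w, hw, w', hw', hne⟩ := one_lt_card.1 (by omega : 1 < #(A \ T))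
    have h3 := hadjA w (hsub hw) w' (sdiff_subset hw') hne
    rcases h.adj_or_adj_of_free_adj (mem_union_left _ (sdiff_subset hw))
      (mem_union_left _ (sdiff_subset hw')) h3 (hWΦ w hw w' hw') with h4 | h4
    · exact hnoD w (hsub hw) c hl.mem h4
    · exact hnoD w' (hsub hw') c hl.mem h4
  obtain ⟨w₀, hw₀, hw₀X⟩ := hWX
  have hTX : ∃ a ∈ T, a ∈ A \ X := by
    by_contra! hcon
    have hsub : A \ X ⊆ A \ T := fun a ha => mem_sdiff.2 ⟨sdiff_subset ha, fun h' => hcon a h' ha⟩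
    have h3 := eq_of_subset_of_card_le hsub (by omega)
    rw [← h3] at hw₀
    exact (mem_sdiff.1 hw₀).2 hw₀X
  obtain ⟨a₀, ha₀T, ha₀⟩ := hTX
  have hdW : ∀ w ∈ A \ T, d w ≤ r := fun w hw => (hTW a₀ ha₀T w hw).trans (hdr a₀ ha₀).1.le
  -- The demand of `w` is at most `r`, and `w` sees the `r - 2` vertices of `T`, all of `D` and some
  -- vertex of `S`, so nothing is left over.
  have hWcount : ∀ w ∈ A \ T, w ∈ X → #D = 1 ∧ ∑ s ∈ S, adjInd F w s = 1 ∧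
      ∀ w' ∈ A \ T, ¬ F.Adj w w' := by
    intro w hw hwX
    have hwA := sdiff_subset hw
    have h3 := hl.dg_split w
    rw [hl.satA w hwA, sum_adjInd_of_forall (hl.join w hwX), ← sum_sdiff hTA,
      sum_adjInd_of_forall (X := T)] at h3
    · have h4 := hdW w hw
      obtain ⟨s, hs, hadj⟩ := hl.out w hwX
      have h5 : 1 ≤ ∑ s ∈ S, adjInd F w s := by
        rw [← adjInd_of_adj hadj]
        exact single_le_sum (f := fun s => adjInd F w s) (fun _ _ => Nat.zero_le _) hs
      refine ⟨by omega, by omega, fun w' hw' hadj' => ?_⟩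
      have h6 : ∑ w' ∈ A \ T, adjInd F w w' = 0 := by omega
      have := (sum_eq_zero_iff.1 h6) w' hw'
      rw [adjInd_of_adj hadj'] at this
      exact one_ne_zero this
    · intro a ha
      exact (h.good.le (hTΦ a ha w hwA (by rintro rfl; exact (mem_sdiff.1 hw).2 ha))).symm
  have hWX : A \ T ⊆ X := by
    intro w hw
    by_contra hwX
    refine (hWcount w₀ hw₀ hw₀X).2.2 w hw (hadjA w (mem_sdiff.2 ⟨sdiff_subset hw, hwX⟩) w₀
      (sdiff_subset hw₀) ?_).symm
    rintro rfl; exact hwX hw₀X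
  have hq1 := (hWcount w₀ hw₀ hw₀X).1
  have hK := s4 (by omega)
  have hXsplit : ∀ f : V → ℕ, ∑ v ∈ X, f v = ∑ v ∈ X \ (A \ T), f v + ∑ v ∈ A \ T, f v :=
    fun f => (sum_sdiff hWX).symm
  have hXcard : #(X \ (A \ T)) + 5 = r := by
    have := card_sdiff_add_card_eq_card hWX
    omega
  have t1 := hl.sum_split d
  rw [hl.sum_A_split, hXsplit] at t1
  have t2 : ∑ v ∈ X \ (A \ T), d v ≤ #(X \ (A \ T)) * (Fintype.card V - 1) :=
    sum_le_card_nsmul _ d _ fun a ha => by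
      rw [← hl.satA a (hl.sub (sdiff_subset ha))]; exact dg_le_card_sub_one F a
  have t3 : ∑ v ∈ A \ T, d v ≤ #(A \ T) * r := sum_le_card_nsmul _ d _ hdW
  have t4 : ∑ v ∈ A \ X, d v ≤ #(A \ X) * r := sum_le_card_nsmul _ d _ fun a ha => (hdr a ha).1.le
  have t5 := hl.sum_S hΔS
  rw [hXsplit, ← hE] at t5
  have t6 := sum_sum_adjInd_le F (X \ (A \ T)) S
  have t7 : ∑ w ∈ A \ T, ∑ s ∈ S, adjInd F w s ≤ #(A \ T) * 1 :=
    sum_le_card_nsmul _ _ _ fun w hw => (hWcount w hw (hWX hw)).2.1.le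
  have t8 := hl.card_deficient_mul_le
  rw [← hE, hq1, mul_one] at t8
  have hEle : E ≤ 1 := by omega
  have t9 : #{s ∈ S | dg F s < d s} * (Δ - #D) ≤ 1 * r := Nat.mul_le_mul (by omega) (by omega)
  have hcard := hl.card_split
  rw [hW] at t3 t7
  rw [hα3] at t4
  rw [hq1, one_mul] at hDle
  -- Now `A \ X` lies in `T`, so only `r - 5` vertices can have large degree, and the sum is about
  -- `(2r-10)n`.
  have u1 : ∑ v, d v ≤ #(X \ (A \ T)) * (Fintype.card V - 1) + #(X \ (A \ T)) * #S + 8 * r + 4 := by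
    omega
  have u2 : (∑ v, (d v : ℤ)) ≤ ((r : ℤ) - 5) * ((Fintype.card V : ℤ) - 1)
      + ((r : ℤ) - 5) * ((Fintype.card V : ℤ) - r - 2) + 8 * r + 4 := by
    have e1 : ((#(X \ (A \ T)) : ℕ) : ℤ) = (r : ℤ) - 5 := by omega
    have e2 : ((Fintype.card V - 1 : ℕ) : ℤ) = (Fintype.card V : ℤ) - 1 := by omega
    have e3 : ((#S : ℕ) : ℤ) = (Fintype.card V : ℤ) - r - 2 := by omega
    rw [← e1, ← e2, ← e3]
    exact_mod_cast u1
  have e4 : (5 * r + 18 : ℤ) ≤ Fintype.card V := by exact_mod_cast hn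
  have e5 : (6 : ℤ) ≤ r := by exact_mod_cast hr
  nlinarith

end LargeCore

/-! ### Cores and their first extension. -/

section Core

variable {V : Type*} [Fintype V] [DecidableEq V]

/-- The clique on `T`, joined completely to `W`, with the edges of `Γ` inside `W`. -/
def coreGraph (T W : Finset V) (Γ : SimpleGraph V) : SimpleGraph V where
  Adj x y := x ≠ y ∧
    ((x ∈ T ∧ y ∈ T ∪ W) ∨ (y ∈ T ∧ x ∈ T ∪ W) ∨ (x ∈ W ∧ y ∈ W ∧ Γ.Adj x y))
  symm := ⟨fun x y h => ⟨h.1.symm, by have := Γ.adj_comm x y; tauto⟩⟩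
  loopless := ⟨fun _ h => h.1 rfl⟩

theorem coreGraph_adj_mem {T W : Finset V} {Γ : SimpleGraph V} {x y : V}
    (h : (coreGraph T W Γ).Adj x y) : x ∈ T ∪ W ∧ y ∈ T ∪ W := by
  obtain ⟨-, h | h | h⟩ := h
  · exact ⟨mem_union_left _ h.1, h.2⟩
  · exact ⟨h.2, mem_union_left _ h.1⟩
  · exact ⟨mem_union_right _ h.1, mem_union_right _ h.2.1⟩

theorem coreGraph_adj_of_mem {T W : Finset V} {Γ : SimpleGraph V} {x y : V} (hx : x ∈ T)
    (hy : y ∈ T ∪ W) (hne : x ≠ y) : (coreGraph T W Γ).Adj x y := ⟨hne, Or.inl ⟨hx, hy⟩⟩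

theorem sum_coreGraph_of_mem_right {T W : Finset V} {Γ : SimpleGraph V} (hdis : Disjoint T W)
    {w : V} (hw : w ∈ W) :
    ∑ x ∈ T ∪ W, adjInd (coreGraph T W Γ) w x = #T + ∑ x ∈ W, adjInd Γ w x := by
  have hwT := disjoint_right.1 hdis hw
  rw [sum_union hdis, sum_adjInd_of_forall fun a ha => (coreGraph_adj_of_mem ha
    (mem_union_right _ hw) (by rintro rfl; exact hwT ha)).symm]
  congr 1
  refine sum_congr rfl fun x hx => ?_
  have hxT := disjoint_right.1 hdis hx
  by_cases h : Γ.Adj w x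
  · rw [adjInd_of_adj h, adjInd_of_adj]
    exact ⟨h.ne, Or.inr (Or.inr ⟨hw, hx, h⟩)⟩
  · rw [adjInd_of_not h, adjInd_of_not]
    rintro ⟨-, h1 | h1 | h1⟩
    · exact hwT h1.1
    · exact hxT h1.1
    · exact h h1.2.2

/-- A graphic sequence with large enough entries is attained on `T` by a graph containing the core,
whose remaining edges join `T` to the vertices outside the core. -/
theorem exists_good_core {d : V → ℕ} {G : SimpleGraph V} (hG : ∀ v, dg G v = d v)
    {T W : Finset V} (hdis : Disjoint T W) (Γ : SimpleGraph V)
    (hT : ∀ a ∈ T, #T + #W ≤ d a + 1) (hW : ∀ w ∈ W, #T + ∑ x ∈ W, adjInd Γ w x ≤ d w) :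
    ∃ F, Good d (coreGraph T W Γ) T F ∧
      ∀ x y, F.Adj x y → (coreGraph T W Γ).Adj x y ∨ (x ∈ T ∧ y ∉ T ∪ W) ∨
        (y ∈ T ∧ x ∉ T ∪ W) := by
  classical
  have hAcard : #(T ∪ W) = #T + #W := card_union_of_disjoint hdis
  -- Outside the core, `a ∈ T` takes its missing neighbours from those it has in `G`, so no outer
  -- vertex exceeds its demand.
  have hex : ∀ a, ∃ Y : Finset V, a ∈ T →
      Y ⊆ {y ∈ (T ∪ W)ᶜ | G.Adj a y} ∧ #Y = d a - (#(T ∪ W) - 1) := by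
    intro a
    by_cases ha : a ∈ T
    · have h1 : d a - (#(T ∪ W) - 1) ≤ #{y ∈ (T ∪ W)ᶜ | G.Adj a y} := by
        rw [← sum_adjInd_eq_card, ← hG a, dg, ← sum_add_sum_compl (T ∪ W)]
        have := sum_adjInd_le_card_sub_one G (mem_union_left W ha)
        omega
      obtain ⟨Y, hY, hYc⟩ := exists_subset_card_eq h1
      exact ⟨Y, fun _ => ⟨hY, hYc⟩⟩
    · exact ⟨∅, fun h => absurd h ha⟩
  choose Y hY using hex
  have hYA : ∀ a ∈ T, ∀ y ∈ Y a, y ∉ T ∪ W ∧ G.Adj a y := fun a ha y hy => by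
    have := (hY a ha).1 hy
    rwa [mem_filter, mem_compl] at this
  let F : SimpleGraph V :=
    { Adj := fun x y => (coreGraph T W Γ).Adj x y ∨ (x ∈ T ∧ y ∈ Y x) ∨ (y ∈ T ∧ x ∈ Y y)
      symm := ⟨fun x y h => by have := (coreGraph T W Γ).adj_comm x y; tauto⟩
      loopless := ⟨fun x h => by
        rcases h with h | ⟨h, h'⟩ | ⟨h, h'⟩
        · exact (coreGraph T W Γ).irrefl h
        · exact (hYA x h x h').1 (mem_union_left _ h)
        · exact (hYA x h x h').1 (mem_union_left _ h)⟩ }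
  have hle : coreGraph T W Γ ≤ F := fun x y h => Or.inl h
  have hdT : ∀ a ∈ T, dg F a = d a := by
    intro a ha
    rw [dg, ← sum_add_sum_compl (T ∪ W), sum_adjInd_of_forall_ne (mem_union_left W ha)
      fun x hx hne => hle (coreGraph_adj_of_mem ha hx hne.symm), sum_adjInd_eq_card]
    have h1 : {y ∈ (T ∪ W)ᶜ | F.Adj a y} = Y a := by
      ext y
      rw [mem_filter, mem_compl]
      constructor
      · rintro ⟨h1, h2 | h2 | h2⟩
        · exact absurd (coreGraph_adj_mem h2).2 h1
        · exact h2.2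
        · exact absurd (mem_union_left W h2.1) h1
      · intro hy
        exact ⟨(hYA a ha y hy).1, Or.inr (Or.inl ⟨ha, hy⟩)⟩
    rw [h1, (hY a ha).2]
    have := hT a ha
    omega
  have hnT : ∀ x y, F.Adj x y → (coreGraph T W Γ).Adj x y ∨ (x ∈ T ∧ y ∉ T ∪ W) ∨ (y ∈ T ∧ x ∉ T ∪ W) := by
    rintro x y (h | ⟨h, h'⟩ | ⟨h, h'⟩)
    · exact Or.inl h
    · exact Or.inr (Or.inl ⟨h, (hYA x h y h').1⟩)
    · exact Or.inr (Or.inr ⟨h, (hYA y h x h').1⟩)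
  refine ⟨F, ⟨hle, fun v => ?_, hdT⟩, hnT⟩
  by_cases hvT : v ∈ T
  · exact (hdT v hvT).le
  by_cases hvW : v ∈ W
  · rw [dg, ← sum_add_sum_compl (T ∪ W), sum_adjInd_of_forall_not (X := (T ∪ W)ᶜ), add_zero]
    · refine le_trans ?_ (hW v hvW)
      rw [← sum_coreGraph_of_mem_right hdis hvW]
      refine sum_le_sum fun x hx => ?_
      by_cases h : F.Adj v x
      · rcases hnT v x h with h1 | h1 | h1
        · rw [adjInd_of_adj h1]; exact adjInd_le_one _ _ _
        · exact absurd h1.1 hvT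
        · exact absurd (mem_union_right _ hvW) h1.2
      · rw [adjInd_of_not h]; exact Nat.zero_le _
    · intro x hx h
      rcases hnT v x h with h1 | h1 | h1
      · exact (mem_compl.1 hx) (coreGraph_adj_mem h1).2
      · exact hvT h1.1
      · exact h1.2 (mem_union_right _ hvW)
  · rw [← hG v]
    refine sum_le_sum fun x _ => ?_
    by_cases h : F.Adj v x
    · rcases h with h1 | h1 | h1
      · rcases mem_union.1 (coreGraph_adj_mem h1).1 with h2 | h2
        · exact absurd h2 hvT
        · exact absurd h2 hvW
      · exact absurd h1.1 hvT
      · rw [adjInd_of_adj (hYA x h1.1 v h1.2).2.symm]; exact adjInd_le_one _ _ _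
    · rw [adjInd_of_not h]; exact Nat.zero_le _

/-- If four vertices of the core are saturated within the core, and the vertices outside the core
have small degrees, then some realization contains the core. -/
theorem Good.exists_realization_of_small {d : V → ℕ} {F : SimpleGraph V} {T W W₀ : Finset V}
    {Γ : SimpleGraph V} {r : ℕ} (hF : Good d (coreGraph T W Γ) (T ∪ W) F)
    (heven : Even (∑ v, d v)) (hdis : Disjoint T W) (hr : 6 ≤ r)
    (hn : 5 * r + 18 ≤ Fintype.card V) (hA : #(T ∪ W) = r + 1)
    (hsum : (2 * (r : ℤ) - 5) * Fintype.card V - (r : ℤ) ^ 2 + 4 * r - 1 ≤ ∑ v, (d v : ℤ))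
    (hsmall : ∀ b, b ∉ T ∪ W → d b + 1 ≤ r) (hW₀ : W₀ ⊆ W) (hcard : 4 ≤ #W₀)
    (hsat : ∀ w ∈ W₀, d w = #T + ∑ x ∈ W, adjInd Γ w x) :
    ∃ G, coreGraph T W Γ ≤ G ∧ ∀ v, dg G v = d v := by
  refine hF.exists_realization heven (fun x y h => Or.inl (coreGraph_adj_mem h).1) ?_
  intro M c F' hdisM hM _ hst
  obtain ⟨-, X, hl⟩ := hst.exists_layout hdisM hM fun x y h => coreGraph_adj_mem h
  -- The core edges alone exhaust the demand of `w ∈ W₀`.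
  have hsub : W₀ ⊆ (T ∪ W) \ X := by
    intro w hw
    have hwA : w ∈ T ∪ W := mem_union_right _ (hW₀ hw)
    refine mem_sdiff.2 ⟨hwA, fun hwX => ?_⟩
    obtain ⟨s, hs, hadj⟩ := hl.out w hwX
    have h1 := hl.dg_split w
    have h2 : 1 ≤ ∑ s ∈ (T ∪ W ∪ insert c M)ᶜ, adjInd F' w s := by
      rw [← adjInd_of_adj hadj]
      exact single_le_sum (f := fun s => adjInd F' w s) (fun _ _ => Nat.zero_le _) hs
    have h3 : ∑ x ∈ T ∪ W, adjInd (coreGraph T W Γ) w x ≤ ∑ x ∈ T ∪ W, adjInd F' w x := by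
      refine sum_le_sum fun x _ => ?_
      by_cases h : (coreGraph T W Γ).Adj w x
      · rw [adjInd_of_adj (hst.good.le h)]; exact adjInd_le_one _ _ _
      · rw [adjInd_of_not h]; exact Nat.zero_le _
    rw [sum_coreGraph_of_mem_right hdis (hW₀ hw), ← hsat w hw] at h3
    have h4 := hl.satA w hwA
    omega
  exact hl.false_of_small hr hn hA (hcard.trans (card_le_card hsub)) hsum hsmall

end Core

/-! ### Saturating the three vertices joined to the clique. -/

section Join

variable {V : Type*} [Fintype V] [DecidableEq V]

namespace Stuck

variable {d : V → ℕ} {F : SimpleGraph V} {T W M : Finset V} {c s a : V}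

theorem coreGraph_bot_adj_of_mem_right (hdis : Disjoint T W) {m w : V} (hm : m ∈ W)
    (h : (coreGraph T W ⊥).Adj m w) : w ∈ T := by
  have hmT := disjoint_right.1 hdis hm
  obtain ⟨-, h | h | h⟩ := h
  · exact absurd h.1 hmT
  · exact h.1
  · exact h.2.2.elim

/-- A deficient vertex that misses a vertex of the clique `T` determines the neighbourhood of the
latter. -/
theorem of_not_adj (h : Stuck d (coreGraph T W ⊥) (T ∪ M) c F) (hdis : Disjoint T W)
    (hW : #W = 3) (hM : M ⊆ W) (hc : c ∈ W) (hdM : ∀ m ∈ M, d c ≤ d m) (hTc : ∀ a ∈ T, d c ≤ d a)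
    (hsc : s ≠ c) (hs : dg F s < d s) (ha : a ∈ T) (has : ¬ F.Adj a s) :
    s ∉ T ∪ W ∧ M = ∅ ∧ (∀ w ∈ W, ¬ F.Adj c w) ∧
      (∀ y, y ∉ T ∪ W → (F.Adj a y ↔ F.Adj c y ∧ y ≠ s)) ∧
      d a = #T + 1 + ∑ y ∈ (T ∪ W)ᶜ, adjInd F c y ∧ d c = d a := by
  classical
  have hle := h.good.le
  have hdom : ∀ m ∈ M, Dominates d (coreGraph T W ⊥) c m := fun m hm => ⟨hdM m hm, fun w hw => by
    have hwT := coreGraph_bot_adj_of_mem_right hdis (hM hm) hw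
    exact (coreGraph_adj_of_mem hwT (mem_union_right _ hc)
      (by rintro rfl; exact disjoint_left.1 hdis hwT hc)).symm⟩
  have hsL := h.mem_of_not_deficient hs
  have haA : ∀ x ∈ T ∪ W, x ≠ a → F.Adj a x := fun x hx hne =>
    hle (coreGraph_adj_of_mem ha hx hne.symm)
  have hsB : s ∉ T ∪ W := by
    intro hsA
    refine has (haA s hsA ?_)
    rintro rfl; exact hsL (mem_union_left _ ha)
  set S₁ := {y ∈ (T ∪ W)ᶜ | F.Adj c y ∧ ∀ m ∈ M, F.Adj m y} with hS₁
  -- The deficiency of `s` can be moved to any outer neighbour `y` of `a`.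
  have hmem : ∀ y, y ∉ T ∪ W → F.Adj a y → y ∈ S₁.erase s := by
    intro y hy hay
    have hyc : y ≠ c := by rintro rfl; exact hy (mem_union_right _ hc)
    have hyL : y ∉ T ∪ M := fun h' => hy (union_subset_union_right hM h')
    obtain ⟨h1, h2⟩ := h.adj_of_move (mem_union_left _ ha) hyL hyc hsc hay
      (fun h' => hy (coreGraph_adj_mem h').2) has hs
    refine mem_erase.2 ⟨by rintro rfl; exact has hay, mem_filter.2 ⟨mem_compl.2 hy, h1.symm, ?_⟩⟩
    exact fun m hm => (h2 m (mem_union_right _ hm) (hdom m hm)).symm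
  have hsS : s ∈ S₁ := mem_filter.2 ⟨mem_compl.2 hsB, (h.adj_of_deficient hsc hs).symm,
    fun m hm => (h.adj_of_deficient_of_dominates hsc hs (mem_union_right _ hm) (hdom m hm)).symm⟩
  have hcard : #(T ∪ W) = #T + #W := card_union_of_disjoint hdis
  have h1 : d a = (#T + #W - 1) + ∑ y ∈ (T ∪ W)ᶜ, adjInd F a y := by
    rw [← h.good.sat a (mem_union_left _ ha), dg, ← sum_add_sum_compl (T ∪ W),
      sum_adjInd_of_forall_ne (mem_union_left _ ha) haA, hcard]
  have h2 : dg F c = #T + ∑ w ∈ W, adjInd F c w + ∑ y ∈ (T ∪ W)ᶜ, adjInd F c y := by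
    rw [dg, ← sum_add_sum_compl (T ∪ W), sum_union hdis, sum_adjInd_of_forall (X := T)]
    exact fun x hx => (hle (coreGraph_adj_of_mem hx (mem_union_right _ hc)
      (by rintro rfl; exact disjoint_left.1 hdis hx hc))).symm
  have h3 : ∑ y ∈ (T ∪ W)ᶜ, adjInd F a y ≤ #(S₁.erase s) := by
    rw [sum_adjInd_eq_card]
    exact card_le_card fun y hy =>
      hmem y (mem_compl.1 (mem_filter.1 hy).1) (mem_filter.1 hy).2
  have h4 : #S₁ ≤ ∑ y ∈ (T ∪ W)ᶜ, adjInd F c y := by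
    rw [sum_adjInd_eq_card]
    exact card_le_card fun y hy => mem_filter.2 ⟨(mem_filter.1 hy).1, (mem_filter.1 hy).2.1⟩
  have h5 := h.lt
  have h6 := hTc a ha
  have h7 := card_erase_of_mem hsS
  have h8 : 0 < #S₁ := card_pos.2 ⟨s, hsS⟩
  -- `dg F c < d c ≤ d a ≤ #T + 1 + #S₁`, while `dg F c` is at least `#T + #S₁` plus the number of
  -- neighbours of `c` in `W`. So every estimate is an equality.
  have h9 : ∑ w ∈ W, adjInd F c w = 0 := by omega
  have hcW : ∀ w ∈ W, ¬ F.Adj c w := by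
    intro w hw hadj
    have := (sum_eq_zero_iff.1 h9) w hw
    rw [adjInd_of_adj hadj] at this
    omega
  have hM0 : M = ∅ := by
    rw [eq_empty_iff_forall_notMem]
    exact fun m hm => hcW m (hM hm) (h.adj_of_dominates (mem_union_right _ hm) (hdom m hm)).symm
  refine ⟨hsB, hM0, hcW, fun y hy => ?_, by omega, by omega⟩
  have heq : {y ∈ (T ∪ W)ᶜ | F.Adj a y} = S₁.erase s := by
    refine eq_of_subset_of_card_le (fun y hy =>
      hmem y (mem_compl.1 (mem_filter.1 hy).1) (mem_filter.1 hy).2) ?_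
    rw [← sum_adjInd_eq_card]
    omega
  constructor
  · intro hay
    have := hmem y hy hay
    rw [mem_erase, mem_filter] at this
    exact ⟨this.2.2.1, this.1⟩
  · rintro ⟨hcy, hys⟩
    have : y ∈ S₁.erase s := mem_erase.2 ⟨hys, mem_filter.2 ⟨mem_compl.2 hy, hcy, by
      rw [hM0]; simp⟩⟩
    rw [← heq] at this
    exact (mem_filter.1 this).2

/-- The completion process does not get stuck at a vertex of `W`. -/
theorem false_of_join (h : Stuck d (coreGraph T W ⊥) (T ∪ M) c F) (hdis : Disjoint T W)
    (hW : #W = 3) (hM : M ⊆ W) (hc : c ∈ W) (hdM : ∀ m ∈ M, d c ≤ d m) (hTc : ∀ a ∈ T, d c ≤ d a)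
    (hWB : ∀ w ∈ W, ∀ b, b ∉ T ∪ W → d b ≤ d w) {r : ℕ} (hr : 6 ≤ r) (hT : #T = r - 2)
    (hn : 5 * r + 18 ≤ Fintype.card V)
    (hsum : (2 * (r : ℤ) - 5) * Fintype.card V - (r : ℤ) ^ 2 + 4 * r - 1 ≤ ∑ v, (d v : ℤ))
    {G : SimpleGraph V} (hG : ∀ v, dg G v = d v) : False := by
  classical
  have hle := h.good.le
  have hcT : c ∉ T := disjoint_right.1 hdis hc
  have hTc' : ∀ x ∈ T, ∀ y ∈ T ∪ W, x ≠ y → F.Adj x y := fun x hx y hy hne =>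
    hle (coreGraph_adj_of_mem hx hy hne)
  -- If every deficient vertex other than `c` sees all of `T`, the clique `insert c (T ∪ M)`
  -- violates Erdős–Gallai.
  by_cases hrel : ∃ s a, s ≠ c ∧ dg F s < d s ∧ a ∈ T ∧ ¬ F.Adj a s
  swap
  · push Not at hrel
    have hdom : ∀ m ∈ M, Dominates d (coreGraph T W ⊥) c m := fun m hm =>
      ⟨hdM m hm, fun w hw => by
        have hwT := coreGraph_bot_adj_of_mem_right hdis (hM hm) hw
        exact (coreGraph_adj_of_mem hwT (mem_union_right _ hc)
          (by rintro rfl; exact hcT hwT)).symm⟩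
    refine h.false_of_clique hG ?_ ?_
    · intro x hx y hy hne
      have hmemA : ∀ z ∈ insert c (T ∪ M), z ∈ T ∪ W := by
        intro z hz
        rcases mem_insert.1 hz with rfl | hz
        · exact mem_union_right _ hc
        · exact union_subset_union_right hM hz
      by_cases hxT : x ∈ T
      · exact hTc' x hxT y (hmemA y hy) hne
      by_cases hyT : y ∈ T
      · exact (hTc' y hyT x (hmemA x hx) hne.symm).symm
      have hmm : ∀ z ∈ insert c (T ∪ M), z ∉ T → z = c ∨ z ∈ M := by
        intro z hz hzT
        rw [mem_insert, mem_union] at hz; tauto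
      rcases hmm x hx hxT with rfl | hxM <;> rcases hmm y hy hyT with rfl | hyM
      · exact absurd rfl hne
      · exact (h.adj_of_dominates (mem_union_right _ hyM) (hdom _ hyM)).symm
      · exact h.adj_of_dominates (mem_union_right _ hxM) (hdom _ hxM)
      · exact h.adj_of_dominates_of_dominates (mem_union_right _ hxM) (hdom _ hxM)
          (mem_union_right _ hyM) (hdom _ hyM) hne
    · intro s hs hsd x hx
      have hsc : s ≠ c := fun h' => hs (h' ▸ mem_insert_self _ _)
      rcases mem_insert.1 hx with rfl | hx
      · exact h.adj_of_deficient hsc hsd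
      rcases mem_union.1 hx with hx | hx
      · exact (hrel s x hsc hsd hx).symm
      · exact h.adj_of_deficient_of_dominates hsc hsd (mem_union_right _ hx) (hdom _ hx)
  obtain ⟨s, a, hsc, hs, ha, has⟩ := hrel
  obtain ⟨hsB, hM0, hcW, hNa, hda, hdc⟩ := h.of_not_adj hdis hW hM hc hdM hTc hsc hs ha has
  subst hM0
  set N := ∑ y ∈ (T ∪ W)ᶜ, adjInd F c y with hN
  have hT0 : T ∪ ∅ = T := union_empty T
  have hmemB : ∀ {y}, y ∉ T ∪ W → y ∉ T ∪ ∅ ∧ y ≠ c := by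
    intro y hy
    refine ⟨fun h' => hy (union_subset_union_right hM h'), ?_⟩
    rintro rfl; exact hy (mem_union_right _ hc)
  have hdgT : ∀ y, y ∉ T → y ≠ c → dg F y = ∑ x ∈ T, adjInd F y x + adjInd F y c := by
    intro y hy hyc
    rw [dg, ← sum_add_sum_compl T, ← add_sum_erase Tᶜ _ (mem_compl.2 hcT),
      sum_adjInd_of_forall_not (X := Tᶜ.erase c), add_zero]
    intro w hw hadj
    rw [mem_erase, mem_compl] at hw
    exact h.indep y (by rwa [hT0]) hyc w (by rw [hT0]; exact hw.2) hw.1 hadj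
  -- The other vertices of `W` miss `c`, so they are not deficient and have neighbours only in `T`.
  -- Their demands bound those outside the core.
  have hdW : ∀ w ∈ W, w ≠ c → d w ≤ #T := by
    intro w hw hwc
    have h1 : ¬ F.Adj w c := fun h' => hcW w hw h'.symm
    have h2 : ¬ dg F w < d w := fun h' => h1 (h.adj_of_deficient hwc h')
    have h3 := hdgT w (disjoint_right.1 hdis hw) hwc
    rw [adjInd_of_not h1] at h3
    have := sum_adjInd_le_card F T w
    omega
  have hdB : ∀ b, b ∉ T ∪ W → d b ≤ #T := by
    obtain ⟨w, hw, hwc⟩ := exists_mem_ne (by omega : 1 < #W) c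
    exact fun b hb => (hWB w hw b hb).trans (hdW w hw hwc)
  have hmiss : ∀ y, y ∉ T ∪ W → F.Adj c y → dg F y + 1 = 1 + 1 + #{x ∈ T | F.Adj y x} := by
    intro y hy hcy
    have h1 := hdgT y (fun h' => hy (mem_union_left _ h')) (hmemB hy).2
    rw [adjInd_of_adj hcy.symm, sum_adjInd_eq_card] at h1
    omega
  have hpart : ∀ y, #{x ∈ T | F.Adj y x} + #{x ∈ T | ¬ F.Adj y x} = #T := fun y =>
    card_filter_add_card_filter_not _
  -- `s` demands at most `#T`, lacks an edge and is adjacent to `c`, so it misses at least two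
  -- vertices of `T`.
  obtain ⟨a', ha', haa'⟩ : ∃ a' ∈ {x ∈ T | ¬ F.Adj s x}, a' ≠ a := by
    refine exists_mem_ne ?_ a
    have h1 := hmiss s hsB (h.adj_of_deficient hsc hs).symm
    have h2 := hpart s
    have h3 := hdB s hsB
    omega
  obtain ⟨ha'T, ha's⟩ := mem_filter.1 ha'
  obtain ⟨-, -, -, hNa', hda', -⟩ := h.of_not_adj hdis hW hM hc hdM hTc hsc hs ha'T
    fun h' => ha's h'.symm
  -- every neighbour of `c` is the one missed by some vertex of `T`
  have hex : ∀ y, ∃ x, y ∉ T ∪ W → F.Adj c y →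
      x ∈ T ∧ ∀ z, z ∉ T ∪ W → (F.Adj x z ↔ F.Adj c z ∧ z ≠ y) := by
    intro y
    by_cases hy : y ∉ T ∪ W ∧ F.Adj c y
    swap
    · exact ⟨y, fun h1 h2 => absurd ⟨h1, h2⟩ hy⟩
    obtain ⟨hy, hcy⟩ := hy
    by_cases hys : y = s
    · subst hys; exact ⟨a, fun _ _ => ⟨ha, hNa⟩⟩
    have hay : F.Adj a y := (hNa y hy).2 ⟨hcy, hys⟩
    obtain ⟨x, hx⟩ : ({x ∈ T | ¬ F.Adj y x}).Nonempty := by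
      rw [← card_pos]
      have h1 := hmiss y hy hcy
      have h2 := hpart y
      have h3 := hdB y hy
      have h4 := h.good.bd y
      omega
    obtain ⟨hxT, hyx⟩ := mem_filter.1 hx
    have hxa : x ≠ a := by rintro rfl; exact hyx hay.symm
    -- With the deficiency moved from `s` to `y`, `of_not_adj` applies to `y` and `x`; the exchanged
    -- edges all contain `a`, so its conclusion transfers back.
    obtain ⟨h1, h2⟩ := h.stuck_move (mem_union_left _ ha) (hmemB hy).1 (hmemB hy).2 hsc hay
      (fun h' => hy (coreGraph_adj_mem h').2) has hs
    have has' : a ≠ s := by rintro rfl; exact hsB (mem_union_left _ ha)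
    have key : ∀ u z, u ≠ a → z ≠ a → ((addE (delE F a y) a s).Adj u z ↔ F.Adj u z) := by
      intro u z hu hz
      rw [addE_adj has', delE_adj]; tauto
    have hneB : ∀ z, z ∉ T ∪ W → z ≠ a := by
      rintro z hz rfl; exact hz (mem_union_left _ ha)
    have hca : c ≠ a := by rintro rfl; exact hcT ha
    obtain ⟨-, -, -, h3, -, -⟩ := h1.of_not_adj hdis hW hM hc hdM hTc (hmemB hy).2 h2 hxT
      (by rw [key x y hxa (hneB y hy)]; exact fun h' => hyx h'.symm)
    refine ⟨x, fun _ _ => ⟨hxT, fun z hz => ?_⟩⟩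
    rw [← key x z hxa (hneB z hz), ← key c z hca (hneB z hz)]
    exact h3 z hz
  choose φ hφ using hex
  have hNT : N ≤ #T := by
    rw [hN, sum_adjInd_eq_card]
    refine card_le_card_of_injOn φ ?_ ?_
    · intro y hy
      obtain ⟨hy, hcy⟩ := mem_filter.1 (mem_coe.1 hy)
      exact (hφ y (mem_compl.1 hy) hcy).1
    · intro y hy y' hy' heq
      obtain ⟨hy, hcy⟩ := mem_filter.1 (mem_coe.1 hy)
      obtain ⟨hy', hcy'⟩ := mem_filter.1 (mem_coe.1 hy')
      rw [mem_compl] at hy hy'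
      by_contra hne
      have h1 := ((hφ y hy hcy).2 y' hy').2 ⟨hcy', fun h' => hne h'.symm⟩
      rw [heq] at h1
      exact (((hφ y' hy' hcy').2 y' hy').1 h1).2 rfl
  have hB : ∀ b ∈ (T ∪ W)ᶜ, d b + 2 ≤ #T + 2 * adjInd F c b := by
    intro b hb
    rw [mem_compl] at hb
    by_cases hcb : F.Adj c b
    · rw [adjInd_of_adj hcb]; have := hdB b hb; omega
    · rw [adjInd_of_not hcb]
      have h1 : ¬ dg F b < d b := fun h' => hcb (h.adj_of_deficient (hmemB hb).2 h').symm
      have h2 := hdgT b (fun h' => hb (mem_union_left _ h')) (hmemB hb).2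
      rw [adjInd_of_not fun h' => hcb h'.symm, sum_adjInd_eq_card] at h2
      have h3 : #{x ∈ T | F.Adj b x} ≤ #((T.erase a).erase a') := by
        refine card_le_card fun x hx => ?_
        obtain ⟨hxT, hbx⟩ := mem_filter.1 hx
        refine mem_erase.2 ⟨?_, mem_erase.2 ⟨?_, hxT⟩⟩
        · rintro rfl; exact hcb ((hNa' b hb).1 hbx.symm).1
        · rintro rfl; exact hcb ((hNa b hb).1 hbx.symm).1
      rw [card_erase_of_mem (mem_erase.2 ⟨haa', ha'T⟩), card_erase_of_mem ha] at h3
      omega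
  have hsB := sum_le_sum hB
  simp only [sum_add_distrib, sum_const, smul_eq_mul, ← mul_sum, ← hN] at hsB
  have hsT : ∑ x ∈ T, d x ≤ d a + (d a' + (#T - 2) * (Fintype.card V - 1)) := by
    rw [← add_sum_erase T _ ha, ← add_sum_erase _ _ (mem_erase.2 ⟨haa', ha'T⟩)]
    gcongr
    refine (sum_le_card_nsmul _ _ (Fintype.card V - 1) fun x _ => ?_).trans ?_
    · rw [← hG x]; exact dg_le_card_sub_one G x
    · rw [card_erase_of_mem (mem_erase.2 ⟨haa', ha'T⟩), card_erase_of_mem ha, smul_eq_mul,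
        Nat.sub_sub]
  have hsW : ∑ w ∈ W, d w ≤ d c + 2 * #T := by
    rw [← add_sum_erase W _ hc]
    gcongr
    refine (sum_le_card_nsmul _ _ #T fun x hx => ?_).trans ?_
    · exact hdW x (mem_of_mem_erase hx) (ne_of_mem_erase hx)
    · rw [card_erase_of_mem hc, hW, smul_eq_mul]
  have htot : ∑ v, d v = ∑ x ∈ T, d x + ∑ w ∈ W, d w + ∑ b ∈ (T ∪ W)ᶜ, d b := by
    rw [← sum_union hdis, sum_add_sum_compl]
  have hcompl : #(T ∪ W)ᶜ = Fintype.card V - (#T + 3) := by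
    rw [card_compl, card_union_of_disjoint hdis, hW]
  rw [hcompl] at hsB
  have hsum' : (2 * (r : ℤ) - 5) * Fintype.card V - (r : ℤ) ^ 2 + 4 * r - 1 ≤
      ((∑ v, d v : ℕ) : ℤ) := by push_cast; exact hsum
  obtain ⟨k, rfl⟩ : ∃ k, r = k + 4 := ⟨r - 4, by omega⟩
  obtain ⟨e, he⟩ : ∃ e, Fintype.card V = e + (k + 5) := ⟨Fintype.card V - (k + 5), by omega⟩
  have hT' : #T = k + 2 := by omega
  rw [hT', he] at hsB hsT
  rw [he] at hn hsum'
  have e1 : e + (k + 5) - (k + 2 + 3) = e := by omega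
  have e2 : k + 2 - 2 = k := by omega
  have e3 : e + (k + 5) - 1 = e + k + 4 := by omega
  rw [e1] at hsB
  rw [e2, e3] at hsT
  -- Only `k = r - 4` degrees are unrestricted, and all but `N ≤ r - 2` outer demands are at most `r
  -- - 4`, so the sum is about `(2r-8)n`.
  have hfin : ∑ v, d v ≤ e * k + k * (e + k + 4) + 5 * N + 3 * (k + 3) + 2 * (k + 2) := by
    have : e * (k + 2) = e * k + e * 2 := by ring
    omega
  have hfin' : ((∑ v, d v : ℕ) : ℤ) ≤ (e : ℤ) * k + k * (e + k + 4) + 5 * N + 3 * (k + 3)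
      + 2 * (k + 2) := by exact_mod_cast hfin
  have hNT' : (N : ℤ) ≤ k + 2 := by rw [hT'] at hNT; exact_mod_cast hNT
  have hn' : 5 * ((k : ℤ) + 4) + 18 ≤ e + (k + 5) := by exact_mod_cast hn
  push_cast at hsum'
  nlinarith

end Stuck

/-- If `r - 2` entries are at least `r`, then some realization contains a clique on these vertices
joined to the next three vertices. -/
theorem exists_realization_join {d : V → ℕ} {G : SimpleGraph V} (hG : ∀ v, dg G v = d v)
    {T : Finset V} {u₁ u₂ u₃ : V} {r : ℕ} (hr : 6 ≤ r) (hn : 5 * r + 18 ≤ Fintype.card V)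
    (hsum : (2 * (r : ℤ) - 5) * Fintype.card V - (r : ℤ) ^ 2 + 4 * r - 1 ≤ ∑ v, (d v : ℤ))
    (hT : #T = r - 2) (hdis : Disjoint T {u₁, u₂, u₃}) (hu₁₂ : u₁ ≠ u₂) (hu₁₃ : u₁ ≠ u₃)
    (hu₂₃ : u₂ ≠ u₃) (hdT : ∀ a ∈ T, r ≤ d a) (hTu : ∀ a ∈ T, d u₁ ≤ d a) (h₁₂ : d u₂ ≤ d u₁)
    (h₂₃ : d u₃ ≤ d u₂) (hB : ∀ b, b ∉ T ∪ {u₁, u₂, u₃} → d b ≤ d u₃) (hu₃ : r - 2 ≤ d u₃) :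
    ∃ G, coreGraph T {u₁, u₂, u₃} ⊥ ≤ G ∧ ∀ v, dg G v = d v := by
  set W : Finset V := {u₁, u₂, u₃} with hWdef
  have hW : #W = 3 := card_eq_three.2 ⟨u₁, u₂, u₃, hu₁₂, hu₁₃, hu₂₃, rfl⟩
  have hmem : ∀ w, w ∈ W ↔ w = u₁ ∨ w = u₂ ∨ w = u₃ := fun w => by simp [hWdef]
  have hWd : ∀ w ∈ W, d u₃ ≤ d w ∧ d w ≤ d u₁ := by
    intro w hw
    rcases (hmem w).1 hw with rfl | rfl | rfl <;> omega
  have heven : Even (∑ v, d v) := by simp only [← hG]; exact even_sum_dg G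
  have hTc : ∀ w ∈ W, ∀ a ∈ T, d w ≤ d a := fun w hw a ha => (hWd w hw).2.trans (hTu a ha)
  have hWB : ∀ w ∈ W, ∀ b, b ∉ T ∪ W → d b ≤ d w := fun w hw b hb => (hB b hb).trans (hWd w hw).1
  obtain ⟨F, hF, -⟩ := exists_good_core hG hdis ⊥ (fun a ha => by have := hdT a ha; omega)
    (fun w hw => by
      rw [sum_adjInd_of_forall_not (fun _ _ h' => h'), hT, add_zero]
      exact hu₃.trans (hWd w hw).1)
  have hnot : ∀ w ∈ W, w ∉ T := fun w hw => disjoint_right.1 hdis hw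
  have hm₁ : u₁ ∈ W := (hmem _).2 (Or.inl rfl)
  have hm₂ : u₂ ∈ W := (hmem _).2 (Or.inr (Or.inl rfl))
  have hm₃ : u₃ ∈ W := (hmem _).2 (Or.inr (Or.inr rfl))
  have step : ∀ M c F, M ⊆ W → c ∈ W → c ∉ M → (∀ m ∈ M, d c ≤ d m) →
      Good d (coreGraph T W ⊥) (T ∪ M) F → ∃ F', Good d (coreGraph T W ⊥) (T ∪ insert c M) F' := by
    intro M c F hM hc hcM hdM hF
    have hfree : ∀ s ∉ T ∪ M, ∀ s' ∉ T ∪ M, ¬ (coreGraph T W ⊥).Adj s s' := by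
      rintro s hs s' hs' ⟨-, h' | h' | h'⟩
      · exact hs (mem_union_left _ h'.1)
      · exact hs' (mem_union_left _ h'.1)
      · exact h'.2.2
    rcases hF.exists_good_insert_or_stuck (c := c)
      (by rw [mem_union, not_or]; exact ⟨hnot c hc, hcM⟩) heven hfree with ⟨F', hF'⟩ | ⟨F', hF'⟩
    · exact ⟨F', by rwa [union_insert]⟩
    · exact (hF'.false_of_join hdis hW hM hc hdM (hTc c hc) hWB hr hT hn hsum hG).elim
  obtain ⟨F₁, hF₁⟩ := step ∅ u₁ F (empty_subset _) hm₁ (notMem_empty _) (by simp)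
    (by rwa [union_empty])
  obtain ⟨F₂, hF₂⟩ := step {u₁} u₂ F₁ (by simpa using hm₁) hm₂ (by simpa using hu₁₂.symm)
    (by simpa using h₁₂) (by simpa using hF₁)
  obtain ⟨F₃, hF₃⟩ := step {u₂, u₁} u₃ F₂ (by simp [insert_subset_iff, hm₁, hm₂]) hm₃
    (by simp [hu₂₃.symm, hu₁₃.symm]) (by simp [h₂₃, h₂₃.trans h₁₂]) (by simpa using hF₂)
  have hW3 : insert u₃ {u₂, u₁} = W := by ext w; simp only [hmem, mem_insert, mem_singleton]; tauto
  rw [hW3] at hF₃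
  have hsd : (T ∪ W) \ T = W := by
    rw [union_sdiff_left, sdiff_eq_self_of_disjoint hdis.symm]
  refine hF₃.exists_realization heven (fun x y h' => Or.inl (coreGraph_adj_mem h').1) ?_
  intro M c F hdisM hM hMs hst
  refine hst.false_of_large_core (T := T) hdisM hM hMs hr hn hsum hG (fun x y h' =>
    coreGraph_adj_mem h') subset_union_left hT (by rw [hsd, hW])
    (fun a ha x hx hne => coreGraph_adj_of_mem ha hx hne) ?_ ?_ ?_
  · rw [hsd]
    rintro w hw w' hw' h'
    exact hnot w' hw' (Stuck.coreGraph_bot_adj_of_mem_right hdis hw h')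
  · rw [hsd]; exact fun a ha w hw => hTc w hw a ha
  · intro a ha b hb
    rcases mem_union.1 ha with ha | ha
    · exact (hWB u₁ hm₁ b hb).trans (hTu a ha)
    · exact hWB a ha b hb

end Join

/-! ### Cores that meet the demands exactly. -/

section SmallCores

variable {V : Type*} [Fintype V] [DecidableEq V]

theorem sum_adjInd_map {k : ℕ} (e : Fin k ↪ V) (Γ : SimpleGraph (Fin k)) (i : Fin k) :
    ∑ x ∈ univ.map e, adjInd (Γ.map e) (e i) x = dg Γ i := by
  rw [sum_map, dg]
  refine sum_congr rfl fun j _ => ?_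
  by_cases h : Γ.Adj i j
  · rw [adjInd_of_adj h, adjInd_of_adj ((SimpleGraph.map_adj_apply).2 h)]
  · rw [adjInd_of_not h, adjInd_of_not fun h' => h ((SimpleGraph.map_adj_apply).1 h')]

theorem Good.le_dg_of_mem_right {d : V → ℕ} {F : SimpleGraph V} {T L : Finset V} {k : ℕ}
    {e : Fin k ↪ V} {Γ : SimpleGraph (Fin k)} (hF : Good d (coreGraph T (univ.map e) (Γ.map e)) L F)
    (hdis : Disjoint T (univ.map e)) (i : Fin k) : #T + dg Γ i ≤ dg F (e i) := by
  rw [← sum_adjInd_map e, ← sum_coreGraph_of_mem_right hdis (mem_map_of_mem e (mem_univ i)), dg]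
  refine (sum_le_sum fun x _ => ?_).trans (sum_le_sum_of_subset (subset_univ _))
  by_cases h : (coreGraph T (univ.map e) (Γ.map e)).Adj (e i) x
  · rw [adjInd_of_adj (hF.le h)]; exact adjInd_le_one _ _ _
  · rw [adjInd_of_not h]; exact Nat.zero_le _

/-- If the vertices of a core outside the clique have exactly the demanded degrees, and the
remaining demands are small, then some realization contains the core. -/
theorem exists_realization_of_exact {d : V → ℕ} {G : SimpleGraph V} (hG : ∀ v, dg G v = d v)
    {T : Finset V} {k r : ℕ} (e : Fin k ↪ V) (Γ : SimpleGraph (Fin k)) (hr : 6 ≤ r)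
    (hn : 5 * r + 18 ≤ Fintype.card V)
    (hsum : (2 * (r : ℤ) - 5) * Fintype.card V - (r : ℤ) ^ 2 + 4 * r - 1 ≤ ∑ v, (d v : ℤ))
    (hdis : Disjoint T (univ.map e)) (hT : #T + k = r + 1) (hk : 4 ≤ k) (hdT : ∀ a ∈ T, r ≤ d a)
    (hd : ∀ i, d (e i) = #T + dg Γ i) (hsmall : ∀ b, b ∉ T ∪ univ.map e → d b + 1 ≤ r) :
    ∃ G, coreGraph T (univ.map e) (Γ.map e) ≤ G ∧ ∀ v, dg G v = d v := by
  have hW : #(univ.map e) = k := by simp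
  have heven : Even (∑ v, d v) := by simp only [← hG]; exact even_sum_dg G
  have hd' : ∀ w ∈ univ.map e, d w = #T + ∑ x ∈ univ.map e, adjInd (Γ.map e) w x := by
    intro w hw
    obtain ⟨i, -, rfl⟩ := mem_map.1 hw
    rw [sum_adjInd_map, hd]
  obtain ⟨F, hF, -⟩ := exists_good_core hG hdis (Γ.map e)
    (fun a ha => by have := hdT a ha; omega) (fun w hw => (hd' w hw).ge)
  have hF' : Good d (coreGraph T (univ.map e) (Γ.map e)) (T ∪ univ.map e) F := by
    refine ⟨hF.le, hF.bd, fun v hv => ?_⟩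
    rcases mem_union.1 hv with hv | hv
    · exact hF.sat v hv
    · obtain ⟨i, -, rfl⟩ := mem_map.1 hv
      exact le_antisymm (hF.bd _) ((hd i).trans_le (hF.le_dg_of_mem_right hdis i))
  exact hF'.exists_realization_of_small heven hdis hr hn
    (by rw [card_union_of_disjoint hdis, hW, hT]) hsum hsmall Subset.rfl (by rw [hW]; exact hk) hd'

/-- The variant of `exists_realization_of_exact` in which one vertex of the core demands one more
neighbour. -/
theorem exists_realization_of_exact_add_one {d : V → ℕ} {G : SimpleGraph V}
    (hG : ∀ v, dg G v = d v) {T : Finset V} {k r : ℕ} (e : Fin k ↪ V) (Γ : SimpleGraph (Fin k))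
    (hr : 6 ≤ r) (hn : 5 * r + 18 ≤ Fintype.card V)
    (hsum : (2 * (r : ℤ) - 5) * Fintype.card V - (r : ℤ) ^ 2 + 4 * r - 1 ≤ ∑ v, (d v : ℤ))
    (hdis : Disjoint T (univ.map e)) (hT : #T + k = r + 1) (hk : 5 ≤ k) (hdT : ∀ a ∈ T, r ≤ d a)
    (i₀ : Fin k) (hd : ∀ i, i ≠ i₀ → d (e i) = #T + dg Γ i) (hd₀ : d (e i₀) = #T + dg Γ i₀ + 1)
    (hsmall : ∀ b, b ∉ T ∪ univ.map e → d b + 1 ≤ r) {b : V} (hb : b ∉ T ∪ univ.map e)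
    (hdb : #T + 1 ≤ d b) :
    ∃ G, coreGraph T (univ.map e) (Γ.map e) ≤ G ∧ ∀ v, dg G v = d v := by
  have hW : #(univ.map e) = k := by simp
  have heven : Even (∑ v, d v) := by simp only [← hG]; exact even_sum_dg G
  have hle : ∀ i, #T + dg Γ i ≤ d (e i) := by
    intro i
    by_cases hi : i = i₀
    · subst hi; omega
    · exact (hd i hi).ge
  obtain ⟨F, hF, hedge⟩ := exists_good_core hG hdis (Γ.map e)
    (fun a ha => by have := hdT a ha; omega) (fun w hw => by
      obtain ⟨i, -, rfl⟩ := mem_map.1 hw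
      rw [sum_adjInd_map]; exact hle i)
  have hmemW : ∀ i, e i ∈ univ.map e := fun i => mem_map_of_mem e (mem_univ i)
  have hmem : ∀ i, e i ∈ T ∪ univ.map e := fun i => mem_union_right _ (hmemW i)
  have hnot : ∀ i, e i ∉ T := fun i => disjoint_right.1 hdis (hmemW i)
  have hadj : ¬ F.Adj (e i₀) b := by
    intro h'
    rcases hedge _ _ h' with h1 | h1 | h1
    · exact hb (coreGraph_adj_mem h1).2
    · exact hnot _ h1.1
    · exact h1.2 (hmem _)
  have hne : e i₀ ≠ b := by rintro rfl; exact hb (hmem _)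
  -- The missing edge at `e i₀` goes to `b`, which so far has neighbours only in `T` and hence has
  -- room.
  have hdeg := dg_addE hne hadj
  have hdgW : ∀ i, dg F (e i) = #T + dg Γ i := by
    refine fun i => le_antisymm ?_ (hF.le_dg_of_mem_right hdis i)
    rw [← sum_adjInd_map e, ← sum_coreGraph_of_mem_right hdis (hmemW i), dg,
      ← sum_add_sum_compl (T ∪ univ.map e), sum_adjInd_of_forall_not (X := (T ∪ univ.map e)ᶜ),
      add_zero]
    · refine sum_le_sum fun x hx => ?_
      by_cases h : F.Adj (e i) x
      · rcases hedge _ _ h with h1 | h1 | h1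
        · rw [adjInd_of_adj h1]; exact adjInd_le_one _ _ _
        · exact absurd h1.1 (hnot i)
        · exact absurd (hmem i) h1.2
      · rw [adjInd_of_not h]; exact Nat.zero_le _
    · intro x hx h
      rcases hedge _ _ h with h1 | h1 | h1
      · exact (mem_compl.1 hx) (coreGraph_adj_mem h1).2
      · exact hnot i h1.1
      · exact h1.2 (hmem i)
  have hdgb : dg F b ≤ #T := by
    refine le_trans ?_ (sum_adjInd_le_card F T b)
    rw [dg, ← sum_add_sum_compl T, sum_adjInd_of_forall_not (X := Tᶜ), add_zero]
    intro x hx h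
    rcases hedge _ _ h with h1 | h1 | h1
    · exact hb (coreGraph_adj_mem h1).1
    · exact hb (mem_union_left _ h1.1)
    · exact mem_compl.1 hx h1.1
  have hneT : ∀ v ∈ T, v ≠ e i₀ ∧ v ≠ b := by
    refine fun v hv => ⟨?_, ?_⟩
    · rintro rfl; exact hnot _ hv
    · rintro rfl; exact hb (mem_union_left _ hv)
  have hF' : Good d (coreGraph T (univ.map e) (Γ.map e)) (T ∪ univ.map e)
      (addE F (e i₀) b) := by
    refine ⟨le_addE hF.le _ _, fun v => ?_, fun v hv => ?_⟩
    · rw [hdeg]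
      by_cases h1 : v = e i₀
      · subst h1
        rw [if_pos rfl, if_neg hne, hdgW]; omega
      · rw [if_neg h1]
        by_cases h2 : v = b
        · subst h2; rw [if_pos rfl]; omega
        · rw [if_neg h2]; exact hF.bd v
    · rw [hdeg]
      rcases mem_union.1 hv with hv | hv
      · rw [if_neg (hneT v hv).1, if_neg (hneT v hv).2]; exact hF.sat v hv
      · obtain ⟨i, -, rfl⟩ := mem_map.1 hv
        rw [if_neg (show e i ≠ b by rintro rfl; exact hb (hmem _)), hdgW]
        by_cases hi : i = i₀
        · subst hi; rw [if_pos rfl]; omega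
        · rw [if_neg fun h' => hi (e.injective h'), hd i hi]; omega
  -- Besides `e i₀`, at least four vertices are saturated within the core; this is why `5 ≤ k` is
  -- needed.
  refine hF'.exists_realization_of_small heven hdis hr hn
    (by rw [card_union_of_disjoint hdis, hW, hT]) hsum hsmall
    (W₀ := (univ.map e).erase (e i₀)) (erase_subset _ _)
    (by rw [card_erase_of_mem (hmemW i₀), hW]; omega) ?_
  intro w hw
  obtain ⟨hne', hw⟩ := mem_erase.1 hw
  obtain ⟨i, -, rfl⟩ := mem_map.1 hw
  rw [sum_adjInd_map]
  exact hd i fun h' => hne' (by rw [h'])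

end SmallCores

/-! ### Finding the target graph inside a core. -/

section Containment

variable {V : Type*} [Fintype V] [DecidableEq V]

/-- A core with `r + 1` vertices contains `K_{r+1} - (K_3 ∪ P_3)` if its part outside the clique
has the edges required by some placement of these vertices in `K_3 ∪ P_3`. -/
theorem completeMinus_isContained_coreGraph {r k : ℕ} (f : Fin 3 ⊕ Fin 4 ↪ Fin (r + 1))
    {T : Finset V} (e : Fin k ↪ V) {Γ : SimpleGraph (Fin k)} (hdis : Disjoint T (univ.map e))
    (hT : #T + k = r + 1) (g : Fin k ↪ Fin 3 ⊕ Fin 4)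
    (hg : ∀ i j, i ≠ j → ¬ triangleUnionPath.Adj (g i) (g j) → Γ.Adj i j) :
    (completeMinus triangleUnionPath f).IsContained (coreGraph T (univ.map e) (Γ.map e)) := by
  classical
  -- The vertices placed by `g` go to the corresponding core vertices, and all others bijectively
  -- onto the clique `T`.
  set R : Finset (Fin (r + 1)) := univ.map (g.trans f) with hR
  have hRc : #Rᶜ = #T := by
    rw [card_compl, hR, card_map, card_univ, Fintype.card_fin, Fintype.card_fin]; omega
  have hmemR : ∀ v, v ∉ Rᶜ → ∃ i, f (g i) = v := by
    intro v hv
    rw [mem_compl, not_not, hR] at hv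
    obtain ⟨i, -, hi⟩ := mem_map.1 hv
    exact ⟨i, hi⟩
  let ε := equivOfCardEq hRc
  let φ : Fin (r + 1) → V := fun v =>
    if h : v ∈ Rᶜ then (ε ⟨v, h⟩ : V) else e (hmemR v h).choose
  have hφT : ∀ v (h : v ∈ Rᶜ), φ v = (ε ⟨v, h⟩ : V) := fun v h => dif_pos h
  have hφW : ∀ v, v ∉ Rᶜ → ∃ i, f (g i) = v ∧ φ v = e i := fun v h =>
    ⟨_, (hmemR v h).choose_spec, dif_neg h⟩
  have hmemT : ∀ v ∈ Rᶜ, φ v ∈ T := fun v h => by rw [hφT v h]; exact (ε ⟨v, h⟩).2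
  have hmemW : ∀ v, v ∉ Rᶜ → φ v ∈ univ.map e := fun v h => by
    obtain ⟨i, -, hi⟩ := hφW v h
    rw [hi]; exact mem_map_of_mem e (mem_univ i)
  have hmem : ∀ v, φ v ∈ T ∪ univ.map e := fun v => by
    by_cases h : v ∈ Rᶜ
    · exact mem_union_left _ (hmemT v h)
    · exact mem_union_right _ (hmemW v h)
  have hinj : Function.Injective φ := by
    intro u v huv
    by_cases hu : u ∈ Rᶜ <;> by_cases hv : v ∈ Rᶜ
    · rw [hφT u hu, hφT v hv] at huv
      have := ε.injective (Subtype.ext huv)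
      exact congrArg Subtype.val this
    · exact absurd (huv ▸ hmemT u hu) (disjoint_right.1 hdis (hmemW v hv))
    · exact absurd (huv.symm ▸ hmemT v hv) (disjoint_right.1 hdis (hmemW u hu))
    · obtain ⟨i, hi, hi'⟩ := hφW u hu
      obtain ⟨j, hj, hj'⟩ := hφW v hv
      rw [hi', hj'] at huv
      rw [← hi, ← hj, e.injective huv]
  refine ⟨⟨⟨φ, ?_⟩, hinj⟩⟩
  intro u v huv
  have hne : φ u ≠ φ v := fun h' => huv.ne (hinj h')
  by_cases hu : u ∈ Rᶜ
  · exact coreGraph_adj_of_mem (hmemT u hu) (hmem v) hne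
  by_cases hv : v ∈ Rᶜ
  · exact (coreGraph_adj_of_mem (hmemT v hv) (hmem u) hne.symm).symm
  obtain ⟨i, hi, hi'⟩ := hφW u hu
  obtain ⟨j, hj, hj'⟩ := hφW v hv
  refine ⟨hne, Or.inr (Or.inr ⟨hmemW u hu, hmemW v hv, ?_⟩)⟩
  rw [hi', hj', SimpleGraph.map_adj_apply]
  refine hg i j (by rintro rfl; exact hne (hi'.trans hj'.symm)) fun h' => ?_
  rw [completeMinus, SimpleGraph.sdiff_adj] at huv
  refine huv.2 ?_
  rw [← hi, ← hj, SimpleGraph.map_adj_apply]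
  exact h'

end Containment

/-! ### What the degree sum forces on single entries. -/

section Sequences

theorem sum_range_le_of_antitone {δ : ℕ → ℕ} (hδ : Antitone δ) {N k a b : ℕ} (hN : ∀ i, δ i ≤ N) :
    ∑ i ∈ range (k + a + b), δ i ≤ k * N + a * δ k + b * δ (k + a) := by
  rw [sum_range_add, sum_range_add]
  refine add_le_add (add_le_add ?_ ?_) ?_
  · simpa using sum_le_card_nsmul (range k) δ N fun i _ => hN i
  · simpa using sum_le_card_nsmul (range a) (fun x => δ (k + x)) (δ k) fun i _ => hδ (by omega)
  · simpa using sum_le_card_nsmul (range b) (fun x => δ (k + a + x)) (δ (k + a))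
      fun i _ => hδ (by omega)

theorem int_sum_le_of_antitone {δ : ℕ → ℕ} (hδ : Antitone δ) {n k l B C : ℕ}
    (hN : ∀ i, δ i ≤ n - 1) (hn : 1 ≤ n) (hkl : k ≤ l) (hl : l ≤ n) (hB : δ k ≤ B) (hC : δ l ≤ C) :
    ((∑ i ∈ range n, δ i : ℕ) : ℤ) ≤
      k * ((n : ℤ) - 1) + ((l : ℤ) - k) * B + ((n : ℤ) - l) * C := by
  obtain ⟨a, rfl⟩ := Nat.exists_eq_add_of_le hkl
  obtain ⟨b, rfl⟩ := Nat.exists_eq_add_of_le hl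
  have h1 := sum_range_le_of_antitone hδ (k := k) (a := a) (b := b) hN
  have h2 : a * δ k ≤ a * B := Nat.mul_le_mul_left _ hB
  have h3 : b * δ (k + a) ≤ b * C := Nat.mul_le_mul_left _ hC
  have h4 : ∑ i ∈ range (k + a + b), δ i ≤ k * (k + a + b - 1) + a * B + b * C := by omega
  have h5 : ((k + a + b - 1 : ℕ) : ℤ) = ((k + a + b : ℕ) : ℤ) - 1 := by
    rw [Nat.cast_sub hn]; rfl
  have h6 : ((∑ i ∈ range (k + a + b), δ i : ℕ) : ℤ) ≤
      ((k * (k + a + b - 1) + a * B + b * C : ℕ) : ℤ) := by exact_mod_cast h4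
  refine h6.trans (le_of_eq ?_)
  rw [Nat.cast_add, Nat.cast_add, Nat.cast_mul, h5]
  push_cast
  ring

/-- The first `m` vertices. -/
def initial (n m : ℕ) : Finset (Fin n) := {i | i.val < m}

theorem mem_initial {n m : ℕ} {i : Fin n} : i ∈ initial n m ↔ i.val < m := by simp [initial]

theorem card_initial {n m : ℕ} (h : m ≤ n) : #(initial n m) = m := by
  rw [initial, Fin.card_filter_val_lt]; omega

/-- The vertices `m + σ 0, m + σ 1, …`. -/
def shiftEmb {n k : ℕ} (m : ℕ) (σ : Fin k → ℕ) (hσ : Function.Injective σ)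
    (h : ∀ i, m + σ i < n) : Fin k ↪ Fin n :=
  ⟨fun i => ⟨m + σ i, h i⟩, fun i j hij => hσ (by simpa using hij)⟩

theorem shiftEmb_val {n k : ℕ} (m : ℕ) (σ : Fin k → ℕ) (hσ : Function.Injective σ)
    (h : ∀ i, m + σ i < n) (i : Fin k) : (shiftEmb m σ hσ h i).val = m + σ i := rfl

theorem disjoint_initial_shiftEmb {n k : ℕ} (m : ℕ) (σ : Fin k → ℕ) (hσ : Function.Injective σ)
    (h : ∀ i, m + σ i < n) : Disjoint (initial n m) (univ.map (shiftEmb m σ hσ h)) := by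
  rw [disjoint_right]
  intro x hx hx'
  obtain ⟨i, -, rfl⟩ := mem_map.1 hx
  have : m + σ i < m := mem_initial.1 hx'
  omega

/-- The degree conditions that a sum of at least `(2 * r - 5) * n - r ^ 2 + 4 * r - 1` imposes. -/
theorem degrees_of_le_sum {n r : ℕ} (hr : 6 ≤ r) (hn : 5 * r + 18 ≤ n) {δ : ℕ → ℕ}
    (hδ : Antitone δ) {G : SimpleGraph (Fin n)} (hG : ∀ i : Fin n, dg G i = δ i)
    (hN : ∀ i, δ i ≤ n - 1)
    (hsum : (2 * (r : ℤ) - 5) * n - (r : ℤ) ^ 2 + 4 * r - 1 ≤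
      ((∑ i ∈ range n, δ i : ℕ) : ℤ)) :
    r - 1 ≤ δ (r - 3) ∧ r - 2 ≤ δ (r + 1) ∧
      (δ (r - 3) ≤ r - 1 → δ (r - 2) = r - 1) ∧
      (δ (r - 4) ≤ r - 1 → δ r = r - 1 ∧ r ≤ δ (r - 5)) := by
  obtain ⟨q, rfl⟩ : ∃ q, r = q + 6 := ⟨r - 6, by omega⟩
  have hn' : 5 * ((q : ℤ) + 6) + 18 ≤ n := by exact_mod_cast hn
  have e1 : q + 6 - 1 = q + 5 := rfl
  have e2 : q + 6 - 2 = q + 4 := rfl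
  have e3 : q + 6 - 3 = q + 3 := rfl
  have e4 : q + 6 - 4 = q + 2 := rfl
  have e5 : q + 6 - 5 = q + 1 := rfl
  rw [e1, e2, e3, e4, e5]
  -- Otherwise the sum is at most `(r-3)(n-1) + (n-r+3)(r-2)`, two below the assumed bound.
  have h1 : q + 5 ≤ δ (q + 3) := by
    by_contra hlt
    have h := int_sum_le_of_antitone hδ (k := q + 3) (l := q + 3) (B := q + 4) (C := q + 4) hN
      (by omega) le_rfl (by omega) (by omega) (by omega)
    push_cast at h hsum
    linarith
  refine ⟨h1, ?_, ?_, ?_⟩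
  · by_contra hlt
    have hc := card_initial (n := n) (m := q + 7) (by omega)
    -- Bounding the first `r + 1` entries by `n - 1` would be too weak. Erdős–Gallai bounds them
    -- through the small remaining ones, giving about `(2r-6)n`.
    have hEG := sum_dg_le G (initial n (q + 7))
    simp only [hG, hc] at hEG
    have h2 : ∀ v ∈ (initial n (q + 7))ᶜ, δ v ≤ q + 3 := by
      intro v hv
      rw [mem_compl, mem_initial] at hv
      have : δ v ≤ δ (q + 6 + 1) := hδ (by omega)
      omega
    have h3 : ∑ v ∈ (initial n (q + 7))ᶜ, min (q + 7) (δ v) ≤ (n - (q + 7)) * (q + 3) := by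
      refine (sum_le_card_nsmul _ _ (q + 3) fun v hv => (min_le_right _ _).trans (h2 v hv)).trans ?_
      rw [card_compl, hc, Fintype.card_fin, smul_eq_mul]
    have h4 : ∑ v ∈ (initial n (q + 7))ᶜ, δ v ≤ (n - (q + 7)) * (q + 3) := by
      refine (sum_le_card_nsmul _ _ (q + 3) h2).trans ?_
      rw [card_compl, hc, Fintype.card_fin, smul_eq_mul]
    have h5 : ∑ i ∈ range n, δ i = ∑ v ∈ initial n (q + 7), δ v
        + ∑ v ∈ (initial n (q + 7))ᶜ, δ v := by
      rw [sum_add_sum_compl, Fin.sum_univ_eq_sum_range]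
    obtain ⟨e, rfl⟩ : ∃ e, n = q + 7 + e := Nat.exists_eq_add_of_le (by omega)
    rw [Nat.add_sub_cancel_left] at h3 h4
    have h6 : ∑ i ∈ range (q + 7 + e), δ i ≤ (q + 7) * (q + 6) + 2 * (e * (q + 3)) := by
      have : (q + 7) * (q + 7 - 1) = (q + 7) * (q + 6) := rfl
      omega
    have h7 : ((∑ i ∈ range (q + 7 + e), δ i : ℕ) : ℤ) ≤
        ((q : ℤ) + 7) * (q + 6) + 2 * (e * (q + 3)) := by exact_mod_cast h6
    push_cast at h7 hsum hn'
    linarith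
  · intro hle
    have h2 : δ (q + 4) ≤ δ (q + 3) := hδ (by omega)
    -- One entry `r - 1` adds only one to the estimate for `h1`, which stays one short.
    by_contra hlt
    have h := int_sum_le_of_antitone hδ (k := q + 3) (l := q + 4) (B := q + 5) (C := q + 4) hN
      (by omega) (by omega) (by omega) (by omega) (by omega)
    push_cast at h hsum
    linarith
  · intro hle
    have h2 : δ (q + 6) ≤ δ (q + 2) := hδ (by omega)
    constructor
    · by_contra hlt
      have h := int_sum_le_of_antitone hδ (k := q + 2) (l := q + 6) (B := q + 5) (C := q + 4) hN
        (by omega) (by omega) (by omega) (by omega) (by omega)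
      push_cast at h hsum
      linarith
    · by_contra hlt
      have h := int_sum_le_of_antitone hδ (k := q + 1) (l := q + 1) (B := q + 5) (C := q + 5) hN
        (by omega) le_rfl (by omega) (by omega) (by omega)
      push_cast at h hsum
      linarith

end Sequences

/-! ### The three cases of the upper bound. -/

section UpperBound

/-- `K_{2,3}` with parts `{3, 4}` and `{0, 1, 2}`, and the edge `01`. -/
def houseGraph : SimpleGraph (Fin 5) where
  Adj i j := (i.val < 3 ∧ 3 ≤ j.val) ∨ (3 ≤ i.val ∧ j.val < 3) ∨ i.val + j.val = 1
  symm := ⟨fun i j h => by omega⟩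
  loopless := ⟨fun i h => by omega⟩

/-- The cycle `0123`. -/
def squareGraph : SimpleGraph (Fin 4) where
  Adj i j := i.val + 1 = j.val ∨ j.val + 1 = i.val ∨ (i.val = 0 ∧ j.val = 3) ∨
    (i.val = 3 ∧ j.val = 0)
  symm := ⟨fun i j h => by omega⟩
  loopless := ⟨fun i h => by omega⟩

theorem dg_houseGraph (i : Fin 5) : dg houseGraph i = if i = 2 then 2 else 3 := by
  fin_cases i <;> simp [dg, adjInd, houseGraph] <;> rfl

theorem dg_squareGraph (i : Fin 4) : dg squareGraph i = 2 := by
  fin_cases i <;> simp [dg, adjInd, squareGraph] <;> rfl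

theorem dg_pathGraph_four (i : Fin 4) :
    dg (SimpleGraph.pathGraph 4) i = if i = 0 ∨ i = 3 then 1 else 2 := by
  fin_cases i <;> simp [dg, adjInd, SimpleGraph.pathGraph_adj] <;> rfl

/-- The order in which the vertices of `P_3` form a path in its complement. -/
def pathComplementEmb : Fin 4 ↪ Fin 3 ⊕ Fin 4 :=
  ⟨fun i => Sum.inr (![2, 0, 3, 1] i), fun i j h => by
    revert h; fin_cases i <;> fin_cases j <;> simp⟩

theorem pathComplementEmb_apply (i : Fin 4) :
    pathComplementEmb i = Sum.inr (![2, 0, 3, 1] i) := rfl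

theorem pathComplementEmb_adj (i j : Fin 4) (hij : i ≠ j)
    (h : ¬ triangleUnionPath.Adj (pathComplementEmb i) (pathComplementEmb j)) :
    (SimpleGraph.pathGraph 4).Adj i j := by
  rw [pathComplementEmb_apply, pathComplementEmb_apply, triangleUnionPath,
    SimpleGraph.sum_adj_inr] at h
  revert hij h
  fin_cases i <;> fin_cases j <;> simp [SimpleGraph.pathGraph_adj]

/-- The triangle and an end edge of the path. -/
def triangleEdgeEmb : Fin 5 ↪ Fin 3 ⊕ Fin 4 :=
  ⟨![Sum.inl 0, Sum.inl 1, Sum.inl 2, Sum.inr 0, Sum.inr 1], fun i j h => by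
    revert h; fin_cases i <;> fin_cases j <;> simp⟩

theorem triangleEdgeEmb_apply (i : Fin 5) :
    triangleEdgeEmb i = ![Sum.inl 0, Sum.inl 1, Sum.inl 2, Sum.inr 0, Sum.inr 1] i := rfl

theorem triangleEdgeEmb_adj (i j : Fin 5) (hij : i ≠ j)
    (h : ¬ triangleUnionPath.Adj (triangleEdgeEmb i) (triangleEdgeEmb j)) :
    houseGraph.Adj i j := by
  rw [triangleEdgeEmb_apply, triangleEdgeEmb_apply] at h
  revert hij h
  fin_cases i <;> fin_cases j <;>
    simp [triangleUnionPath, houseGraph, SimpleGraph.pathGraph_adj]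

theorem map_bot_graph {k : ℕ} {V : Type*} (e : Fin k ↪ V) :
    (⊥ : SimpleGraph (Fin k)).map e = ⊥ := by
  ext x y
  simp [SimpleGraph.map_adj]

theorem potentiallyGraphic_of_coreGraph {n r k : ℕ} {d : Fin n → ℕ}
    (f : Fin 3 ⊕ Fin 4 ↪ Fin (r + 1)) {T : Finset (Fin n)} (e : Fin k ↪ Fin n)
    {Γ : SimpleGraph (Fin k)} (hdis : Disjoint T (univ.map e)) (hT : #T + k = r + 1)
    (g : Fin k ↪ Fin 3 ⊕ Fin 4)
    (hg : ∀ i j, i ≠ j → ¬ triangleUnionPath.Adj (g i) (g j) → Γ.Adj i j)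
    (h : ∃ G, coreGraph T (univ.map e) (Γ.map e) ≤ G ∧ ∀ v, dg G v = d v) :
    PotentiallyGraphic (completeMinus triangleUnionPath f) d := by
  obtain ⟨G, hle, hG⟩ := h
  refine ⟨G, fun i => by rw [dg_eq_ncard, hG], ?_⟩
  exact (completeMinus_isContained_coreGraph f e hdis hT g hg).mono_right hle

/-- A graphic sequence whose sum is at least `(2 * r - 5) * n - r ^ 2 + 4 * r - 1` is potentially
`K_{r+1} - (K_3 ∪ P_3)`-graphic. -/
theorem potentiallyGraphic_of_le_sum {n r : ℕ} (hr : 6 ≤ r) (hn : 5 * r + 18 ≤ n)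
    (f : Fin 3 ⊕ Fin 4 ↪ Fin (r + 1)) {d : Fin n → ℕ} (hd : IsGraphic d)
    (hsum : (2 * (r : ℤ) - 5) * n - (r : ℤ) ^ 2 + 4 * r - 1 ≤ ∑ i, (d i : ℤ)) :
    PotentiallyGraphic (completeMinus triangleUnionPath f) d := by
  obtain ⟨hanti, G, hreal⟩ := hd
  have hG : ∀ v, dg G v = d v := fun v => by rw [← dg_eq_ncard, hreal]
  have hcard : Fintype.card (Fin n) = n := Fintype.card_fin n
  have hn' : 5 * r + 18 ≤ Fintype.card (Fin n) := by rw [hcard]; exact hn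
  have hsum' : (2 * (r : ℤ) - 5) * Fintype.card (Fin n) - (r : ℤ) ^ 2 + 4 * r - 1 ≤
      ∑ i, (d i : ℤ) := by rw [hcard]; exact hsum
  obtain ⟨δ, hδ, hdδ⟩ : ∃ δ : ℕ → ℕ, Antitone δ ∧ ∀ i : Fin n, d i = δ i := by
    refine ⟨fun j => if h : j < n then d ⟨j, h⟩ else 0, fun i j hij => ?_, fun i => ?_⟩
    · by_cases hj : j < n
      · simp only [dif_pos hj, dif_pos (hij.trans_lt hj)]
        exact hanti hij
      · simp only [dif_neg hj]; exact Nat.zero_le _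
    · simp only [dif_pos i.2]
  have hN : ∀ i, δ i ≤ n - 1 := by
    intro i
    refine (hδ (Nat.zero_le i)).trans ?_
    have := dg_le_card_sub_one G ⟨0, by omega⟩
    rwa [hG, hdδ, hcard] at this
  have hsumδ : ((∑ i ∈ range n, δ i : ℕ) : ℤ) = ∑ i, (d i : ℤ) := by
    rw [← Fin.sum_univ_eq_sum_range]
    push_cast
    exact sum_congr rfl fun i _ => by rw [hdδ]
  obtain ⟨h1, h2, h3, h4⟩ := degrees_of_le_sum hr hn hδ (fun i => by rw [hG, hdδ]) hN
    (by rw [hsumδ]; exact hsum)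
  have hle : ∀ i j, i ≤ j → δ j ≤ δ i := fun i j h => hδ h
  by_cases hA : r ≤ δ (r - 3)
  · have hσ : Function.Injective (fun i : Fin 3 => i.val) := Fin.val_injective
    have hlt : ∀ i : Fin 3, r - 2 + i.val < n := fun i => by omega
    have hdis := disjoint_initial_shiftEmb (r - 2) _ hσ hlt
    have hTc := card_initial (n := n) (m := r - 2) (by omega)
    refine potentiallyGraphic_of_coreGraph (Γ := ⊥) f _ hdis (by omega)
      Function.Embedding.inl (fun i j hij h => h ?_) ?_
    · simpa [triangleUnionPath] using hij
    have hW : univ.map (shiftEmb (r - 2) _ hσ hlt) =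
        {⟨r - 2, by omega⟩, ⟨r - 1, by omega⟩, ⟨r, by omega⟩} := by
      ext x
      simp only [mem_map, mem_univ, true_and, mem_insert, mem_singleton, Fin.ext_iff,
        shiftEmb_val]
      constructor
      · rintro ⟨i, hi⟩; have := i.2; omega
      · intro hx; exact ⟨⟨x.val - (r - 2), by omega⟩,
          show r - 2 + (x.val - (r - 2)) = x.val by omega⟩
    rw [map_bot_graph]
    rw [hW] at hdis ⊢
    refine exists_realization_join hG hr hn' hsum' hTc hdis ?_ ?_ ?_ ?_ ?_ ?_ ?_ ?_ ?_
    · simp only [ne_eq, Fin.mk.injEq]; omega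
    · simp only [ne_eq, Fin.mk.injEq]; omega
    · simp only [ne_eq, Fin.mk.injEq]; omega
    · intro a ha
      rw [mem_initial] at ha
      rw [hdδ]
      exact hA.trans (hle _ _ (by omega))
    · intro a ha
      rw [mem_initial] at ha
      exact hanti (Fin.mk_le_mk.2 (by omega) : a ≤ ⟨r - 2, by omega⟩)
    · exact hanti (Fin.mk_le_mk.2 (by omega))
    · exact hanti (Fin.mk_le_mk.2 (by omega))
    · intro b hb
      rw [mem_union, mem_initial, not_or, ← hW] at hb
      rw [hdδ, hdδ]
      refine hle _ _ ?_
      simp only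
      by_contra hlt'
      exact hb.2 (mem_map.2 ⟨⟨b.val - (r - 2), by omega⟩, mem_univ _, Fin.ext
        (show r - 2 + (b.val - (r - 2)) = b.val by omega)⟩)
    · rw [hdδ]
      exact h2.trans (hle _ _ (by simp only; omega))
  have hsmall : ∀ (m : ℕ) (W : Finset (Fin n)), δ m ≤ r - 1 →
      ∀ b, b ∉ initial n m ∪ W → d b + 1 ≤ r := by
    intro m W hm b hb
    rw [mem_union, mem_initial, not_or] at hb
    have := hle m b (by omega)
    rw [hdδ]; omega
  have hlarge : ∀ m : ℕ, r ≤ δ m → ∀ a ∈ initial n (m + 1), r ≤ d a := by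
    intro m hm a ha
    rw [mem_initial] at ha
    rw [hdδ]; exact hm.trans (hle _ _ (by omega))
  by_cases hB : r ≤ δ (r - 4)
  · have hr4 : r - 4 + 1 = r - 3 := by omega
    have hTc := card_initial (n := n) (m := r - 3) (by omega)
    have main : ∀ (σ : Fin 4 → ℕ) (Γ : SimpleGraph (Fin 4)), Function.Injective σ →
        (∀ i, σ i ≤ 4) → (∀ i, δ (r - 3 + σ i) = r - 3 + dg Γ i) →
        SimpleGraph.pathGraph 4 ≤ Γ →
        PotentiallyGraphic (completeMinus triangleUnionPath f) d := by
      intro σ Γ hσ hσ4 hdeg hpath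
      have hlt : ∀ i, r - 3 + σ i < n := fun i => by have := hσ4 i; omega
      have hdis := disjoint_initial_shiftEmb (r - 3) σ hσ hlt
      refine potentiallyGraphic_of_coreGraph (Γ := Γ) f _ hdis (by omega) pathComplementEmb
        (fun i j hij h => hpath (pathComplementEmb_adj i j hij h)) ?_
      refine exists_realization_of_exact hG _ Γ hr hn' hsum' hdis (by omega) le_rfl ?_ ?_
        (hsmall _ _ (by omega))
      · rw [← hr4]; exact hlarge _ hB
      · intro i
        rw [hdδ, hTc]; exact hdeg i
    have e3 := h3 (by omega)
    have a1 := hle (r - 3) (r - 2) (by omega)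
    have a2 := hle (r - 2) (r - 1) (by omega)
    have a3 := hle (r - 1) r (by omega)
    have a4 := hle r (r + 1) (by omega)
    have s0 : r - 3 + 0 = r - 3 := rfl
    have s1 : r - 3 + 1 = r - 2 := by omega
    have s2 : r - 3 + 2 = r - 1 := by omega
    have s3 : r - 3 + 3 = r := by omega
    have s4 : r - 3 + 4 = r + 1 := by omega
    -- A core vertex with two neighbours among the four has degree `r - 1`, and an end of the path
    -- `r - 2`. Four demands `r - 1` call for the 4-cycle; otherwise the path has inner vertices `r
    -- - 3` and `r - 2`.
    by_cases hC : δ r = r - 1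
    · refine main (fun i => i.val) squareGraph Fin.val_injective (fun i => by omega) ?_ ?_
      · intro i
        rw [dg_squareGraph]
        fin_cases i <;> simp only [s0, s1, s2, s3] <;> omega
      · intro i j h
        rw [SimpleGraph.pathGraph_adj] at h
        change _ ∨ _ ∨ _
        tauto
    by_cases hD : δ (r - 1) = r - 1
    · refine main ![3, 0, 1, 4] (SimpleGraph.pathGraph 4) (by decide) (by decide) ?_ le_rfl
      intro i
      rw [dg_pathGraph_four]
      fin_cases i <;> simp [s0, s1, s3, s4] <;> omega
    · refine main ![2, 0, 1, 3] (SimpleGraph.pathGraph 4) (by decide) (by decide) ?_ le_rfl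
      intro i
      rw [dg_pathGraph_four]
      fin_cases i <;> simp [s0, s1, s2, s3] <;> omega
  -- Vertices `r - 4, …, r` all demand `r - 1`. The core provides this except at vertex `2` of
  -- `houseGraph`, which gets one edge to vertex `r + 1`.
  · obtain ⟨e4, e5⟩ := h4 (by omega)
    have hr5 : r - 5 + 1 = r - 4 := by omega
    have hTc := card_initial (n := n) (m := r - 4) (by omega)
    have hσ : Function.Injective (fun i : Fin 5 => i.val) := Fin.val_injective
    have hlt : ∀ i : Fin 5, r - 4 + i.val < n := fun i => by omega
    have hdis := disjoint_initial_shiftEmb (r - 4) _ hσ hlt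
    have hdeg : ∀ i : Fin 5, d (shiftEmb (r - 4) _ hσ hlt i) = r - 1 := by
      intro i
      rw [hdδ]
      have a1 := hle (r - 4) (r - 4 + i.val) (by omega)
      have a2 := hle (r - 4 + i.val) r (by omega)
      change δ (r - 4 + i.val) = r - 1
      omega
    refine potentiallyGraphic_of_coreGraph (Γ := houseGraph) f _ hdis (by omega) triangleEdgeEmb
      triangleEdgeEmb_adj ?_
    refine exists_realization_of_exact_add_one hG _ houseGraph hr hn' hsum' hdis (by omega) le_rfl
      ?_ 2 ?_ ?_ (hsmall _ _ (by omega)) (b := ⟨r + 1, by omega⟩) ?_ ?_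
    · rw [← hr5]; exact hlarge _ e5
    · intro i hi
      rw [hdeg, hTc, dg_houseGraph, if_neg hi]; omega
    · rw [hdeg, hTc, dg_houseGraph, if_pos rfl]; omega
    · rw [mem_union, mem_initial, mem_map, not_or]
      refine ⟨by simp only; omega, ?_⟩
      rintro ⟨i, -, hi⟩
      have h5 : r - 4 + i.val = r + 1 := congrArg Fin.val hi
      omega
    · rw [hdδ, hTc]
      refine le_trans ?_ h2
      omega

end UpperBound

/-! ### The extremal sequence. -/

section LowerBound

theorem adjInd_congr {V V' : Type*} {F : SimpleGraph V} {F' : SimpleGraph V'} {v w : V} {v' w' : V'}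
    (h : F.Adj v w ↔ F'.Adj v' w') : adjInd F v w = adjInd F' v' w' := by
  by_cases h' : F.Adj v w
  · rw [adjInd_of_adj h', adjInd_of_adj (h.1 h')]
  · rw [adjInd_of_not h', adjInd_of_not fun h'' => h' (h.2 h'')]

theorem sum_adjInd_pathGraph_four (X : Finset (Fin 4)) :
    ∑ x ∈ X, ∑ y ∈ X, adjInd (SimpleGraph.pathGraph 4) x y ≤ 2 * (#X - 1) := by
  have h : ∀ X : Finset (Fin 4), ∑ x ∈ X, ∑ y ∈ X,
      (if x.val + 1 = y.val ∨ y.val + 1 = x.val then 1 else 0) ≤ 2 * (#X - 1) := by decide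
  refine le_of_eq_of_le (sum_congr rfl fun x _ => sum_congr rfl fun y _ => ?_) (h X)
  by_cases h' : (SimpleGraph.pathGraph 4).Adj x y
  · rw [adjInd_of_adj h', if_pos (SimpleGraph.pathGraph_adj.1 h')]
  · rw [adjInd_of_not h', if_neg fun hn => h' (SimpleGraph.pathGraph_adj.2 hn)]

/-- At most four vertices of `K_3 ∪ P_3` span at most three edges. -/
theorem sum_adjInd_triangleUnionPath {X : Finset (Fin 3 ⊕ Fin 4)} (hX : #X ≤ 4) :
    ∑ x ∈ X, ∑ y ∈ X, adjInd triangleUnionPath x y ≤ 6 := by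
  have hc : #X.toLeft + #X.toRight = #X := card_toLeft_add_card_toRight
  rw [← toLeft_disjSum_toRight (u := X)]
  simp only [sum_disjSum]
  have h1 : ∀ x y, adjInd triangleUnionPath (Sum.inl x) (Sum.inr y) = 0 := fun x y =>
    adjInd_of_not (by simp [triangleUnionPath])
  have h2 : ∀ x y, adjInd triangleUnionPath (Sum.inr y) (Sum.inl x) = 0 := fun x y =>
    adjInd_of_not (by simp [triangleUnionPath])
  have h3 : ∀ x y, adjInd triangleUnionPath (Sum.inr x) (Sum.inr y) =
      adjInd (SimpleGraph.pathGraph 4) x y := fun x y =>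
    adjInd_congr SimpleGraph.sum_adj_inr
  have h4 : ∀ x y, adjInd triangleUnionPath (Sum.inl x) (Sum.inl y) =
      adjInd (⊤ : SimpleGraph (Fin 3)) x y := fun x y =>
    adjInd_congr SimpleGraph.sum_adj_inl
  simp only [h1, h2, h3, h4, sum_const_zero, add_zero, zero_add]
  have h5 := sum_adjInd_pathGraph_four X.toRight
  have h6 : ∑ x ∈ X.toLeft, ∑ y ∈ X.toLeft, adjInd (⊤ : SimpleGraph (Fin 3)) x y ≤
      #X.toLeft * (#X.toLeft - 1) := by
    rw [← smul_eq_mul]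
    exact sum_le_card_nsmul _ _ _ fun x hx => sum_adjInd_le_card_sub_one _ hx
  have h7 : #X.toLeft ≤ 3 := by simpa using card_le_univ X.toLeft
  have h8 : #X.toLeft * (#X.toLeft - 1) + 2 * (#X.toRight - 1) ≤ 6 := by
    generalize #X.toLeft = a at *
    generalize #X.toRight = b at *
    interval_cases a <;> omega
  omega

/-- Any four vertices of `K_{r+1} - (K_3 ∪ P_3)` span at least three edges. -/
theorem six_le_sum_adjInd_completeMinus {m : ℕ} (f : Fin 3 ⊕ Fin 4 ↪ Fin m) {Q : Finset (Fin m)}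
    (hQ : #Q = 4) :
    6 ≤ ∑ u ∈ Q, ∑ v ∈ Q, adjInd (completeMinus triangleUnionPath f) u v := by
  classical
  set X : Finset (Fin 3 ⊕ Fin 4) := {x | f x ∈ Q} with hX
  have hsub : X.map f ⊆ Q := by
    intro u hu
    obtain ⟨x, hx, rfl⟩ := mem_map.1 hu
    exact (mem_filter.1 hx).2
  have hout : ∀ u ∈ Q, u ∉ X.map f → ∀ v, ¬ (triangleUnionPath.map f).Adj u v := by
    intro u hu hnot v h
    obtain ⟨x, y, -, rfl, -⟩ := (SimpleGraph.map_adj _ _ _ _).1 h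
    exact hnot (mem_map_of_mem f (mem_filter.2 ⟨mem_univ _, hu⟩))
  have h1 : ∑ u ∈ Q, ∑ v ∈ Q, adjInd (triangleUnionPath.map f) u v ≤ 6 := by
    rw [← sum_subset hsub fun u hu hnot => sum_adjInd_of_forall_not fun v _ => hout u hu hnot v]
    refine le_of_eq_of_le (b := ∑ u ∈ X.map f, ∑ v ∈ X.map f, adjInd (triangleUnionPath.map f) u v)
      (sum_congr rfl fun u _ => ?_) ?_
    · exact (sum_subset hsub fun v hv hnot => adjInd_of_not fun h => hout v hv hnot u h.symm).symm
    · simp only [sum_map]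
      refine le_of_eq_of_le (sum_congr rfl fun x _ => sum_congr rfl fun y _ => ?_)
        (sum_adjInd_triangleUnionPath (X := X) ?_)
      · exact adjInd_congr SimpleGraph.map_adj_apply
      · exact (card_map f).symm.trans_le ((card_le_card hsub).trans hQ.le)
  have h2 : ∀ u ∈ Q, 3 ≤ ∑ v ∈ Q, adjInd (completeMinus triangleUnionPath f) u v +
      ∑ v ∈ Q, adjInd (triangleUnionPath.map f) u v := by
    intro u hu
    have h3 := sum_adjInd_of_forall_ne (F := (⊤ : SimpleGraph (Fin m))) hu
      fun w _ hne => hne.symm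
    rw [← sum_add_distrib]
    refine le_trans (by rw [h3, hQ]) (sum_le_sum fun v _ => ?_)
    by_cases huv : u = v
    · subst huv; rw [adjInd_self]; exact Nat.zero_le _
    refine (adjInd_le_one _ _ _).trans ?_
    by_cases h : (triangleUnionPath.map f).Adj u v
    · rw [adjInd_of_adj h]; exact Nat.le_add_left _ _
    · rw [adjInd_of_adj (F := completeMinus triangleUnionPath f) ⟨huv, h⟩]
      exact Nat.le_add_right _ _
  have h4 := card_nsmul_le_sum Q _ 3 h2
  rw [sum_add_distrib, hQ, smul_eq_mul] at h4
  omega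

/-- A sequence with `r - 3` dominating vertices, whose other vertices have degree at most `r - 2`
with one exception of degree `r - 1`, is not potentially `K_{r+1} - (K_3 ∪ P_3)`-graphic. -/
theorem not_potentiallyGraphic {n r : ℕ} (hr : 6 ≤ r) (f : Fin 3 ⊕ Fin 4 ↪ Fin (r + 1))
    {d : Fin n → ℕ} {T : Finset (Fin n)} (hT : #T = r - 3) (hdT : ∀ a ∈ T, d a = n - 1)
    (x₀ : Fin n) (hd : ∀ x, x ∉ T → d x ≤ r - 2 + if x = x₀ then 1 else 0) :
    ¬ PotentiallyGraphic (completeMinus triangleUnionPath f) d := by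
  classical
  rintro ⟨G, hreal, ⟨φ⟩⟩
  have hG : ∀ v, dg G v = d v := fun v => by rw [← dg_eq_ncard, hreal]
  have hadj : ∀ a ∈ T, ∀ x, x ≠ a → G.Adj a x := by
    intro a ha x hne
    by_contra hn
    have h1 : dg G a ≤ #((univ.erase a).erase x) := by
      rw [dg, sum_adjInd_eq_card]
      refine card_le_card fun w hw => ?_
      have := (mem_filter.1 hw).2
      refine mem_erase.2 ⟨?_, mem_erase.2 ⟨this.ne', mem_univ _⟩⟩
      rintro rfl; exact hn this
    rw [hG, hdT a ha, card_erase_of_mem (mem_erase.2 ⟨hne, mem_univ _⟩),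
      card_erase_of_mem (mem_univ _), card_univ, Fintype.card_fin] at h1
    have := x.2
    have := a.2
    have : a.val ≠ x.val := fun h => hne (Fin.ext h.symm)
    omega
  have hout : ∀ x, x ∉ T → ∑ w ∈ Tᶜ, adjInd G x w ≤ 1 + if x = x₀ then 1 else 0 := by
    intro x hx
    have h1 := hd x hx
    rw [← hG, dg, ← sum_add_sum_compl T, sum_adjInd_of_forall fun a ha =>
      (hadj a ha x (by rintro rfl; exact hx ha)).symm] at h1
    omega
  have hinj : Function.Injective φ := φ.injective
  have hcard : 4 ≤ #{u : Fin (r + 1) | φ u ∉ T} := by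
    have h1 := card_filter_add_card_filter_not (s := (univ : Finset (Fin (r + 1))))
      (fun u => φ u ∈ T)
    have h2 : #{u : Fin (r + 1) | φ u ∈ T} ≤ #T :=
      card_le_card_of_injOn φ (fun u hu => (mem_filter.1 (mem_coe.1 hu)).2) hinj.injOn
    rw [card_univ, Fintype.card_fin] at h1
    omega
  obtain ⟨Q, hQ, hQ4⟩ := exists_subset_card_eq hcard
  have h1 := six_le_sum_adjInd_completeMinus f hQ4
  have hQT : ∀ u ∈ Q, φ u ∉ T := fun u hu => (mem_filter.1 (hQ hu)).2
  have h2 : ∀ u ∈ Q, ∑ v ∈ Q, adjInd (completeMinus triangleUnionPath f) u v ≤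
      1 + if φ u = x₀ then 1 else 0 := by
    intro u hu
    refine le_trans ?_ (hout (φ u) (hQT u hu))
    refine le_trans ?_ (sum_le_sum_of_subset (s := Q.map ⟨φ, hinj⟩) ?_)
    · rw [sum_map]
      refine sum_le_sum fun v _ => ?_
      by_cases h : (completeMinus triangleUnionPath f).Adj u v
      · have h' : adjInd G (φ u) (φ v) = 1 := adjInd_of_adj (φ.toHom.map_adj h)
        exact (adjInd_le_one _ _ _).trans h'.ge
      · rw [adjInd_of_not h]; exact Nat.zero_le _
    · intro x hx
      obtain ⟨v, hv, rfl⟩ := mem_map.1 hx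
      exact mem_compl.2 (hQT v hv)
  -- Four vertices of the copy outside `T` have degree sum at most `4 + 1` among themselves, but six
  -- is needed.
  have h3 := sum_le_sum h2
  rw [sum_add_distrib, sum_const, hQ4, ← card_filter] at h3
  have h4 : #{u ∈ Q | φ u = x₀} ≤ 1 := by
    rw [card_le_one]
    intro u hu v hv
    exact hinj ((mem_filter.1 hu).2.trans (mem_filter.1 hv).2.symm)
  simp only [smul_eq_mul] at h3
  omega

/-- `m` dominating vertices, joined to a graph on the remaining ones, which is given by a relation
on the natural numbers. -/
def dominatedGraph (n m : ℕ) (P : ℕ → ℕ → Prop) (hP : ∀ i j, P i j → P j i) :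
    SimpleGraph (Fin n) where
  Adj i j := i ≠ j ∧ (i.val < m ∨ j.val < m ∨ P (i.val - m) (j.val - m))
  symm := ⟨fun i j h => ⟨h.1.symm, by have := hP (i.val - m) (j.val - m); tauto⟩⟩
  loopless := ⟨fun _ h => h.1 rfl⟩

theorem dg_dominatedGraph_of_lt {n m : ℕ} {P : ℕ → ℕ → Prop} {hP : ∀ i j, P i j → P j i}
    {i : Fin n} (hi : i.val < m) : dg (dominatedGraph n m P hP) i = n - 1 := by
  rw [dg, sum_adjInd_of_forall_ne (F := dominatedGraph n m P hP) (mem_univ i) fun w _ hne => ⟨hne.symm, Or.inl hi⟩, card_univ,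
    Fintype.card_fin]

theorem dg_dominatedGraph_of_le {n m : ℕ} {P : ℕ → ℕ → Prop} {hP : ∀ i j, P i j → P j i}
    {i : Fin n} (hi : m ≤ i.val) (Y : Finset ℕ) (hY : ∀ j ∈ Y, m + j < n)
    (hYP : ∀ j, m + j < n → ((j ≠ i.val - m ∧ P (i.val - m) j) ↔ j ∈ Y)) :
    dg (dominatedGraph n m P hP) i = m + #Y := by
  classical
  rw [dg, ← sum_add_sum_compl (initial n m), sum_adjInd_of_forall, card_initial (hi.trans i.2.le),
    sum_adjInd_eq_card]
  · congr 1
    refine card_bij (fun j _ => j.val - m) ?_ ?_ ?_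
    · intro j hj
      rw [mem_filter, mem_compl, mem_initial] at hj
      obtain ⟨hjm, hne, h | h | h⟩ := hj
      · omega
      · omega
      · refine (hYP _ (by have := j.2; omega)).1 ⟨fun h' => hne (Fin.ext (by omega)), h⟩
    · intro j hj j' hj' heq
      rw [mem_filter, mem_compl, mem_initial] at hj hj'
      exact Fin.ext (by omega)
    · intro j hj
      obtain ⟨h1, h2⟩ := (hYP j (hY j hj)).2 hj
      refine ⟨⟨m + j, hY j hj⟩, ?_, by simp⟩
      rw [mem_filter, mem_compl, mem_initial]
      refine ⟨by simp, fun h => h1 ?_, Or.inr (Or.inr ?_)⟩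
      · rw [h]; simp
      · simpa using h2
  · intro w hw
    rw [mem_initial] at hw
    exact ⟨fun h => by rw [h] at hi; omega, Or.inr (Or.inl hw)⟩

/-- The sequence with `m` entries `n - 1`, and the remaining ones `m + 1`, except that the first
of them is `m + 1 + ε`. -/
def extremalSeq (n m ε : ℕ) (i : Fin n) : ℕ :=
  if i.val < m then n - 1 else m + 1 + if i.val = m then ε else 0

theorem extremalSeq_antitone {n m ε : ℕ} (h : m + 2 + ε ≤ n) : Antitone (extremalSeq n m ε) := by
  intro i j hij
  have hij' : i.val ≤ j.val := hij
  unfold extremalSeq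
  split_ifs <;> omega

theorem sum_extremalSeq {n m ε : ℕ} (h : m < n) :
    ∑ i, (extremalSeq n m ε i : ℤ) = m * ((n : ℤ) - 1) + ((n : ℤ) - m) * (m + 1) + ε := by
  have h1 : ∑ i, extremalSeq n m ε i = m * (n - 1) + (n - m) * (m + 1) + ε := by
    unfold extremalSeq
    rw [Fin.sum_univ_eq_sum_range
      (fun i => if i < m then n - 1 else m + 1 + if i = m then ε else 0) n]
    obtain ⟨e, rfl⟩ := Nat.exists_eq_add_of_le h.le
    rw [sum_range_add, sum_congr rfl fun x hx => if_pos (mem_range.1 hx),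
      sum_congr rfl (s₁ := range e) fun x _ => if_neg (by omega : ¬ m + x < m), sum_add_distrib,
      Nat.add_sub_cancel_left]
    have h2 : ∑ x ∈ range e, (if m + x = m then ε else 0) = ε := by
      rw [sum_eq_single_of_mem 0 (mem_range.2 (by omega)) fun x _ hx => if_neg (by omega)]
      simp
    rw [h2]
    simp
    ring
  rw [← Nat.cast_sum, h1]
  push_cast [h.le, show 1 ≤ n by omega]
  ring

theorem isGraphic_extremalSeq {n m : ℕ} (h : m + 6 ≤ n) :
    IsGraphic (extremalSeq n m (if Even (n - m) then 0 else 1)) := by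
  by_cases hpar : Even (n - m)
  · rw [if_pos hpar]
    refine ⟨extremalSeq_antitone (by omega), dominatedGraph n m (fun i j => i / 2 = j / 2)
      fun i j h => h.symm, fun i => ?_⟩
    rw [dg_eq_ncard]
    obtain ⟨k, hk⟩ := hpar
    by_cases hi : i.val < m
    · rw [dg_dominatedGraph_of_lt hi, extremalSeq, if_pos hi]
    · have hin := i.2
      rw [extremalSeq, if_neg hi]
      by_cases hodd : (i.val - m) % 2 = 0
      · rw [dg_dominatedGraph_of_le (by omega) {i.val - m + 1}]
        · simp
        · simp only [mem_singleton]; omega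
        · intro j hj; rw [mem_singleton]; omega
      · rw [dg_dominatedGraph_of_le (by omega) {i.val - m - 1}]
        · simp
        · simp only [mem_singleton]; omega
        · intro j hj; rw [mem_singleton]; omega
  · rw [if_neg hpar]
    -- The path `1, 0, 2` and the pairs `{3, 4}, {5, 6}, …`.
    refine ⟨extremalSeq_antitone (by omega), dominatedGraph n m (fun i j =>
      (i = 0 ∧ (j = 1 ∨ j = 2)) ∨ (j = 0 ∧ (i = 1 ∨ i = 2)) ∨
        (3 ≤ i ∧ 3 ≤ j ∧ (i + 1) / 2 = (j + 1) / 2)) fun i j h => by omega, fun i => ?_⟩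
    rw [dg_eq_ncard]
    obtain ⟨k, hk⟩ := Nat.not_even_iff_odd.1 hpar
    by_cases hi : i.val < m
    · rw [dg_dominatedGraph_of_lt hi, extremalSeq, if_pos hi]
    · have hin := i.2
      rw [extremalSeq, if_neg hi]
      by_cases h0 : i.val = m
      · rw [if_pos h0, dg_dominatedGraph_of_le (by omega) {1, 2}]
        · simp
        · simp only [mem_insert, mem_singleton]; omega
        · intro j hj; simp only [mem_insert, mem_singleton]; omega
      · rw [if_neg h0]
        by_cases h3 : i.val - m < 3
        · rw [dg_dominatedGraph_of_le (by omega) {0}]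
          · simp
          · simp only [mem_singleton]; omega
          · intro j hj; rw [mem_singleton]; omega
        by_cases hodd : (i.val - m) % 2 = 0
        · rw [dg_dominatedGraph_of_le (by omega) {i.val - m - 1}]
          · simp
          · simp only [mem_singleton]; omega
          · intro j hj; rw [mem_singleton]; omega
        · rw [dg_dominatedGraph_of_le (by omega) {i.val - m + 1}]
          · simp
          · simp only [mem_singleton]; omega
          · intro j hj; rw [mem_singleton]; omega

end LowerBound

theorem theorem1p1 (r n : ℕ) (hr : 6 ≤ r) (hn : 5 * r + 18 ≤ n)
    (f : Fin 3 ⊕ Fin 4 ↪ Fin (r + 1)) :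
    IsSigma (completeMinus triangleUnionPath f) n
      (if Odd ((n : ℤ) - (r : ℤ)) then
        ((r : ℤ) - 1) * (2 * (n : ℤ) - (r : ℤ)) - 3 * ((n : ℤ) - (r : ℤ)) - 1
      else
        ((r : ℤ) - 1) * (2 * (n : ℤ) - (r : ℤ)) - 3 * ((n : ℤ) - (r : ℤ))) := by
  -- The parity correction in the value is the same `ε` as in the extremal sequence.
  have hpar : ∃ ε : ℕ, (if Even (n - (r - 3)) then 0 else 1) = ε ∧
      (if Odd ((n : ℤ) - (r : ℤ)) then
        ((r : ℤ) - 1) * (2 * (n : ℤ) - (r : ℤ)) - 3 * ((n : ℤ) - (r : ℤ)) - 1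
      else ((r : ℤ) - 1) * (2 * (n : ℤ) - (r : ℤ)) - 3 * ((n : ℤ) - (r : ℤ))) =
        (2 * (r : ℤ) - 5) * n - (r : ℤ) ^ 2 + 4 * r - 1 + ε ∧ ε ≤ 1 := by
    by_cases h : Odd ((n : ℤ) - (r : ℤ))
    · refine ⟨0, if_pos ?_, ?_, Nat.zero_le _⟩
      · obtain ⟨k, hk⟩ := h
        exact ⟨(k + 2).toNat, by omega⟩
      · rw [if_pos h]; push_cast; ring
    · refine ⟨1, if_neg ?_, ?_, le_rfl⟩
      · rintro ⟨k, hk⟩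
        exact h ⟨(k : ℤ) - 2, by omega⟩
      · rw [if_neg h]; push_cast; ring
  have heven : Even (if Odd ((n : ℤ) - (r : ℤ)) then
        ((r : ℤ) - 1) * (2 * (n : ℤ) - (r : ℤ)) - 3 * ((n : ℤ) - (r : ℤ)) - 1
      else ((r : ℤ) - 1) * (2 * (n : ℤ) - (r : ℤ)) - 3 * ((n : ℤ) - (r : ℤ))) := by
    have h0 : Even (((r : ℤ) - 1) * (2 * (n : ℤ) - (r : ℤ))) := by
      rcases Int.even_or_odd (r : ℤ) with h | h
      · exact ((even_two_mul (n : ℤ)).sub h).mul_left _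
      · exact (h.sub_odd odd_one).mul_right _
    split_ifs with h
    · rw [sub_sub]
      refine h0.sub ?_
      obtain ⟨k, hk⟩ := h
      exact ⟨3 * k + 2, by rw [hk]; ring⟩
    · exact h0.sub ((Int.not_odd_iff_even.1 h).mul_left _)
  obtain ⟨ε, hε, hval, hε1⟩ := hpar
  rw [hval] at heven ⊢
  refine ⟨⟨heven, fun d hd hsum => potentiallyGraphic_of_le_sum hr hn f hd (by linarith)⟩, ?_⟩
  rintro l ⟨hl, hall⟩
  by_contra! hlt
  -- Both numbers are even, so `l` drops by two, to at most the sum of the extremal sequence.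
  have hl2 : l ≤ (2 * (r : ℤ) - 5) * n - (r : ℤ) ^ 2 + 4 * r - 1 + ε - 2 := by
    obtain ⟨k, hk⟩ := hl
    obtain ⟨k', hk'⟩ := heven
    omega
  have hgr := isGraphic_extremalSeq (n := n) (m := r - 3) (by omega)
  rw [hε] at hgr
  refine not_potentiallyGraphic hr f (T := initial n (r - 3)) (card_initial (by omega)) ?_
    ⟨r - 3, by omega⟩ ?_ (hall _ hgr ?_)
  · intro a ha
    rw [extremalSeq, if_pos (mem_initial.1 ha)]
  · intro x hx
    rw [mem_initial] at hx
    rw [extremalSeq, if_neg hx]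
    simp only [Fin.ext_iff]
    split_ifs <;> omega
  · rw [sum_extremalSeq (by omega)]
    refine hl2.trans (le_of_eq ?_)
    push_cast [show 3 ≤ r by omega]
    ring
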